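/- A hypergraph $H=(V,E)$ consists of a finite set $V$ of vertices and a set $E$ of subsets of $V$ (hyperedges). Its rank is the maximum size of a hyperedge. A transversal is a set $T\subseteq V$ that meets every hyperedge; it is minimal if no proper subset of it is a transversal. The degree $d(v)$ is the number of hyperedges containing $v$, and $d_2(v)$ is the number of hyperedges of size $2$ containing $v$. Consider the following recursive algorithm. An instance is a hypergraph $(V,E)$ with a set $S$ of already selected vertices; initially $(V,E)$ is the input hypergraph and $S=\emptyset$. To *select* $v$ means to add $v$ to $S$, to remove $v$ from $V$ and to remove all hyperedges containing $v$ from $E$. To *discard* $v$ means to remove $v$ from $V$ and from all hyperedges (hyperedges that become equal are identified). The first applicable rule of the following list is applied, and the algorithm recurses on each of the resulting instances. 1. If $\emptyset\in E$: stop, without output. 2. If $E=\emptyset$: output $S$ if $S$ is a minimal transversal of the input hypergraph, and stop. 3. If there is a vertex $v\in V$ with $d(v)=0$: discard $v$. 4. If some $e_1\in E$ is a proper subset of some $e_2\in E$ with $|e_2|=3$: remove $e_2$ from $E$. 5. If there is a hyperedge $\{v\}$: select $v$. 6. If there is a vertex $v$ with $d(v)=1$, let $e$ be the hyperedge containing $v$.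 - If $e=\{v,u\}$: branch into (i) select $v$, discard $u$; (ii) discard $v$. - If $|e|=3$ and all vertices of $e$ have degree $1$: branch into three instances; in each, one vertex of $e$ is selected and the other two are discarded. - If $e=\{v,u,w\}$ and $u$ or $w$ has degree at least $2$: branch into (i) select $v$, discard $u$ and $w$; (ii) discard $v$. 7. If there is a hyperedge of size $2$: let $v$ have maximum degree among the vertices maximizing $d_2$. Branch into (i) select $v$; (ii) discard $v$ and select every $u$ with $\{v,u\}\in E$. 8. Otherwise all hyperedges have size $3$; let $v$ be a vertex of maximum degree. - If $d(v)\ge 3$: branch into (i) select $v$; (ii) discard $v$. - If $d(v)=2$ and some $u\ne v$ lies in both hyperedges containing $v$: branch into (i) select $v$, discard $u$; (ii) discard $v$. - If $d(v)=2$ and the hyperedges containing $v$ are $\{v,u_1,w_1\}$ and $\{v,u_2,w_2\}$ with no other common vertex: branch into (i) select $v$ and $u_1$, discard $u_2$ and $w_2$; (ii) select $v$, discard $u_1$; (iii) discard $v$. **Theorem.** On every $n$-vertex hypergraph of rank at most $3$ (in particular, of rank $3$), given by lists of its vertices and hyperedges, this algorithm outputs every minimal transversal exactly once and nothing else, in time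 $O(1.6755^n)$, where time is the number of elementary steps (comparisons of two vertices and single steps in walking through lists). Consequently, an $n$-vertex hypergraph of rank at most $3$ has at most $O(1.6755^n)$ minimal transversals. The implied constants are absolute. -/

import Mathlib

/-! ### Hypergraphs: rank and transversals -/

namespace Hypergraph

/-- The rank of a hypergraph: the maximum size of a hyperedge. -/
noncomputable def rank {α : Type} (H : Hypergraph α) : ℕ∞ :=
  ⨆ e ∈ H.edgeSet, e.encard

/-- A transversal: a set of vertices that meets every hyperedge. -/
def IsTransversal {α : Type} (H : Hypergraph α) (T : Set α) : Prop :=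
  T ⊆ H.vertexSet ∧ ∀ e ∈ H.edgeSet, (e ∩ T).Nonempty

/-- An inclusion-minimal transversal. -/
def IsMinimalTransversal {α : Type} (H : Hypergraph α) (T : Set α) : Prop :=
  Minimal H.IsTransversal T

/-- The lists `V` (of vertices) and `E` (of hyperedges, each given as a list of vertices) describe
the hypergraph `H`, every vertex and every hyperedge being listed exactly once. -/
structure IsListedBy {α : Type} (H : Hypergraph α) (V : List α) (E : List (List α)) : Prop where
  nodup_vertices : V.Nodup
  mem_vertices : ∀ x, x ∈ V ↔ x ∈ H.vertexSet
  nodup_edge : ∀ e ∈ E, e.Nodup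
  nodup_edges : (E.map fun e => {x | x ∈ e}).Nodup
  mem_edges : ∀ s : Set α, s ∈ H.edgeSet ↔ ∃ e ∈ E, {x | x ∈ e} = s

end Hypergraph

namespace TransversalEnum

/-! ### Computations with a step count

A value of type `Timed β` is the result of a computation together with the number of elementary
steps made. A comparison of two vertices is one step; each call of a list primitive is one step,
and so is each recursive call made while it walks through its list. All loops are written with the
primitives below, so that only a bounded number of operations on list cells, Booleans and
numbers takes place between two counted steps. -/

structure Timed (β : Type) where
  val : β
  time : ℕ

instance : Monad Timed where
  pure b := ⟨b, 0⟩
  bind x f := ⟨(f x.val).val, x.time + (f x.val).time⟩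

/-- The computation `x`, preceded by one elementary step. -/
def step {β : Type} (x : Timed β) : Timed β := ⟨x.val, x.time + 1⟩

section Primitives

variable {β γ : Type}

/-- Does some element of the list satisfy `p`? -/
def anyT (p : β → Timed Bool) : List β → Timed Bool
  | [] => step (pure false)
  | b :: l => step do if ← p b then pure true else anyT p l

/-- Do all elements of the list satisfy `p`? -/
def allT (p : β → Timed Bool) : List β → Timed Bool
  | [] => step (pure true)
  | b :: l => step do if ← p b then allT p l else pure false

/-- The first element of the list that satisfies `p`, if there is one. -/
def findT (p : β → Timed Bool) : List β → Timed (Option β)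
  | [] => step (pure none)
  | b :: l => step do if ← p b then pure (some b) else findT p l

/-- The elements of the list that satisfy `p`. -/
def filterT (p : β → Timed Bool) : List β → Timed (List β)
  | [] => step (pure [])
  | b :: l => step do
      let c ← p b
      let l' ← filterT p l
      pure (if c then b :: l' else l')

/-- The number of elements of the list that satisfy `p`. -/
def countT (p : β → Timed Bool) : List β → Timed ℕ
  | [] => step (pure 0)
  | b :: l => step do
      let c ← p b
      let k ← countT p l
      pure (if c then k + 1 else k)

/-- The length of the list. -/
def lengthT : List β → Timed ℕ
  | [] => step (pure 0)
  | _ :: l => step do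
      let k ← lengthT l
      pure (k + 1)

/-- Apply `f` to every element of the list. -/
def mapT (f : β → Timed γ) : List β → Timed (List γ)
  | [] => step (pure [])
  | b :: l => step do
      let c ← f b
      let l' ← mapT f l
      pure (c :: l')

/-- Concatenation of two lists. -/
def appendT : List β → List β → Timed (List β)
  | [], m => step (pure m)
  | b :: l, m => step do
      let l' ← appendT l m
      pure (b :: l')

/-- Apply `f` to every element of the list and concatenate the resulting lists. -/
def flatMapT (f : β → Timed (List γ)) : List β → Timed (List γ)
  | [] => step (pure [])
  | b :: l => step do
      let m ← f b
      let m' ← flatMapT f l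
      appendT m m'

/-- An element of the list with the maximum value of `f`, and this value (`none` for the empty
list). -/
def argmaxT (f : β → Timed ℕ) : List β → Timed (Option (β × ℕ))
  | [] => step (pure none)
  | b :: l => step do
      let k ← f b
      match ← argmaxT f l with
      | none => pure (some (b, k))
      | some (b', k') => pure (if k' ≤ k then some (b, k) else some (b', k'))

end Primitives

section Algorithm

variable {α : Type} [DecidableEq α]

/-- Comparison of two vertices. -/
def eqT (x y : α) : Timed Bool := step (pure (decide (x = y)))

def neT (x y : α) : Timed Bool := do
  let b ← eqT x y
  pure (!b)

/-- Is the vertex `x` contained in `e`? -/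
def memT (x : α) (e : List α) : Timed Bool := anyT (eqT x) e

def subsetT (e f : List α) : Timed Bool := allT (fun x => memT x f) e

/-- Are `e` and `f` the same set? -/
def sameSetT (e f : List α) : Timed Bool := do
  if ← subsetT e f then subsetT f e else pure false

/-- Is `e` a proper subset of `f`? -/
def ssubsetT (e f : List α) : Timed Bool := do
  if ← subsetT e f then
    let b ← subsetT f e
    pure (!b)
  else pure false

/-- Has the list length `k`? -/
def hasSizeT (k : ℕ) (e : List α) : Timed Bool := do
  let n ← lengthT e
  pure (n == k)

/-- Remove all but one of several hyperedges that are the same set. -/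
def dedupT : List (List α) → Timed (List (List α))
  | [] => step (pure [])
  | e :: E => step do
      let E' ← dedupT E
      if ← anyT (sameSetT e) E' then pure E' else pure (e :: E')

/-- Degree of the vertex `v`. -/
def degreeT (E : List (List α)) (v : α) : Timed ℕ := countT (memT v) E

/-- Has the vertex `v` degree `k`? -/
def hasDegreeT (E : List (List α)) (k : ℕ) (v : α) : Timed Bool := do
  let d ← degreeT E v
  pure (d == k)

/-- Is `e` a hyperedge of size 2 that contains `v`? -/
def isPairAtT (v : α) (e : List α) : Timed Bool := do
  if ← hasSizeT 2 e then memT v e else pure false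

/-- Number of hyperedges of size 2 that contain `v`. -/
def degreeTwoT (E : List (List α)) (v : α) : Timed ℕ := countT (isPairAtT v) E

/-- Does `e` contain both `v` and `u`? -/
def containsBothT (v u : α) (e : List α) : Timed Bool := do
  if ← memT v e then memT u e else pure false

/-- Is `{v, u}` a hyperedge, with `u ≠ v`? -/
def isPairPartnerT (E : List (List α)) (v u : α) : Timed Bool := do
  if ← neT v u then
    anyT (fun e => do if ← isPairAtT v e then memT u e else pure false) E
  else pure false

/-- Does the set `T` of vertices meet every member of `E`? -/
def hitsAllT (E : List (List α)) (T : List α) : Timed Bool :=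
  allT (anyT (fun x => memT x T)) E

/-- Is the set `T` of vertices a minimal transversal for `E`: it meets all members of `E`, and
it no longer does so when any one of its elements is removed? -/
def isMinimalT (E : List (List α)) (T : List α) : Timed Bool := do
  if ← hitsAllT E T then
    allT (fun v => do
      let T' ← filterT (neT v) T
      let b ← hitsAllT E T'
      pure (!b)) T
  else pure false

/-- An instance of a recursive call: the vertices that may still be selected, the hyperedges that
still have to be hit, and the vertices that have been selected so far. -/
structure Inst (α : Type) where
  V : List α
  E : List (List α)
  S : List α

/-- Select `v`: put it into `S`, remove it from `V`, and remove the hyperedges containing it. -/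
def selectT (v : α) (I : Inst α) : Timed (Inst α) := do
  let V ← filterT (neT v) I.V
  let E ← filterT (fun e => do
    let b ← memT v e
    pure (!b)) I.E
  pure ⟨V, E, v :: I.S⟩

/-- Discard `v`: remove it from `V` and from all hyperedges (which form a set: hyperedges that
become equal are merged). -/
def discardT (v : α) (I : Inst α) : Timed (Inst α) := do
  let V ← filterT (neT v) I.V
  let E ← mapT (filterT (neT v)) I.E
  let E ← dedupT E
  pure ⟨V, E, I.S⟩

/-- Select all vertices of a list, one after the other. -/
def selectAllT : List α → Inst α → Timed (Inst α)
  | [], I => step (pure I)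
  | v :: l, I => step do
      let J ← selectT v I
      selectAllT l J

/-- Discard all vertices of a list, one after the other. -/
def discardAllT : List α → Inst α → Timed (Inst α)
  | [], I => step (pure I)
  | v :: l, I => step do
      let J ← discardT v I
      discardAllT l J

/-- What a rule does: halt with a list of transversals to output, or recurse into subinstances. -/
inductive Outcome (α : Type) where
  | halt (out : List (List α))
  | branch (subinstances : List (Inst α))

/-- Branching at a vertex `v` of degree 1, where `e` is the hyperedge that contains it. -/
def branchDegreeOne (I : Inst α) (v : α) (e : List α) : Timed (Outcome α) := do
  match ← filterT (neT v) e with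
  | [u] =>
    let J₁ ← selectT v I
    let J₁ ← discardT u J₁
    let J₂ ← discardT v I
    pure (.branch [J₁, J₂])
  | [u, w] =>
    let du ← degreeT I.E u
    let dw ← degreeT I.E w
    if du = 1 ∧ dw = 1 then
      let J₁ ← selectT v I
      let J₁ ← discardAllT [u, w] J₁
      let J₂ ← selectT u I
      let J₂ ← discardAllT [v, w] J₂
      let J₃ ← selectT w I
      let J₃ ← discardAllT [v, u] J₃
      pure (.branch [J₁, J₂, J₃])
    else
      let J₁ ← selectT v I
      let J₁ ← discardAllT [u, w] J₁
      let J₂ ← discardT v I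
      pure (.branch [J₁, J₂])
  -- impossible for hyperedges of size 2 or 3
  | _ => pure (.halt [])

/-- Branching when there is a hyperedge of size 2. The vertex `v` has maximum degree among the
vertices in a maximum number of hyperedges of size 2. It is either selected, or discarded, and then
all vertices that form a hyperedge of size 2 with it are selected. -/
def branchPair (I : Inst α) : Timed (Outcome α) := do
  match ← argmaxT (degreeTwoT I.E) I.V with
  | some (_, k) =>
    let C ← filterT (fun x => do
      let d ← degreeTwoT I.E x
      pure (d == k)) I.V
    match ← argmaxT (degreeT I.E) C with
    | some (v, _) =>
      let U ← filterT (isPairPartnerT I.E v) I.V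
      let J₁ ← selectT v I
      let J₂ ← discardT v I
      let J₂ ← selectAllT U J₂
      pure (.branch [J₁, J₂])
    -- impossible, because `C` is not empty
    | none => pure (.halt [])
  -- impossible, because `I.V` is not empty
  | none => pure (.halt [])

/-- Branching when all hyperedges have size 3: `v` is a vertex of maximum degree. -/
def branchTriple (I : Inst α) : Timed (Outcome α) := do
  match ← argmaxT (degreeT I.E) I.V with
  | some (v, d) =>
    if 3 ≤ d then
      let J₁ ← selectT v I
      let J₂ ← discardT v I
      pure (.branch [J₁, J₂])
    else
      -- a vertex that shares two hyperedges with `v`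
      let u? ← findT (fun u => do
        if ← neT v u then
          let k ← countT (containsBothT v u) I.E
          pure (k == 2)
        else pure false) I.V
      match u? with
      | some u =>
        let J₁ ← selectT v I
        let J₁ ← discardT u J₁
        let J₂ ← discardT v I
        pure (.branch [J₁, J₂])
      | none =>
        let F ← filterT (memT v) I.E
        match ← mapT (filterT (neT v)) F with
        | [[u₁, _], [u₂, w₂]] =>
          let J₀ ← selectT v I
          let J₁ ← selectT u₁ J₀
          let J₁ ← discardAllT [u₂, w₂] J₁
          let J₂ ← discardT u₁ J₀
          let J₃ ← discardT v I
          pure (.branch [J₁, J₂, J₃])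
        -- impossible, because `v` has degree 2 and all hyperedges have size 3
        | _ => pure (.halt [])
  -- impossible, because `I.V` is not empty
  | none => pure (.halt [])

/-- The first applicable rule, applied to the instance `I`; the list `E₀` holds the hyperedges of
the input hypergraph. -/
def applyRule (E₀ : List (List α)) (I : Inst α) : Timed (Outcome α) := do
  -- an empty hyperedge: there is nothing to enumerate
  if ← anyT (hasSizeT 0) I.E then pure (.halt []) else
  -- no hyperedge remains: output `S` if it is a minimal transversal of the input
  if I.E.isEmpty then
    if ← isMinimalT E₀ I.S then pure (.halt [I.S]) else pure (.halt [])
  else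
  -- a vertex of degree 0: discard it
  match ← findT (hasDegreeT I.E 0) I.V with
  | some v =>
    let J ← discardT v I
    pure (.branch [J])
  | none =>
  -- a hyperedge of size 3 with another hyperedge as a subset: remove it
  match ← findT (fun f => do
      if ← hasSizeT 3 f then anyT (fun e => ssubsetT e f) I.E else pure false) I.E with
  | some f =>
    let E ← filterT (fun e => do
      let b ← sameSetT e f
      pure (!b)) I.E
    pure (.branch [⟨I.V, E, I.S⟩])
  | none =>
  -- a hyperedge of size 1: select its vertex
  match ← findT (hasSizeT 1) I.E with
  | some e =>
    let J ← selectAllT e I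
    pure (.branch [J])
  | none =>
  -- a vertex of degree 1
  match ← findT (hasDegreeT I.E 1) I.V with
  | some v =>
    match ← findT (memT v) I.E with
    | some e => branchDegreeOne I v e
    -- impossible, because `v` has degree 1
    | none => pure (.halt [])
  | none =>
  if ← anyT (hasSizeT 2) I.E then branchPair I else branchTriple I

/-- The search tree: apply a rule, and solve the resulting subinstances recursively. The natural
number bounds the depth of the recursion. -/
def search (E₀ : List (List α)) : ℕ → Inst α → Timed (List (List α))
  | 0, _ => step (pure [])
  | depth + 1, I => step do
      match ← applyRule E₀ I with
      | .halt out => pure out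
      | .branch subinstances => flatMapT (search E₀ depth) subinstances

/-- The algorithm on the hypergraph with vertices `V` and hyperedges `E`, starting from `S = ∅`.
Each recursive call decreases the number of vertices plus hyperedges, so that
the bound on the depth of the recursion is never reached. -/
def enumerate (V : List α) (E : List (List α)) : Timed (List (List α)) :=
  search E (V.length + E.length + 1) ⟨V, E, []⟩

end Algorithm

end TransversalEnum

/-!
An instance is measured by a product over its core, the inclusion-minimal hyperedges with at least
two elements: a factor between 1 and 67/40 for every vertex, depending on its degree, times a factor
between 1 and 3/2 that is smaller the more hyperedges of size 2 there are. Removing supersets and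
selecting singletons do not change the core, and at every branching the measures of the new
instances add up to at most the measure of the old one: selecting `v` lowers the degrees of its
neighbors, while discarding `v` turns hyperedges of size 3 into hyperedges of size 2. Since the
measure is at least 1, the search tree has at most `3 / 2 * (67 / 40) ^ n` leaves; its depth and the
cost of a single rule are polynomial in `n`, and `67 / 40 < 1.6755` absorbs the polynomial. The
instances of a branching partition the solutions, because every element of a minimal transversal is
its only element in some hyperedge, and this excludes the choices that a rule leaves out.
-/

namespace TransversalEnum

/-! ### Families of finite sets -/

section Families

open Finset

variable {α : Type*} [DecidableEq α]

/-- The number of members of `F` that contain `v`. -/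
def degree (F : Finset (Finset α)) (v : α) : ℕ := #{e ∈ F | v ∈ e}

/-- The number of members of `F` that contain both `u` and `v`. -/
def codegree (F : Finset (Finset α)) (u v : α) : ℕ := #{e ∈ F | u ∈ e ∧ v ∈ e}

/-- The vertices other than `v` that share a member of `F` with `v`. -/
def neighbors (F : Finset (Finset α)) (v : α) : Finset α :=
  ({e ∈ F | v ∈ e}.biUnion id).erase v

/-- The members of size 2, the graph part of `F`. -/
def pairs (F : Finset (Finset α)) : Finset (Finset α) := {e ∈ F | #e = 2}

/-- The neighbors of `v` in the graph part of `F`. -/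
def partners (F : Finset (Finset α)) (v : α) : Finset α :=
  {u ∈ F.biUnion id | u ≠ v ∧ {v, u} ∈ F}

/-- What remains of `F` after selecting all elements of `P` and discarding all elements of `D`. -/
def restrict (F : Finset (Finset α)) (P D : Finset α) : Finset (Finset α) :=
  {e ∈ F | Disjoint e P}.image (· \ D)

/-- The inclusion-minimal members that have at least two elements. These are the hyperedges that
survive the rules for empty sets, supersets and singletons, so that a quantity computed from
the core is not affected by these rules. -/
def core (F : Finset (Finset α)) : Finset (Finset α) :=
  {e ∈ F | 2 ≤ #e ∧ ∀ f ∈ F, f ⊆ e → f = e}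

/-- An antichain of sets with at least two elements each: a family that equals its core. -/
structure IsClutter (F : Finset (Finset α)) : Prop where
  two_le_card : ∀ e ∈ F, 2 ≤ #e
  eq_of_subset : ∀ e ∈ F, ∀ f ∈ F, f ⊆ e → f = e

variable {F G : Finset (Finset α)} {P D : Finset α} {u v x : α}

omit [DecidableEq α] in
lemma mem_pairs {e : Finset α} : e ∈ pairs F ↔ e ∈ F ∧ #e = 2 := mem_filter

lemma mem_partners : u ∈ partners F v ↔ u ≠ v ∧ {v, u} ∈ F := by
  simp only [partners, mem_filter, mem_biUnion, id, and_iff_right_iff_imp]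
  exact fun h => ⟨_, h.2, by simp⟩

lemma notMem_partners_self (F : Finset (Finset α)) (v : α) : v ∉ partners F v :=
  fun h => (mem_partners.1 h).1 rfl

lemma mem_restrict {s : Finset α} :
    s ∈ restrict F P D ↔ ∃ e ∈ F, Disjoint e P ∧ e \ D = s := by
  simp [restrict, and_assoc]

lemma mem_core {e : Finset α} : e ∈ core F ↔ e ∈ F ∧ 2 ≤ #e ∧ ∀ f ∈ F, f ⊆ e → f = e :=
  mem_filter

lemma IsClutter.core_eq (hF : IsClutter F) : core F = F :=
  filter_true_of_mem fun e he => ⟨hF.two_le_card e he, hF.eq_of_subset e he⟩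

lemma degree_mono (h : F ⊆ G) (v : α) : degree F v ≤ degree G v :=
  card_le_card (filter_subset_filter _ h)

lemma degree_pairs_le (F : Finset (Finset α)) (v : α) : degree (pairs F) v ≤ degree F v :=
  degree_mono (filter_subset _ _) v

lemma degree_le_card (F : Finset (Finset α)) (v : α) : degree F v ≤ #F :=
  card_le_card (filter_subset _ _)

lemma degree_pos_of_mem {e : Finset α} (he : e ∈ F) (hv : v ∈ e) : 0 < degree F v :=
  card_pos.2 ⟨e, mem_filter.2 ⟨he, hv⟩⟩

lemma degree_eq_zero_iff : degree F v = 0 ↔ ∀ e ∈ F, v ∉ e := by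
  rw [degree, card_eq_zero, filter_eq_empty_iff]

lemma degree_eq_zero_of_notMem (h : v ∉ F.biUnion id) : degree F v = 0 :=
  degree_eq_zero_iff.2 fun e he hv => h (mem_biUnion.2 ⟨e, he, hv⟩)

lemma eq_of_degree_eq_one (hv : degree F v = 1) {e f : Finset α} (he : e ∈ F) (hve : v ∈ e)
    (hf : f ∈ F) (hvf : v ∈ f) : e = f :=
  card_le_one.1 hv.le e (mem_filter.2 ⟨he, hve⟩) f (mem_filter.2 ⟨hf, hvf⟩)

lemma mem_of_degree_eq_one (hv : degree F v = 1) {e : Finset α} (he : e ∈ F) (hve : v ∈ e)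
    (hue : u ∈ e) : ∀ f ∈ F, v ∈ f → u ∈ f :=
  fun _ hf hvf => eq_of_degree_eq_one hv he hve hf hvf ▸ hue

lemma codegree_le_degree (F : Finset (Finset α)) (u v : α) : codegree F u v ≤ degree F v :=
  card_le_card (monotone_filter_right F fun _ _ h => h.2)

lemma codegree_eq_degree_iff : codegree F v u = degree F v ↔ ∀ e ∈ F, v ∈ e → u ∈ e := by
  rw [codegree, degree, ← filter_filter, card_filter_eq_iff]
  simp only [mem_filter, and_imp]

/-- Double counting of the pairs of a neighbor of `v` and a hyperedge that contains both. -/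
lemma sum_codegree_neighbors {r : ℕ} (hr : ∀ e ∈ F, #e = r + 1) (v : α) :
    ∑ x ∈ neighbors F v, codegree F v x = r * degree F v := by
  have h := sum_card_bipartiteAbove_eq_sum_card_bipartiteBelow
    (s := neighbors F v) (t := {e ∈ F | v ∈ e}) (fun x e => x ∈ e)
  simp only [bipartiteAbove, bipartiteBelow, filter_filter] at h
  have hcard : ∀ e ∈ {e ∈ F | v ∈ e}, #{x ∈ neighbors F v | x ∈ e} = r := by
    intro e he
    obtain ⟨heF, hve⟩ := mem_filter.1 he
    have herase : {x ∈ neighbors F v | x ∈ e} = e.erase v := by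
      ext x
      simp only [neighbors, mem_filter, mem_erase, mem_biUnion, id]
      exact ⟨fun hx => ⟨hx.1.1, hx.2⟩, fun hx => ⟨⟨hx.1, e, ⟨heF, hve⟩, hx.2⟩, hx.2⟩⟩
    rw [herase, card_erase_of_mem hve, hr e heF, Nat.add_sub_cancel]
  unfold codegree
  rw [h, sum_const_nat hcard, mul_comm, degree]

lemma card_le_card_disjoint_add_sum_degree (F : Finset (Finset α)) (U : Finset α) :
    #F ≤ #{e ∈ F | Disjoint e U} + ∑ u ∈ U, degree F u := by
  rw [← card_filter_add_card_filter_not (s := F) (fun e => Disjoint e U)]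
  gcongr
  refine (card_le_card (t := U.biUnion fun u => {e ∈ F | u ∈ e}) fun e he => ?_).trans
    card_biUnion_le
  obtain ⟨heF, h⟩ := mem_filter.1 he
  obtain ⟨u, hue, huU⟩ := Finset.not_disjoint_iff.1 h
  exact mem_biUnion.2 ⟨u, huU, mem_filter.2 ⟨heF, hue⟩⟩

lemma exists_mem_partners_of_mem_pairs {e : Finset α} (he : e ∈ pairs F) (hv : v ∈ e) :
    ∃ u ∈ partners F v, e = {v, u} := by
  obtain ⟨heF, hc⟩ := mem_pairs.1 he
  obtain ⟨u, hu⟩ := card_eq_one.1 (show #(e.erase v) = 1 by rw [card_erase_of_mem hv, hc])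
  have huv : u ∈ e.erase v := hu ▸ mem_singleton_self u
  have heq : e = {v, u} := by rw [← hu, insert_erase hv]
  exact ⟨u, mem_partners.2 ⟨(mem_erase.1 huv).1, heq ▸ heF⟩, heq⟩

lemma pair_mem_pairs_of_mem_partners (hu : u ∈ partners F v) : {v, u} ∈ pairs F :=
  have h := mem_partners.1 hu
  mem_pairs.2 ⟨h.2, card_pair h.1.symm⟩

lemma card_partners (F : Finset (Finset α)) (v : α) : #(partners F v) = degree (pairs F) v := by
  refine card_bij (fun u _ => {v, u}) (fun u hu => ?_) (fun a ha b _ hab => ?_) fun e he => ?_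
  · exact mem_filter.2 ⟨pair_mem_pairs_of_mem_partners hu, mem_insert_self _ _⟩
  · have hmem : a ∈ ({v, b} : Finset α) := hab ▸ (by simp)
    simpa [(mem_partners.1 ha).1] using hmem
  · obtain ⟨hep, hv⟩ := mem_filter.1 he
    obtain ⟨u, hu, rfl⟩ := exists_mem_partners_of_mem_pairs hep hv
    exact ⟨u, hu, rfl⟩

lemma partners_eq_empty (hv : degree (pairs F) v = 0) : partners F v = ∅ := by
  rw [← card_eq_zero, card_partners, hv]

lemma partners_eq_singleton (hv : degree F v = 1) (huv : u ≠ v) (he : {v, u} ∈ F) :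
    partners F v = {u} := by
  ext x
  rw [mem_partners, mem_singleton]
  refine ⟨fun ⟨hx, hxe⟩ => ?_, ?_⟩
  · have hpair := eq_of_degree_eq_one hv he (by simp) hxe (by simp)
    have hmem : x ∈ ({v, u} : Finset α) := hpair ▸ (by simp)
    simpa [hx] using hmem
  · rintro rfl
    exact ⟨huv, he⟩

lemma degree_pairs_eq_zero (hv : degree F v = 1) {e : Finset α} (he : e ∈ F) (hve : v ∈ e)
    (hc : #e ≠ 2) : degree (pairs F) v = 0 :=
  degree_eq_zero_iff.2 fun f hf hvf => hc <| by
    rw [eq_of_degree_eq_one hv he hve (mem_pairs.1 hf).1 hvf, (mem_pairs.1 hf).2]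

lemma degree_eq_card_triples_add_card_partners (hF : IsClutter F) (h3 : ∀ e ∈ F, #e ≤ 3) (v : α) :
    degree F v = #{e ∈ F | v ∈ e ∧ #e = 3} + #(partners F v) := by
  have hpairs : {e ∈ pairs F | v ∈ e} = {e ∈ F | v ∈ e ∧ ¬#e = 3} := by
    ext e
    simp only [mem_filter, mem_pairs]
    refine ⟨fun ⟨⟨he, _⟩, hv⟩ => ⟨he, hv, by omega⟩, fun ⟨he, hv, hc⟩ => ⟨⟨he, ?_⟩, hv⟩⟩
    have := h3 e he
    have := hF.two_le_card e he
    omega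
  rw [card_partners, degree, degree, hpairs,
    ← card_filter_add_card_filter_not (s := {e ∈ F | v ∈ e}) (fun e => #e = 3), filter_filter,
    filter_filter]

lemma core_erase_of_ssubset {e f : Finset α} (he : e ∈ F) (hf : e ⊂ f) :
    core (F.erase f) = core F := by
  ext g
  simp only [mem_core, mem_erase]
  constructor
  · rintro ⟨⟨hg, hgF⟩, hc, hm⟩
    refine ⟨hgF, hc, fun h hh hs => ?_⟩
    by_cases hhf : h = f
    · subst hhf
      obtain rfl := hm e ⟨hf.ne, he⟩ (hf.subset.trans hs)
      exact absurd hs (not_subset_of_ssubset hf)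
    · exact hm h ⟨hhf, hh⟩ hs
  · rintro ⟨hgF, hc, hm⟩
    refine ⟨⟨?_, hgF⟩, hc, fun h hh hs => hm h hh.2 hs⟩
    rintro rfl
    exact hf.ne (hm e he hf.subset)

lemma core_restrict_of_singletons_mem (h : ∀ u ∈ P, {u} ∈ F) : core (restrict F P ∅) = core F := by
  ext g
  simp only [mem_core, mem_restrict, sdiff_empty]
  constructor
  · rintro ⟨⟨e, heF, hP, rfl⟩, hc, hm⟩
    exact ⟨heF, hc, fun f hf hs => hm f ⟨f, hf, hP.mono_left hs, rfl⟩ hs⟩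
  · rintro ⟨hgF, hc, hm⟩
    refine ⟨⟨g, hgF, Finset.disjoint_left.2 fun u hu huP => ?_, rfl⟩, hc, ?_⟩
    · rw [← hm _ (h u huP) (singleton_subset_iff.2 hu), card_singleton] at hc
      omega
    · rintro f ⟨f', hf, -, rfl⟩ hs
      exact hm _ hf hs

lemma restrict_eq_self (hP : ∀ e ∈ F, Disjoint e P) (hD : ∀ e ∈ F, Disjoint e D) :
    restrict F P D = F := by
  rw [restrict, filter_true_of_mem hP]
  exact (image_congr fun e he => sdiff_eq_self_of_disjoint (hD e he)).trans image_id

lemma restrict_empty (F : Finset (Finset α)) : restrict F ∅ ∅ = F :=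
  restrict_eq_self (fun _ _ => disjoint_empty_right _) fun _ _ => disjoint_empty_right _

lemma restrict_restrict {P' D' : Finset α} (h : Disjoint D P') :
    restrict (restrict F P D) P' D' = restrict F (P ∪ P') (D ∪ D') := by
  have hdisj : ∀ e : Finset α, Disjoint (e \ D) P' ↔ Disjoint e P' := fun e => by
    rw [disjoint_sdiff_comm, sdiff_eq_self_of_disjoint h.symm]
  ext g
  simp only [mem_restrict, disjoint_union_right]
  constructor
  · rintro ⟨_, ⟨e, he, hP, rfl⟩, hP', rfl⟩
    exact ⟨e, he, ⟨hP, (hdisj e).1 hP'⟩, by rw [sdiff_sdiff_left, sup_eq_union]⟩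
  · rintro ⟨e, he, hP, rfl⟩
    exact ⟨e \ D, ⟨e, he, hP.1, rfl⟩, (hdisj e).2 hP.2, by rw [sdiff_sdiff_left, sup_eq_union]⟩

lemma core_restrict_partners (F : Finset (Finset α)) (v : α) :
    core (restrict F (partners F v) {v}) = core (restrict F ∅ {v}) := by
  have h : restrict (restrict F ∅ {v}) (partners F v) ∅ = restrict F (partners F v) {v} := by
    rw [restrict_restrict (disjoint_singleton_left.2 (notMem_partners_self F v)), empty_union,
      union_empty]
  rw [← h]
  refine core_restrict_of_singletons_mem fun u hu => ?_
  obtain ⟨huv, he⟩ := mem_partners.1 hu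
  refine mem_restrict.2 ⟨_, he, disjoint_empty_right _, ?_⟩
  rw [insert_sdiff_of_mem _ (mem_singleton_self v),
    sdiff_eq_self_of_disjoint (disjoint_singleton.2 huv)]

lemma degree_core_restrict_le (F : Finset (Finset α)) (P D : Finset α) (x : α) :
    degree (core (restrict F P D)) x ≤ #{e ∈ F | x ∈ e ∧ Disjoint e P} := by
  refine (card_le_card (t := image (· \ D) {e ∈ F | x ∈ e ∧ Disjoint e P}) ?_).trans card_image_le
  intro s hs
  simp only [mem_core, mem_filter, mem_restrict] at hs
  obtain ⟨⟨⟨e, he, hP, rfl⟩, -⟩, hx⟩ := hs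
  exact mem_image.2 ⟨e, mem_filter.2 ⟨he, (mem_sdiff.1 hx).1, hP⟩, rfl⟩

lemma degree_core_restrict_le_degree (F : Finset (Finset α)) (P D : Finset α) (x : α) :
    degree (core (restrict F P D)) x ≤ degree F x :=
  (degree_core_restrict_le F P D x).trans
    (card_le_card (monotone_filter_right F fun _ _ h => h.1))

lemma degree_core_restrict_le_degree_sub_codegree (hv : v ∈ P) :
    degree (core (restrict F P D)) x ≤ degree F x - codegree F v x := by
  have hsplit : degree F x = #{e ∈ F | x ∈ e ∧ v ∈ e} + #{e ∈ F | x ∈ e ∧ v ∉ e} := by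
    rw [degree, ← card_filter_add_card_filter_not (s := {e ∈ F | x ∈ e}) (fun e => v ∈ e),
      filter_filter, filter_filter]
  have hsub : #{e ∈ F | x ∈ e ∧ Disjoint e P} ≤ #{e ∈ F | x ∈ e ∧ v ∉ e} :=
    card_le_card (monotone_filter_right F fun e _ h =>
      ⟨h.1, fun hve => Finset.disjoint_left.1 h.2 hve hv⟩)
  have hle := degree_core_restrict_le F P D x
  simp only [codegree, and_comm (a := v ∈ _)]
  omega

lemma degree_core_restrict_le_degree_sub_one {e : Finset α} (he : e ∈ F) (hve : v ∈ e) (hx : x ∈ e)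
    (hv : v ∈ P) : degree (core (restrict F P D)) x ≤ degree F x - 1 := by
  have hpos : 0 < codegree F v x := card_pos.2 ⟨e, mem_filter.2 ⟨he, hve, hx⟩⟩
  have := degree_core_restrict_le_degree_sub_codegree (F := F) (D := D) (x := x) hv
  omega

lemma degree_core_restrict_eq_zero (h : x ∈ P ∪ D) : degree (core (restrict F P D)) x = 0 := by
  refine degree_eq_zero_iff.2 fun s hs hx => ?_
  obtain ⟨e, -, hP, rfl⟩ := mem_restrict.1 (mem_core.1 hs).1
  rw [mem_sdiff] at hx
  rcases mem_union.1 h with h | h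
  · exact Finset.disjoint_left.1 hP hx.1 h
  · exact hx.2 h

lemma degree_core_eq_zero_of_singleton_mem (h : {x} ∈ F) : degree (core F) x = 0 := by
  refine degree_eq_zero_iff.2 fun s hs hx => ?_
  obtain ⟨-, hc, hm⟩ := mem_core.1 hs
  rw [← hm _ h (singleton_subset_iff.2 hx), card_singleton] at hc
  omega

lemma pairs_subset_pairs_core (h : ∀ e ∈ F, 2 ≤ #e) : pairs F ⊆ pairs (core F) := by
  intro e he
  obtain ⟨heF, hc⟩ := mem_pairs.1 he
  exact mem_pairs.2 ⟨mem_core.2 ⟨heF, hc.ge, fun f hf hs =>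
    eq_of_subset_of_card_le hs (hc.trans_le (h f hf))⟩, hc⟩

lemma filter_disjoint_pairs_subset (h : ∀ s ∈ restrict F P D, 2 ≤ #s) :
    {e ∈ pairs F | Disjoint e P} ⊆ pairs (restrict F P D) := by
  intro e he
  obtain ⟨hep, hP⟩ := mem_filter.1 he
  obtain ⟨heF, hc⟩ := mem_pairs.1 hep
  have hmem : e \ D ∈ restrict F P D := mem_restrict.2 ⟨e, heF, hP, rfl⟩
  have heq : e \ D = e := eq_of_subset_of_card_le sdiff_subset (hc.trans_le (h _ hmem))
  exact mem_pairs.2 ⟨heq ▸ hmem, hc⟩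

lemma card_pairs_sub_le_card_pairs_core_restrict (h : ∀ s ∈ restrict F P D, 2 ≤ #s) :
    #(pairs F) - ∑ u ∈ P, degree (pairs F) u ≤ #(pairs (core (restrict F P D))) := by
  have h1 := card_le_card_disjoint_add_sum_degree (pairs F) P
  have h2 := card_le_card ((filter_disjoint_pairs_subset h).trans (pairs_subset_pairs_core h))
  omega

lemma IsClutter.two_le_card_of_mem_restrict (hF : IsClutter F) :
    ∀ s ∈ restrict F P ∅, 2 ≤ #s := by
  intro s hs
  obtain ⟨e, he, -, rfl⟩ := mem_restrict.1 hs
  simpa using hF.two_le_card e he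

lemma IsClutter.two_le_card_of_mem_restrict_partners (hF : IsClutter F) :
    ∀ s ∈ restrict F (partners F v) {v}, 2 ≤ #s := by
  intro s hs
  obtain ⟨e, he, hP, rfl⟩ := mem_restrict.1 hs
  have h2 := hF.two_le_card e he
  rw [sdiff_singleton_eq_erase]
  by_cases hv : v ∈ e
  · rw [card_erase_of_mem hv]
    by_contra hlt
    obtain ⟨u, hu, rfl⟩ :=
      exists_mem_partners_of_mem_pairs (mem_pairs.2 ⟨he, by omega⟩) hv
    exact Finset.disjoint_left.1 hP (by simp) hu
  · rwa [erase_eq_of_notMem hv]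

lemma IsClutter.disjoint_partners (hF : IsClutter F) {e : Finset α} (he : e ∈ F) (hv : v ∈ e)
    (hc : #e ≠ 2) : Disjoint e (partners F v) := by
  refine Finset.disjoint_left.2 fun u hue hu => hc ?_
  obtain ⟨huv, hp⟩ := mem_partners.1 hu
  rw [← hF.eq_of_subset e he _ hp (insert_subset hv (singleton_subset_iff.2 hue)),
    card_pair huv.symm]

/-- Once `v` is discarded, its hyperedges of size 3 become pairs, and these are new pairs because
`F` is an antichain. -/
lemma IsClutter.card_pairs_add_degree_le (hF : IsClutter F) (h3 : ∀ e ∈ F, #e ≤ 3) (v : α) :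
    #(pairs F) + degree F v ≤ #(pairs (core (restrict F (partners F v) {v}))) +
      (#(partners F v) + ∑ u ∈ partners F v, degree (pairs F) u) := by
  have hcard := hF.two_le_card_of_mem_restrict_partners (v := v)
  set A : Finset (Finset α) := {e ∈ pairs F | Disjoint e (partners F v)} with hA
  set T : Finset (Finset α) := {e ∈ F | v ∈ e ∧ #e = 3} with hT
  have hsub : A ∪ T.image (·.erase v) ⊆ pairs (restrict F (partners F v) {v}) := by
    refine union_subset (filter_disjoint_pairs_subset hcard) fun s hs => ?_
    obtain ⟨e, he, rfl⟩ := mem_image.1 hs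
    obtain ⟨heF, hv, hc⟩ := mem_filter.1 he
    exact mem_pairs.2 ⟨mem_restrict.2 ⟨e, heF, hF.disjoint_partners heF hv (by omega),
      sdiff_singleton_eq_erase v e⟩, by rw [card_erase_of_mem hv, hc]⟩
  have hdisj : Disjoint A (T.image (·.erase v)) := by
    refine Finset.disjoint_left.2 fun s hs hsT => ?_
    obtain ⟨e, he, rfl⟩ := mem_image.1 hsT
    obtain ⟨heF, -, hc⟩ := mem_filter.1 he
    obtain ⟨hsF, hs2⟩ := mem_pairs.1 (mem_filter.1 hs).1
    rw [hF.eq_of_subset e heF _ hsF (erase_subset _ _)] at hs2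
    omega
  have hinj : Set.InjOn (fun e : Finset α => e.erase v) T := fun e he f hf hef => by
    rw [← insert_erase (mem_filter.1 he).2.1, ← insert_erase (mem_filter.1 hf).2.1]
    exact congrArg _ hef
  have hle := card_le_card (hsub.trans (pairs_subset_pairs_core hcard))
  rw [card_union_of_disjoint hdisj, card_image_of_injOn hinj] at hle
  have hA' := card_le_card_disjoint_add_sum_degree (pairs F) (partners F v)
  have hT' := degree_eq_card_triples_add_card_partners hF h3 v
  rw [← hA] at hA'
  rw [← hT] at hT'
  omega

end Families

/-! ### The measure -/

section Factors

/-- The factor of a vertex of degree `d` in the measure of an instance. These constants and those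
of `pairFactor` were found numerically, subject to the inequality of every branching rule; the
limit 67/40 = 1.675 leaves room below 1.6755 for the polynomial cost of a single step. -/
def vertexFactor : ℕ → ℚ
  | 0 => 1
  | 1 => 151 / 100
  | 2 => 163 / 100
  | 3 => 333 / 200
  | _ => 67 / 40

/-- The factor of an instance with `m` hyperedges of size 2 in its measure. It decreases in `m`
because such hyperedges make the coming branchings more efficient. -/
def pairFactor : ℕ → ℚ
  | 0 => 3 / 2
  | 1 => 11 / 8
  | 2 => 63 / 50
  | 3 => 231 / 200
  | 4 => 107 / 100
  | _ => 1

lemma vertexFactor_of_four_le {n : ℕ} (h : 4 ≤ n) : vertexFactor n = 67 / 40 := by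
  obtain ⟨k, rfl⟩ := Nat.exists_eq_add_of_le' h
  rfl

lemma pairFactor_of_five_le {n : ℕ} (h : 5 ≤ n) : pairFactor n = 1 := by
  obtain ⟨k, rfl⟩ := Nat.exists_eq_add_of_le' h
  rfl

lemma vertexFactor_monotone : Monotone vertexFactor := by
  refine monotone_nat_of_le_succ fun n => ?_
  rcases n with _ | _ | _ | _ | n
  iterate 4 norm_num [vertexFactor]
  exact le_rfl

lemma pairFactor_antitone : Antitone pairFactor := by
  refine antitone_nat_of_succ_le fun n => ?_
  rcases n with _ | _ | _ | _ | _ | n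
  iterate 5 norm_num [pairFactor]
  exact le_rfl

lemma one_le_vertexFactor (n : ℕ) : 1 ≤ vertexFactor n :=
  vertexFactor_monotone (Nat.zero_le n)

lemma vertexFactor_pos (n : ℕ) : 0 < vertexFactor n :=
  one_pos.trans_le (one_le_vertexFactor n)

lemma vertexFactor_le (n : ℕ) : vertexFactor n ≤ 67 / 40 :=
  (vertexFactor_monotone (Nat.le_add_right n 4)).trans_eq
    (vertexFactor_of_four_le (Nat.le_add_left 4 n))

lemma one_le_pairFactor (n : ℕ) : 1 ≤ pairFactor n :=
  (pairFactor_of_five_le (Nat.le_add_left 5 n)).symm.trans_le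
    (pairFactor_antitone (Nat.le_add_right n 5))

lemma pairFactor_pos (n : ℕ) : 0 < pairFactor n :=
  one_pos.trans_le (one_le_pairFactor n)

lemma pairFactor_le (n : ℕ) : pairFactor n ≤ 3 / 2 :=
  pairFactor_antitone (Nat.zero_le n)

lemma vertexFactor_min_sub {c : ℕ} (hc : c ≤ 1) (n : ℕ) :
    vertexFactor (min n 5 - c) = vertexFactor (n - c) := by
  rcases le_total n 5 with h | h
  · rw [min_eq_left h]
  · rw [min_eq_right h, vertexFactor_of_four_le (by omega), vertexFactor_of_four_le (by omega)]

lemma vertexFactor_min (n : ℕ) : vertexFactor (min n 5) = vertexFactor n :=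
  vertexFactor_min_sub zero_le_one n

lemma pairFactor_min_sub {m a c : ℕ} (ha : c + 5 ≤ a) :
    pairFactor (min m a - c) = pairFactor (m - c) := by
  rcases le_total m a with h | h
  · rw [min_eq_left h]
  · rw [min_eq_right h, pairFactor_of_five_le (by omega), pairFactor_of_five_le (by omega)]

lemma pairFactor_min {m a : ℕ} (ha : 5 ≤ a) : pairFactor (min m a) = pairFactor m :=
  pairFactor_min_sub (c := 0) ha

lemma pairFactor_add_sub_le {m m' d d' c b : ℕ} (hd : d' ≤ d) (hm : m' = min m b)
    (hb : c + 5 ≤ b + d') : pairFactor (m + d - c) ≤ pairFactor (m' + d' - c) := by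
  subst hm
  rcases le_total m b with h | h
  · exact pairFactor_antitone (by omega)
  · rw [pairFactor_of_five_le (by omega)]
    exact one_le_pairFactor _

lemma factors_leaf_of_one_pair {m d : ℕ} (hm : 1 ≤ m) (hd : 1 ≤ d) :
    2 * pairFactor (m - 1) ≤ pairFactor m * (vertexFactor 1 * vertexFactor d) := by
  have key : ∀ m ∈ Finset.Icc 1 6,
      2 * pairFactor (m - 1) ≤ pairFactor m * (vertexFactor 1 * vertexFactor 1) := by
    decide +kernel
  have h := key (min m 6) (by rw [Finset.mem_Icc]; omega)
  rw [pairFactor_min_sub (by omega), pairFactor_min (by omega)] at h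
  have h1 := pairFactor_pos m
  have h2 := vertexFactor_pos 1
  refine h.trans ?_
  gcongr
  exact vertexFactor_monotone hd

lemma factors_leaf_of_two_le {m d j : ℕ} (hj : 2 ≤ j) (hjm : j ≤ m) (hjd : j ≤ d) :
    1 + pairFactor (m - j) ≤ pairFactor m * (vertexFactor 1 * vertexFactor d) := by
  have h1 := pairFactor_pos m
  have h2 := vertexFactor_pos 1
  obtain rfl | hj3 := hj.eq_or_lt
  · have key : ∀ m ∈ Finset.Icc 2 7,
        1 + pairFactor (m - 2) ≤ pairFactor m * (vertexFactor 1 * vertexFactor 2) := by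
      decide +kernel
    have h := key (min m 7) (by rw [Finset.mem_Icc]; omega)
    rw [pairFactor_min_sub (by omega), pairFactor_min (by omega)] at h
    refine h.trans ?_
    gcongr
    exact vertexFactor_monotone hjd
  · calc 1 + pairFactor (m - j) ≤ 1 + 3 / 2 := by gcongr; exact pairFactor_le _
      _ ≤ 1 * (vertexFactor 1 * vertexFactor 3) := by norm_num [vertexFactor]
      _ ≤ pairFactor m * (vertexFactor 1 * vertexFactor d) := by
        have := vertexFactor_pos 3
        gcongr
        exacts [one_le_pairFactor m, vertexFactor_monotone (Nat.succ_le_of_lt hj3 |>.trans hjd)]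

lemma factors_one_partner {m d x : ℕ} (hm : 1 ≤ m) (hx : 2 ≤ x) (hxd : x ≤ d) :
    pairFactor (m - 1) * vertexFactor (x - 1) + pairFactor (m + d - 2) ≤
      pairFactor m * (vertexFactor d * vertexFactor x) := by
  have key : ∀ m ∈ Finset.Icc 1 6, ∀ d ∈ Finset.Icc 2 5, ∀ x ∈ Finset.Icc 2 d,
      pairFactor (m - 1) * vertexFactor (x - 1) + pairFactor (m + d - 2) ≤
        pairFactor m * (vertexFactor d * vertexFactor x) := by decide +kernel
  have h := key (min m 6) (by rw [Finset.mem_Icc]; omega) (min d 5) (by rw [Finset.mem_Icc]; omega)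
    (min x 5) (by rw [Finset.mem_Icc]; omega)
  rw [pairFactor_min_sub (by omega), pairFactor_min (by omega), vertexFactor_min,
    vertexFactor_min, vertexFactor_min_sub le_rfl] at h
  refine (add_le_add_right ?_ _).trans h
  exact pairFactor_add_sub_le (min_le_left d 5) rfl (by omega)

lemma factors_two_partners {m d x y p q : ℕ} (hm : 2 ≤ m) (hd : 2 ≤ d) (hx : 2 ≤ x) (hy : 2 ≤ y)
    (hp : p ∈ Finset.Icc 1 2) (hq : q ∈ Finset.Icc 1 2) (hpx : p = 2 → x ≤ d)
    (hqy : q = 2 → y ≤ d) :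
    pairFactor (m - 2) * (vertexFactor (x - 1) * vertexFactor (y - 1)) +
      pairFactor (m + d - (2 + (p + q))) ≤
      pairFactor m * (vertexFactor d * (vertexFactor x * vertexFactor y)) := by
  have key : ∀ m ∈ Finset.Icc 2 9, ∀ d ∈ Finset.Icc 2 5, ∀ x ∈ Finset.Icc 2 5,
      ∀ y ∈ Finset.Icc 2 5, ∀ p ∈ Finset.Icc 1 2, ∀ q ∈ Finset.Icc 1 2,
      (p = 2 → x ≤ d) → (q = 2 → y ≤ d) →
      pairFactor (m - 2) * (vertexFactor (x - 1) * vertexFactor (y - 1)) +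
        pairFactor (m + d - (2 + (p + q))) ≤
        pairFactor m * (vertexFactor d * (vertexFactor x * vertexFactor y)) := by
    decide +kernel
  have h := key (min m 9) (by rw [Finset.mem_Icc]; omega) (min d 5) (by rw [Finset.mem_Icc]; omega)
    (min x 5) (by rw [Finset.mem_Icc]; omega) (min y 5) (by rw [Finset.mem_Icc]; omega)
    p hp q hq (by omega) (by omega)
  rw [pairFactor_min_sub (by omega), pairFactor_min (by omega), vertexFactor_min,
    vertexFactor_min, vertexFactor_min, vertexFactor_min_sub le_rfl,
    vertexFactor_min_sub le_rfl] at h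
  rw [Finset.mem_Icc] at hp hq
  refine (add_le_add_right ?_ _).trans h
  exact pairFactor_add_sub_le (min_le_left d 5) rfl (by omega)

lemma factors_many_partners {m d k : ℕ} (hk : 3 ≤ k) (hkm : k ≤ m) (hkd : k ≤ d) :
    pairFactor (m - k) * vertexFactor 2 ^ k + 3 / 2 ≤
      pairFactor m * (vertexFactor d * vertexFactor 2 ^ k) := by
  rcases le_or_gt k 4 with hk4 | hk4
  · have key : ∀ k ∈ Finset.Icc 3 4, ∀ m ∈ Finset.Icc k 9, ∀ d ∈ Finset.Icc k 5,
        pairFactor (m - k) * vertexFactor 2 ^ k + 3 / 2 ≤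
          pairFactor m * (vertexFactor d * vertexFactor 2 ^ k) := by
      decide +kernel
    have h := key k (Finset.mem_Icc.2 ⟨hk, hk4⟩) (min m 9) (by rw [Finset.mem_Icc]; omega)
      (min d 5) (by rw [Finset.mem_Icc]; omega)
    rwa [pairFactor_min_sub (by omega), pairFactor_min (by omega), vertexFactor_min] at h
  · rw [pairFactor_of_five_le (n := m) (by omega), vertexFactor_of_four_le (n := d) (by omega)]
    have hpow : 10 ≤ vertexFactor 2 ^ k :=
      (by norm_num [vertexFactor] : (10 : ℚ) ≤ vertexFactor 2 ^ 5).trans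
        (pow_le_pow_right₀ (one_le_vertexFactor 2) hk4)
    nlinarith [pairFactor_le (m - k)]

lemma vertexFactor_sub_one_le {d k : ℕ} (hd : 3 ≤ d) (hk : 1 ≤ k) (hkd : k ≤ d) :
    vertexFactor (k - 1) ≤ vertexFactor k * (vertexFactor (d - 1) / vertexFactor d) := by
  have key : ∀ d ∈ Finset.Icc 3 5, ∀ k ∈ Finset.Icc 1 d,
      vertexFactor (k - 1) ≤ vertexFactor k * (vertexFactor (d - 1) / vertexFactor d) := by
    decide +kernel
  have h := key (min d 5) (by rw [Finset.mem_Icc]; omega) (min k 5) (by rw [Finset.mem_Icc]; omega)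
  rwa [vertexFactor_min, vertexFactor_min, vertexFactor_min_sub le_rfl,
    vertexFactor_min_sub le_rfl] at h

lemma vertexFactor_sub_le {d k : ℕ} (hd : 3 ≤ d) (hkd : k ≤ d) (c : ℕ) (hc : c ≤ k) :
    vertexFactor (k - c) ≤ vertexFactor k * (vertexFactor (d - 1) / vertexFactor d) ^ c := by
  have hq := div_pos (vertexFactor_pos (d - 1)) (vertexFactor_pos d)
  induction c with
  | zero => simp
  | succ c ih =>
    calc vertexFactor (k - (c + 1)) = vertexFactor (k - c - 1) := by rw [Nat.sub_sub]
      _ ≤ vertexFactor (k - c) * (vertexFactor (d - 1) / vertexFactor d) :=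
        vertexFactor_sub_one_le hd (by omega) (by omega)
      _ ≤ vertexFactor k * (vertexFactor (d - 1) / vertexFactor d) ^ c *
          (vertexFactor (d - 1) / vertexFactor d) := by gcongr; exact ih (by omega)
      _ = _ := by rw [mul_assoc, ← pow_succ]

lemma factors_triples {d : ℕ} (hd : 3 ≤ d) :
    3 / 2 * (vertexFactor (d - 1) / vertexFactor d) ^ (2 * d) + pairFactor d ≤
      3 / 2 * vertexFactor d := by
  rcases Nat.lt_or_ge d 5 with h | h
  · have key : ∀ d ∈ Finset.Icc 3 4,
        3 / 2 * (vertexFactor (d - 1) / vertexFactor d) ^ (2 * d) + pairFactor d ≤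
        3 / 2 * vertexFactor d := by
      decide +kernel
    exact key d (Finset.mem_Icc.2 ⟨hd, by omega⟩)
  · rw [pairFactor_of_five_le h, vertexFactor_of_four_le (by omega : 4 ≤ d),
      vertexFactor_of_four_le (by omega : 4 ≤ d - 1), div_self (by norm_num), one_pow]
    norm_num

end Factors

section Weight

open Finset

variable {α : Type*} [DecidableEq α]

/-- The measure of an instance with hyperedges `F`: a bound for the number of leaves of the
search tree. It depends on the core only, hence is the same before and after the rules that do not
branch. -/
def weight (F : Finset (Finset α)) : ℚ :=
  pairFactor #(pairs (core F)) *
    ∏ v ∈ (core F).biUnion id, vertexFactor (degree (core F) v)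

variable {F G : Finset (Finset α)} {P D : Finset α}

lemma weight_eq_of_core_eq (h : core F = core G) : weight F = weight G := by
  unfold weight
  rw [h]

lemma weight_eq_prod {U : Finset α} (hU : (core F).biUnion id ⊆ U) :
    weight F = pairFactor #(pairs (core F)) * ∏ v ∈ U, vertexFactor (degree (core F) v) := by
  rw [weight, prod_subset hU fun v _ hv => by rw [degree_eq_zero_of_notMem hv, vertexFactor]]

lemma one_le_weight (F : Finset (Finset α)) : 1 ≤ weight F :=
  one_le_mul_of_one_le_of_one_le (one_le_pairFactor _)
    (one_le_prod fun _ _ => one_le_vertexFactor _)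

lemma weight_nonneg (F : Finset (Finset α)) : 0 ≤ weight F :=
  zero_le_one.trans (one_le_weight F)

lemma weight_le {U : Finset α} (hU : F.biUnion id ⊆ U) : weight F ≤ 3 / 2 * (67 / 40) ^ #U := by
  rw [weight_eq_prod ((biUnion_subset_biUnion_of_subset_left _ (filter_subset _ _)).trans hU),
    ← prod_const]
  gcongr
  · exact prod_nonneg fun _ _ => (vertexFactor_pos _).le
  · exact pairFactor_le _
  · exact fun _ _ => (vertexFactor_pos _).le
  · exact vertexFactor_le _

/-- The comparison behind every branching: only the vertices in `X` need to be looked at, since no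
degree increases. Both sides are multiplied out so that the estimates for the instances of one
branching have the same coefficient on the left. -/
lemma weight_restrict_mul_le (hF : IsClutter F) (X : Finset α) {φ : α → ℚ}
    (hφ : ∀ x ∈ X, vertexFactor (degree (core (restrict F P D)) x) ≤ φ x) {m : ℕ}
    (hm : m ≤ #(pairs (core (restrict F P D)))) :
    weight (restrict F P D) * (pairFactor #(pairs F) * ∏ x ∈ X, vertexFactor (degree F x)) ≤
      weight F * (pairFactor m * ∏ x ∈ X, φ x) := by
  set R := core (restrict F P D) with hR
  set U := R.biUnion id ∪ F.biUnion id ∪ X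
  have hXU : X ⊆ U := subset_union_right
  have hpos : ∀ (S : Finset α) (f : α → ℕ), 0 ≤ ∏ x ∈ S, vertexFactor (f x) :=
    fun S f => prod_nonneg fun _ _ => (vertexFactor_pos _).le
  have hrestrict : weight (restrict F P D) ≤
      pairFactor m * ((∏ x ∈ U \ X, vertexFactor (degree F x)) * ∏ x ∈ X, φ x) := by
    rw [weight_eq_prod (U := U) (subset_union_left.trans subset_union_left), ← hR,
      ← prod_sdiff hXU]
    gcongr with x _ x hx
    · exact mul_nonneg (hpos _ _) (hpos _ _)
    · exact (pairFactor_pos _).le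
    · exact pairFactor_antitone hm
    · exact hpos _ _
    · exact hpos _ _
    · exact fun _ _ => (vertexFactor_pos _).le
    · exact vertexFactor_monotone (degree_core_restrict_le_degree F P D x)
    · exact fun _ _ => (vertexFactor_pos _).le
    · exact hφ x hx
  have hF' : weight F = pairFactor #(pairs F) * ((∏ x ∈ U \ X, vertexFactor (degree F x)) *
      ∏ x ∈ X, vertexFactor (degree F x)) := by
    rw [weight_eq_prod (U := U) (hF.core_eq.symm ▸ subset_union_right.trans subset_union_left),
      hF.core_eq, prod_sdiff hXU]
  rw [hF']
  refine (mul_le_mul_of_nonneg_right hrestrict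
    (mul_nonneg (pairFactor_pos _).le (hpos _ _))).trans_eq ?_
  ring

lemma weight_restrict_mul_le_of_gone (hF : IsClutter F) (X : Finset α)
    (hX : ∀ x ∈ X, degree (core (restrict F P D)) x = 0) {m : ℕ}
    (hm : m ≤ #(pairs (core (restrict F P D)))) :
    weight (restrict F P D) * (pairFactor #(pairs F) * ∏ x ∈ X, vertexFactor (degree F x)) ≤
      weight F * pairFactor m := by
  have h := weight_restrict_mul_le hF X (φ := fun _ => 1)
    (fun x hx => by rw [hX x hx, vertexFactor]) hm
  rwa [prod_const_one, mul_one] at h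

lemma add_le_of_mul_le {w w₁ w₂ c b₁ b₂ : ℚ} (hw : 0 ≤ w) (hc : 0 < c)
    (h₁ : w₁ * c ≤ w * b₁) (h₂ : w₂ * c ≤ w * b₂) (h : b₁ + b₂ ≤ c) : w₁ + w₂ ≤ w := by
  refine le_of_mul_le_mul_right ?_ hc
  calc (w₁ + w₂) * c = w₁ * c + w₂ * c := add_mul _ _ _
    _ ≤ w * b₁ + w * b₂ := add_le_add h₁ h₂
    _ = w * (b₁ + b₂) := (mul_add _ _ _).symm
    _ ≤ w * c := mul_le_mul_of_nonneg_left h hw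

end Weight

/-! ### Branching does not increase the measure -/

section Branching

open Finset

variable {α : Type*} [DecidableEq α] {F : Finset (Finset α)} {P D : Finset α} {v u : α}

lemma weight_restrict_mul_le_of_gone_of_le (hF : IsClutter F) {X Y : Finset α}
    (hXY : Disjoint X Y) (hX : ∀ x ∈ X, degree (core (restrict F P D)) x = 0) {φ : α → ℚ}
    (hφ : ∀ y ∈ Y, vertexFactor (degree (core (restrict F P D)) y) ≤ φ y) {m : ℕ}
    (hm : m ≤ #(pairs (core (restrict F P D)))) :
    weight (restrict F P D) * (pairFactor #(pairs F) *
        ((∏ x ∈ X, vertexFactor (degree F x)) * ∏ y ∈ Y, vertexFactor (degree F y))) ≤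
      weight F * (pairFactor m * ∏ y ∈ Y, φ y) := by
  have h := weight_restrict_mul_le hF (X ∪ Y) (φ := fun x => if x ∈ X then 1 else φ x)
    (fun x hx => ?_) hm
  · rwa [prod_union hXY, prod_union hXY, prod_congr rfl fun x hx => if_pos hx, prod_const_one,
      one_mul, prod_congr rfl fun y hy => if_neg (Finset.disjoint_right.1 hXY hy)] at h
  · split_ifs with hxX
    · rw [hX x hxX, vertexFactor]
    · exact hφ x ((mem_union.1 hx).resolve_left hxX)

lemma weight_select_mul_le (hF : IsClutter F) (v : α) :
    weight (restrict F {v} ∅) * (pairFactor #(pairs F) * (vertexFactor (degree F v) *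
        ∏ u ∈ partners F v, vertexFactor (degree F u))) ≤
      weight F * (pairFactor (#(pairs F) - #(partners F v)) *
        ∏ u ∈ partners F v, vertexFactor (degree F u - 1)) := by
  have h := weight_restrict_mul_le_of_gone_of_le (P := {v}) (D := ∅) hF
    (disjoint_singleton_left.2 (notMem_partners_self F v))
    (fun x hx => degree_core_restrict_eq_zero (by rwa [union_empty]))
    (φ := fun u => vertexFactor (degree F u - 1))
    (fun u hu => vertexFactor_monotone
      (degree_core_restrict_le_degree_sub_one (mem_partners.1 hu).2 (by simp) (by simp)
        (mem_singleton_self v)))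
    (card_pairs_sub_le_card_pairs_core_restrict hF.two_le_card_of_mem_restrict)
  rwa [prod_singleton, sum_singleton, ← card_partners] at h

lemma weight_discard_mul_le (hF : IsClutter F) (h3 : ∀ e ∈ F, #e ≤ 3) {m : ℕ}
    (hm : m ≤ #(pairs F) + degree F v -
      (#(partners F v) + ∑ u ∈ partners F v, degree (pairs F) u)) :
    weight (restrict F (partners F v) {v}) * (pairFactor #(pairs F) * (vertexFactor (degree F v) *
      ∏ u ∈ partners F v, vertexFactor (degree F u))) ≤ weight F * pairFactor m := by
  have h := weight_restrict_mul_le_of_gone (P := partners F v) (D := {v}) hF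
    (insert v (partners F v))
    (fun x hx => degree_core_restrict_eq_zero (by rwa [union_comm, ← insert_eq]))
    (m := m) (by have := hF.card_pairs_add_degree_le h3 v; omega)
  rwa [prod_insert (notMem_partners_self F v)] at h

lemma weight_discard_eq (F : Finset (Finset α)) (v : α) :
    weight (restrict F ∅ {v}) = weight (restrict F (partners F v) {v}) :=
  weight_eq_of_core_eq (core_restrict_partners F v).symm

/-- The factor of the forced vertex `x` is at least 151/100, which outweighs the loss of all
pairs. -/
lemma weight_restrict_mul_le_of_forced (hF : IsClutter F) {x : α} (hx : {x} ∈ restrict F P D) :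
    weight (restrict F P D) * (pairFactor #(pairs F) *
      ∏ y ∈ P ∪ D, vertexFactor (degree F y)) ≤ weight F := by
  obtain ⟨e, he, heP, hex⟩ := mem_restrict.1 hx
  obtain ⟨hxe, hxD⟩ := mem_sdiff.1 (hex ▸ mem_singleton_self x)
  have hxP : x ∉ P ∪ D := notMem_union.2 ⟨Finset.disjoint_left.1 heP hxe, hxD⟩
  have h := weight_restrict_mul_le_of_gone (P := P) (D := D) hF (insert x (P ∪ D))
    (fun y hy => (mem_insert.1 hy).elim
      (fun h => h ▸ degree_core_eq_zero_of_singleton_mem hx) degree_core_restrict_eq_zero)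
    (Nat.zero_le _)
  rw [prod_insert hxP] at h
  have hx1 : 3 / 2 ≤ vertexFactor (degree F x) :=
    (by norm_num [vertexFactor] : (3 / 2 : ℚ) ≤ vertexFactor 1).trans
      (vertexFactor_monotone (degree_pos_of_mem he hxe))
  have hnonneg : 0 ≤ weight (restrict F P D) * (pairFactor #(pairs F) *
      ∏ y ∈ P ∪ D, vertexFactor (degree F y)) :=
    mul_nonneg (weight_nonneg _) (mul_nonneg (pairFactor_pos _).le
      (prod_nonneg fun _ _ => (vertexFactor_pos _).le))
  have h0 : pairFactor 0 = 3 / 2 := rfl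
  rw [h0] at h
  nlinarith

lemma IsClutter.nonempty_of_mem_restrict_erase (hF : IsClutter F) {e : Finset α} (he : e ∈ F)
    (hve : v ∈ e) : ∀ s ∈ restrict F {v} (e.erase v), s.Nonempty := by
  intro s hs
  obtain ⟨f, hf, hfv, rfl⟩ := mem_restrict.1 hs
  refine sdiff_nonempty.2 fun hsub => ?_
  obtain rfl := hF.eq_of_subset e he f hf (hsub.trans (erase_subset _ _))
  exact disjoint_singleton_right.1 hfv hve

lemma weight_select_discard_mul_le (hF : IsClutter F) {e : Finset α} (he : e ∈ F) (hve : v ∈ e) :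
    weight (restrict F {v} (e.erase v)) * (pairFactor #(pairs F) *
      ∏ y ∈ e, vertexFactor (degree F y)) ≤
      weight F * pairFactor (#(pairs F) - degree (pairs F) v) := by
  have hunion : {v} ∪ e.erase v = e := by rw [singleton_union, insert_erase hve]
  by_cases hx : ∃ x, {x} ∈ restrict F {v} (e.erase v)
  · obtain ⟨x, hx⟩ := hx
    have h := weight_restrict_mul_le_of_forced hF hx
    rw [hunion] at h
    exact h.trans (le_mul_of_one_le_right (weight_nonneg F) (one_le_pairFactor _))
  · have hcard : ∀ s ∈ restrict F {v} (e.erase v), 2 ≤ #s := fun s hs => by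
      by_contra hlt
      have hpos := (hF.nonempty_of_mem_restrict_erase he hve s hs).card_pos
      obtain ⟨x, rfl⟩ := card_eq_one.1 (show #s = 1 by omega)
      exact hx ⟨x, hs⟩
    have hpairs := card_pairs_sub_le_card_pairs_core_restrict hcard
    rw [sum_singleton] at hpairs
    exact weight_restrict_mul_le_of_gone hF e
      (fun y hy => degree_core_restrict_eq_zero (by rwa [hunion])) hpairs

lemma pow_le_prod_vertexFactor (U : Finset α) (k : ℕ) (h : ∀ u ∈ U, k ≤ degree F u) :
    vertexFactor k ^ #U ≤ ∏ u ∈ U, vertexFactor (degree F u) := by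
  rw [← prod_const]
  exact prod_le_prod (fun _ _ => (vertexFactor_pos _).le) fun u hu => vertexFactor_monotone (h u hu)

lemma exists_singleton_mem_restrict (hv : degree F v = 1) (he : {v, u} ∈ F)
    (hu : 1 < degree (pairs F) u) : ∃ x, {x} ∈ restrict F {v} {u} := by
  obtain ⟨f, hf, hfe⟩ := exists_mem_ne (show 1 < #{e ∈ pairs F | u ∈ e} from hu) {v, u}
  obtain ⟨hfp, huf⟩ := mem_filter.1 hf
  obtain ⟨hfF, hfc⟩ := mem_pairs.1 hfp
  obtain ⟨x, hx⟩ := card_eq_one.1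
    (show #(f \ {u}) = 1 by rw [sdiff_singleton_eq_erase, card_erase_of_mem huf, hfc])
  exact ⟨x, mem_restrict.2 ⟨f, hfF, disjoint_singleton_right.2 fun hvf =>
    hfe (eq_of_degree_eq_one hv hfF hvf he (mem_insert_self v {u})), hx⟩⟩

lemma weight_branch_degree_one_pair (hF : IsClutter F) (h3 : ∀ e ∈ F, #e ≤ 3)
    (hv : degree F v = 1) (huv : u ≠ v) (he : {v, u} ∈ F) :
    weight (restrict F {v} {u}) + weight (restrict F ∅ {v}) ≤ weight F := by
  have hp := partners_eq_singleton hv huv he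
  have hpv : degree (pairs F) v = 1 := by rw [← card_partners, hp, card_singleton]
  have hju : degree (pairs F) u ≤ degree F u := degree_pairs_le F u
  have hjm : degree (pairs F) u ≤ #(pairs F) := degree_le_card _ _
  have hj : 0 < degree (pairs F) u :=
    degree_pos_of_mem (mem_pairs.2 ⟨he, card_pair huv.symm⟩) (by simp)
  have hc : 0 < pairFactor #(pairs F) * (vertexFactor 1 * vertexFactor (degree F u)) :=
    mul_pos (pairFactor_pos _) (mul_pos (vertexFactor_pos _) (vertexFactor_pos _))
  have hdiscard := weight_discard_mul_le (v := v) hF h3 (m := #(pairs F) - degree (pairs F) u)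
    (by rw [hp, hv, sum_singleton, card_singleton]; omega)
  rw [hp, prod_singleton, hv] at hdiscard
  rw [weight_discard_eq, hp]
  rcases Nat.lt_or_ge 1 (degree (pairs F) u) with hj1 | hj1
  · obtain ⟨x, hx⟩ := exists_singleton_mem_restrict hv he hj1
    have hselect := weight_restrict_mul_le_of_forced hF hx
    rw [singleton_union, prod_pair huv.symm, hv, ← mul_one (weight F)] at hselect
    exact add_le_of_mul_le (weight_nonneg F) hc hselect hdiscard
      (factors_leaf_of_two_le hj1 hjm hju)
  · have hselect := weight_select_discard_mul_le hF he (mem_insert_self v {u})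
    rw [erase_insert (by simpa using huv.symm), prod_pair huv.symm, hv, hpv] at hselect
    rw [show degree (pairs F) u = 1 by omega] at hdiscard
    refine add_le_of_mul_le (weight_nonneg F) hc hselect hdiscard ?_
    rw [← two_mul]
    exact factors_leaf_of_one_pair (by omega) (by omega)

lemma weight_branch_isolated (hF : IsClutter F) {e : Finset α} (he : e ∈ F)
    (hc : #e = 3) (hd : ∀ x ∈ e, degree F x = 1) {x : α} (hx : x ∈ e) :
    weight (restrict F {x} (e.erase x)) * 3 ≤ weight F := by
  have h := weight_select_discard_mul_le hF he hx
  have hp : degree (pairs F) x = 0 := degree_pairs_eq_zero (hd x hx) he hx (by omega)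
  rw [hp, Nat.sub_zero, prod_congr rfl fun y hy => by rw [hd y hy], prod_const, hc,
    mul_left_comm, mul_comm (weight F)] at h
  refine le_trans ?_ (le_of_mul_le_mul_left h (pairFactor_pos _))
  exact mul_le_mul_of_nonneg_left (by norm_num [vertexFactor]) (weight_nonneg _)

lemma weight_branch_degree_one_triple (hF : IsClutter F) (h3 : ∀ e ∈ F, #e ≤ 3)
    (hv : degree F v = 1) {e : Finset α} (he : e ∈ F) (hve : v ∈ e) (hc : #e = 3)
    (hu : u ∈ e) (hd : 2 ≤ degree F u) :
    weight (restrict F {v} (e.erase v)) + weight (restrict F ∅ {v}) ≤ weight F := by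
  have hp : degree (pairs F) v = 0 := degree_pairs_eq_zero hv he hve (by omega)
  have huv : u ∈ e.erase v := mem_erase.2 ⟨by rintro rfl; omega, hu⟩
  have hw := pow_le_prod_vertexFactor ((e.erase v).erase u) 1 (F := F)
    fun x hx => degree_pos_of_mem he (mem_of_mem_erase (mem_of_mem_erase hx))
  rw [card_erase_of_mem huv, card_erase_of_mem hve, hc, pow_one] at hw
  have hb := pairFactor_pos #(pairs F)
  have hselect : weight (restrict F {v} (e.erase v)) * (pairFactor #(pairs F) * vertexFactor 1) ≤
      weight F * (pairFactor #(pairs F) / (vertexFactor 2 * vertexFactor 1)) := by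
    have h := weight_select_discard_mul_le hF he hve
    rw [hp, Nat.sub_zero, ← mul_prod_erase _ _ hve, ← mul_prod_erase _ _ huv, hv] at h
    rw [mul_div_assoc', le_div_iff₀ (by norm_num [vertexFactor]), mul_assoc, mul_assoc]
    refine le_trans (mul_le_mul_of_nonneg_left ?_ (weight_nonneg _)) h
    have h1 := vertexFactor_pos 1
    have h2 := vertexFactor_pos (degree F u)
    gcongr
    exact vertexFactor_monotone hd
  have hdiscard := weight_discard_mul_le (v := v) hF h3 (m := #(pairs F))
    (by rw [partners_eq_empty hp, card_empty, sum_empty]; omega)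
  rw [partners_eq_empty hp, prod_empty, mul_one, hv] at hdiscard
  rw [weight_discard_eq, partners_eq_empty hp]
  refine add_le_of_mul_le (weight_nonneg F) (mul_pos hb (vertexFactor_pos 1)) hselect hdiscard ?_
  rw [div_eq_mul_inv, ← mul_add_one]
  exact mul_le_mul_of_nonneg_left (by norm_num [vertexFactor]) hb.le

lemma weight_branch_of_factors_le (hF : IsClutter F) (h3 : ∀ e ∈ F, #e ≤ 3) {m : ℕ}
    (hm : m ≤ #(pairs F) + degree F v -
      (#(partners F v) + ∑ u ∈ partners F v, degree (pairs F) u))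
    (h : pairFactor (#(pairs F) - #(partners F v)) *
        ∏ u ∈ partners F v, vertexFactor (degree F u - 1) + pairFactor m ≤
      pairFactor #(pairs F) * (vertexFactor (degree F v) *
        ∏ u ∈ partners F v, vertexFactor (degree F u))) :
    weight (restrict F {v} ∅) + weight (restrict F (partners F v) {v}) ≤ weight F :=
  add_le_of_mul_le (weight_nonneg F)
    (mul_pos (pairFactor_pos _) (mul_pos (vertexFactor_pos _)
      (prod_pos fun _ _ => vertexFactor_pos _)))
    (weight_select_mul_le hF v) (weight_discard_mul_le hF h3 hm) h

lemma weight_branch_three_le_card_partners (hF : IsClutter F) (h3 : ∀ e ∈ F, #e ≤ 3)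
    (hd : ∀ u ∈ partners F v, 2 ≤ degree F u) (hv : 3 ≤ #(partners F v)) :
    weight (restrict F {v} ∅) + weight (restrict F (partners F v) {v}) ≤ weight F := by
  have hcard := card_partners F v
  have hm := degree_le_card (pairs F) v
  have hdv := degree_pairs_le F v
  refine weight_branch_of_factors_le hF h3 (Nat.zero_le _) ?_
  have hfac := factors_many_partners hv (hcard.trans_le hm) (hcard.trans_le hdv)
  have hdrop : ∏ u ∈ partners F v, vertexFactor (degree F u - 1) ≤
      ∏ u ∈ partners F v, vertexFactor (degree F u) :=
    prod_le_prod (fun _ _ => (vertexFactor_pos _).le)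
      fun u _ => vertexFactor_monotone (Nat.sub_le _ 1)
  have hprod := pow_le_prod_vertexFactor (partners F v) 2 hd
  have hpos := pow_pos (vertexFactor_pos 2) #(partners F v)
  have hb := pairFactor_pos (#(pairs F) - #(partners F v))
  have h0 : pairFactor 0 = 3 / 2 := rfl
  have hgain : 0 ≤ pairFactor #(pairs F) * vertexFactor (degree F v) -
      pairFactor (#(pairs F) - #(partners F v)) := by
    refine nonneg_of_mul_nonneg_left ?_ hpos
    linarith
  rw [h0]
  linarith [mul_le_mul_of_nonneg_left hdrop hb.le, mul_le_mul_of_nonneg_left hprod hgain]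

lemma weight_branch_two_partners (hF : IsClutter F) (h3 : ∀ e ∈ F, #e ≤ 3)
    (hd : 2 ≤ degree F v) (hdu : ∀ u ∈ partners F v, 2 ≤ degree F u)
    (hpu : ∀ u ∈ partners F v, degree (pairs F) u ∈ Icc 1 2)
    (hmax : ∀ u ∈ partners F v, degree (pairs F) u = 2 → degree F u ≤ degree F v)
    (hv : #(partners F v) = 2) :
    weight (restrict F {v} ∅) + weight (restrict F (partners F v) {v}) ≤ weight F := by
  obtain ⟨x, y, hxy, hU⟩ := card_eq_two.1 hv
  have hx : x ∈ partners F v := by simp [hU]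
  have hy : y ∈ partners F v := by simp [hU]
  have hcard := card_partners F v
  have hm := degree_le_card (pairs F) v
  refine weight_branch_of_factors_le hF h3
    (m := #(pairs F) + degree F v - (2 + (degree (pairs F) x + degree (pairs F) y)))
    (by rw [hU, sum_pair hxy, card_pair hxy]) ?_
  rw [hU, card_pair hxy, prod_pair hxy, prod_pair hxy]
  exact factors_two_partners (by omega) hd (hdu x hx) (hdu y hy) (hpu x hx) (hpu y hy)
    (hmax x hx) (hmax y hy)

lemma weight_branch_pair (hF : IsClutter F) (h3 : ∀ e ∈ F, #e ≤ 3)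
    (hdeg : ∀ x, degree F x ≠ 1) (hpos : 0 < degree (pairs F) v)
    (hmax : ∀ x, degree (pairs F) x ≤ degree (pairs F) v)
    (hmax' : ∀ x, degree (pairs F) x = degree (pairs F) v → degree F x ≤ degree F v) :
    weight (restrict F {v} ∅) + weight (restrict F (partners F v) {v}) ≤ weight F := by
  have hcard := card_partners F v
  have hpu : ∀ u ∈ partners F v, 1 ≤ degree (pairs F) u := fun u hu =>
    degree_pos_of_mem (pair_mem_pairs_of_mem_partners hu) (by simp)
  have hdu : ∀ u ∈ partners F v, 2 ≤ degree F u := fun u hu => by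
    have := (hpu u hu).trans (degree_pairs_le F u)
    have := hdeg u
    omega
  have hm := degree_le_card (pairs F) v
  have hdv : 2 ≤ degree F v := by
    have := hpos.trans_le (degree_pairs_le F v)
    have := hdeg v
    omega
  obtain h1 | h2 | h3' : #(partners F v) = 1 ∨ #(partners F v) = 2 ∨ 3 ≤ #(partners F v) := by
    omega
  · obtain ⟨x, hx⟩ := card_eq_one.1 h1
    have hxm : x ∈ partners F v := hx ▸ mem_singleton_self x
    have hpx : degree (pairs F) x = 1 := by
      have := hpu x hxm
      have := hmax x
      omega
    refine weight_branch_of_factors_le hF h3 (m := #(pairs F) + degree F v - 2)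
      (by rw [hx, sum_singleton, card_singleton, hpx]) ?_
    rw [hx, card_singleton, prod_singleton, prod_singleton]
    exact factors_one_partner (by omega) (hdu x hxm) (hmax' x (by omega))
  · have hv2 : degree (pairs F) v = 2 := hcard.symm.trans h2
    exact weight_branch_two_partners hF h3 hdv hdu
      (fun u hu => mem_Icc.2 ⟨hpu u hu, (hmax u).trans hv2.le⟩)
      (fun u _ h => hmax' u (h.trans hv2.symm)) h2
  · exact weight_branch_three_le_card_partners hF h3 hdu h3'

omit [DecidableEq α] in
lemma pairs_eq_empty (h3 : ∀ e ∈ F, #e = 3) : pairs F = ∅ :=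
  filter_eq_empty_iff.2 fun e he => by rw [h3 e he]; decide

lemma weight_discard_mul_le_of_triples (hF : IsClutter F) (h3 : ∀ e ∈ F, #e = 3) (v : α) :
    weight (restrict F ∅ {v}) * (3 / 2 * vertexFactor (degree F v)) ≤
      weight F * pairFactor (degree F v) := by
  have hp := pairs_eq_empty h3
  have hU : partners F v = ∅ := partners_eq_empty (by rw [hp, degree, filter_empty, card_empty])
  have h := weight_discard_mul_le (v := v) hF (fun e he => (h3 e he).le) (m := degree F v)
    (by simp [hU, hp])
  rwa [← weight_discard_eq, hU, prod_empty, mul_one, hp, card_empty] at h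

lemma weight_branch_degree_three (hF : IsClutter F) (h3 : ∀ e ∈ F, #e = 3)
    (hd : 3 ≤ degree F v) (hmax : ∀ x, degree F x ≤ degree F v) :
    weight (restrict F {v} ∅) + weight (restrict F ∅ {v}) ≤ weight F := by
  set q := vertexFactor (degree F v - 1) / vertexFactor (degree F v)
  have hprod : 0 < ∏ x ∈ neighbors F v, vertexFactor (degree F x) :=
    prod_pos fun _ _ => vertexFactor_pos _
  have hselect : weight (restrict F {v} ∅) * (3 / 2 * vertexFactor (degree F v)) ≤
      weight F * (3 / 2 * q ^ (2 * degree F v)) := by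
    have h := weight_restrict_mul_le_of_gone_of_le (P := {v}) (D := ∅) hF
      (disjoint_singleton_left.2 (notMem_erase v _))
      (fun x hx => degree_core_restrict_eq_zero (by rwa [union_empty]))
      (φ := fun x => vertexFactor (degree F x) * q ^ codegree F v x)
      (fun x _ => (vertexFactor_monotone
        (degree_core_restrict_le_degree_sub_codegree (mem_singleton_self v))).trans
          (vertexFactor_sub_le hd (hmax x) _ (codegree_le_degree F v x)))
      (Y := neighbors F v) (Nat.zero_le _)
    rw [prod_singleton, prod_mul_distrib, prod_pow_eq_pow_sum, sum_codegree_neighbors h3,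
      pairs_eq_empty h3, card_empty, show pairFactor 0 = 3 / 2 from rfl] at h
    refine le_of_mul_le_mul_right ?_ hprod
    linarith
  exact add_le_of_mul_le (weight_nonneg F) (mul_pos (by norm_num) (vertexFactor_pos _)) hselect
    (weight_discard_mul_le_of_triples hF h3 v) (factors_triples hd)

lemma weight_branch_twins (hF : IsClutter F) (h3 : ∀ e ∈ F, #e = 3)
    (hv : degree F v = 2) (hu : degree F u = 2) (huv : u ≠ v) :
    weight (restrict F {v} {u}) + weight (restrict F ∅ {v}) ≤ weight F := by
  have hselect := weight_restrict_mul_le_of_gone (P := {v}) (D := {u}) hF {v, u}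
    (fun x hx => degree_core_restrict_eq_zero hx) (Nat.zero_le _)
  have hdiscard := weight_discard_mul_le_of_triples hF h3 v
  rw [prod_pair huv.symm, hv, hu, pairs_eq_empty h3, card_empty] at hselect
  rw [hv] at hdiscard
  simp only [vertexFactor, pairFactor] at hselect hdiscard
  linarith [weight_nonneg F]

lemma weight_branch_degree_two (hF : IsClutter F) (h3 : ∀ e ∈ F, #e = 3) {u₁ u₂ w₂ : α}
    (he : {v, u₂, w₂} ∈ F) (hdisj : Disjoint {v, u₁} ({u₂, w₂} : Finset α)) (hu₁ : u₁ ≠ v)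
    (hu₂ : u₂ ≠ w₂) (hdv : degree F v = 2) (hdu₁ : degree F u₁ = 2) (hdu₂ : degree F u₂ = 2)
    (hdw₂ : degree F w₂ = 2) :
    weight (restrict F {v, u₁} {u₂, w₂}) + weight (restrict F {v} {u₁}) +
      weight (restrict F ∅ {v}) ≤ weight F := by
  have hboth := weight_restrict_mul_le_of_gone (P := {v, u₁}) (D := {u₂, w₂}) hF
    ({v, u₁} ∪ {u₂, w₂}) (fun x hx => degree_core_restrict_eq_zero hx) (Nat.zero_le _)
  have hone := weight_restrict_mul_le_of_gone_of_le (P := {v}) (D := {u₁}) hF hdisj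
    (fun x hx => degree_core_restrict_eq_zero hx)
    (φ := fun x => vertexFactor (degree F x - 1))
    (fun x hx => vertexFactor_monotone (degree_core_restrict_le_degree_sub_one he
      (mem_insert_self v _) (mem_insert_of_mem hx) (mem_singleton_self v))) (Nat.zero_le _)
  have hdiscard := weight_discard_mul_le_of_triples hF h3 v
  rw [prod_union hdisj, prod_pair hu₁.symm, prod_pair hu₂, hdv, hdu₁, hdu₂, hdw₂,
    pairs_eq_empty h3, card_empty] at hboth
  rw [prod_pair hu₁.symm, prod_pair hu₂, prod_pair hu₂, hdv, hdu₁, hdu₂, hdw₂,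
    pairs_eq_empty h3, card_empty] at hone
  rw [hdv] at hdiscard
  simp only [vertexFactor, pairFactor] at hboth hone hdiscard
  linarith [weight_nonneg F]

end Branching

/-! ### Results of the computations -/

section Values

variable {β γ : Type}

@[simp] lemma val_pure (b : β) : (pure b : Timed β).val = b := rfl
@[simp] lemma val_bind (x : Timed β) (f : β → Timed γ) : (x >>= f).val = (f x.val).val := rfl
@[simp] lemma val_step (x : Timed β) : (step x).val = x.val := rfl

lemma val_ite (c : Prop) [Decidable c] (x y : Timed β) :
    (if c then x else y).val = if c then x.val else y.val := apply_ite _ _ _ _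

@[simp] lemma anyT_val (p : β → Timed Bool) (l : List β) :
    (anyT p l).val = l.any fun b => (p b).val := by
  induction l with
  | nil => rfl
  | cons b l ih =>
    simp only [anyT, val_step, val_bind, val_ite, val_pure, ih, List.any_cons]
    cases (p b).val <;> rfl

@[simp] lemma allT_val (p : β → Timed Bool) (l : List β) :
    (allT p l).val = l.all fun b => (p b).val := by
  induction l with
  | nil => rfl
  | cons b l ih =>
    simp only [allT, val_step, val_bind, val_ite, val_pure, ih, List.all_cons]
    cases (p b).val <;> rfl

@[simp] lemma findT_val (p : β → Timed Bool) (l : List β) :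
    (findT p l).val = l.find? fun b => (p b).val := by
  induction l with
  | nil => rfl
  | cons b l ih =>
    simp only [findT, val_step, val_bind, val_ite, val_pure, ih, List.find?_cons]
    cases (p b).val <;> rfl

@[simp] lemma filterT_val (p : β → Timed Bool) (l : List β) :
    (filterT p l).val = l.filter fun b => (p b).val := by
  induction l with
  | nil => rfl
  | cons b l ih =>
    simp only [filterT, val_step, val_bind, val_pure, ih, List.filter_cons]

@[simp] lemma countT_val (p : β → Timed Bool) (l : List β) :
    (countT p l).val = l.countP fun b => (p b).val := by
  induction l with
  | nil => rfl
  | cons b l ih =>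
    simp only [countT, val_step, val_bind, val_pure, ih, List.countP_cons]
    split_ifs <;> rfl

@[simp] lemma lengthT_val (l : List β) : (lengthT l).val = l.length := by
  induction l with
  | nil => rfl
  | cons b l ih => simp only [lengthT, val_step, val_bind, val_pure, ih, List.length_cons]

@[simp] lemma mapT_val (f : β → Timed γ) (l : List β) :
    (mapT f l).val = l.map fun b => (f b).val := by
  induction l with
  | nil => rfl
  | cons b l ih => simp only [mapT, val_step, val_bind, val_pure, ih, List.map_cons]

@[simp] lemma appendT_val (l m : List β) : (appendT l m).val = l ++ m := by
  induction l with
  | nil => rfl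
  | cons b l ih => simp only [appendT, val_step, val_bind, val_pure, ih, List.cons_append]

@[simp] lemma flatMapT_val (f : β → Timed (List γ)) (l : List β) :
    (flatMapT f l).val = l.flatMap fun b => (f b).val := by
  induction l with
  | nil => rfl
  | cons b l ih => simp only [flatMapT, val_step, val_bind, appendT_val, ih, List.flatMap_cons]

lemma argmaxT_eq_none {f : β → Timed ℕ} {l : List β} (h : (argmaxT f l).val = none) : l = [] := by
  cases l with
  | nil => rfl
  | cons b l =>
    simp only [argmaxT, val_step, val_bind] at h
    split at h
    · simp at h
    · simp only [val_pure] at h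
      split_ifs at h

lemma argmaxT_eq_some {f : β → Timed ℕ} {l : List β} {b : β} {k : ℕ}
    (h : (argmaxT f l).val = some (b, k)) :
    b ∈ l ∧ k = (f b).val ∧ ∀ b' ∈ l, (f b').val ≤ k := by
  induction l generalizing b k with
  | nil => simp [argmaxT] at h
  | cons a l ih =>
    simp only [argmaxT, val_step, val_bind] at h
    split at h
    · rename_i hnone
      simp only [val_pure, Option.some.injEq, Prod.mk.injEq] at h
      obtain ⟨rfl, rfl⟩ := h
      simp [argmaxT_eq_none hnone]
    · rename_i b' k' hsome
      obtain ⟨hmem, hk', hmax⟩ := ih hsome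
      simp only [val_pure] at h
      split_ifs at h with hle
      · simp only [Option.some.injEq, Prod.mk.injEq] at h
        obtain ⟨rfl, rfl⟩ := h
        refine ⟨List.mem_cons_self, rfl, fun c hc => ?_⟩
        rcases List.mem_cons.1 hc with rfl | hc
        exacts [le_rfl, (hmax c hc).trans hle]
      · simp only [Option.some.injEq, Prod.mk.injEq] at h
        obtain ⟨rfl, rfl⟩ := h
        refine ⟨List.mem_cons_of_mem a hmem, hk', fun c hc => ?_⟩
        rcases List.mem_cons.1 hc with rfl | hc
        exacts [(not_le.1 hle).le, hmax c hc]

variable {α : Type} [DecidableEq α]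

/-- The finite family of finite sets that a list of lists of vertices describes. -/
def family (E : List (List α)) : Finset (Finset α) := (E.map List.toFinset).toFinset

lemma family_cons (e : List α) (E : List (List α)) :
    family (e :: E) = insert e.toFinset (family E) := by
  simp [family]

lemma mem_family {E : List (List α)} {s : Finset α} :
    s ∈ family E ↔ ∃ e ∈ E, e.toFinset = s := by
  simp [family]

@[simp] lemma eqT_val (x y : α) : (eqT x y).val = decide (x = y) := by
  rw [Bool.eq_iff_iff]
  simp [eqT]

@[simp] lemma neT_val (x y : α) : (neT x y).val = !decide (x = y) := by
  rw [Bool.eq_iff_iff]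
  simp [neT]

@[simp] lemma memT_val (x : α) (e : List α) : (memT x e).val = decide (x ∈ e) := by
  rw [Bool.eq_iff_iff]
  simp [memT]

@[simp] lemma subsetT_val (e f : List α) :
    (subsetT e f).val = decide (e.toFinset ⊆ f.toFinset) := by
  rw [Bool.eq_iff_iff]
  simp [subsetT, Finset.subset_iff]

@[simp] lemma sameSetT_val (e f : List α) :
    (sameSetT e f).val = decide (e.toFinset = f.toFinset) := by
  rw [Bool.eq_iff_iff]
  simp only [sameSetT, val_bind, val_ite, subsetT_val, val_pure]
  simp [Finset.Subset.antisymm_iff]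

@[simp] lemma ssubsetT_val (e f : List α) :
    (ssubsetT e f).val = decide (e.toFinset ⊂ f.toFinset) := by
  rw [Bool.eq_iff_iff]
  simp only [ssubsetT, val_bind, val_ite, subsetT_val, val_pure]
  simp [Finset.ssubset_def]

@[simp] lemma hasSizeT_val {β : Type} (k : ℕ) (e : List β) :
    (hasSizeT k e).val = (e.length == k) := by
  simp [hasSizeT]

@[simp] lemma degreeT_val (E : List (List α)) (v : α) :
    (degreeT E v).val = E.countP fun e => decide (v ∈ e) := by
  simp [degreeT]

@[simp] lemma hasDegreeT_val (E : List (List α)) (k : ℕ) (v : α) :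
    (hasDegreeT E k v).val = ((degreeT E v).val == k) := by
  simp [hasDegreeT]

@[simp] lemma isPairAtT_val (v : α) (e : List α) :
    (isPairAtT v e).val = decide (e.length = 2 ∧ v ∈ e) := by
  rw [Bool.eq_iff_iff]
  simp only [isPairAtT, val_bind, val_ite, hasSizeT_val, memT_val, val_pure]
  simp

@[simp] lemma containsBothT_val (v u : α) (e : List α) :
    (containsBothT v u e).val = decide (v ∈ e ∧ u ∈ e) := by
  rw [Bool.eq_iff_iff]
  simp only [containsBothT, val_bind, val_ite, memT_val, val_pure]
  simp

@[simp] lemma hitsAllT_val (E : List (List α)) (T : List α) :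
    (hitsAllT E T).val = decide (∀ s ∈ family E, (s ∩ T.toFinset).Nonempty) := by
  rw [Bool.eq_iff_iff]
  simp [hitsAllT, mem_family, Finset.Nonempty]

lemma dedupT_sublist (E : List (List α)) : (dedupT E).val.Sublist E := by
  induction E with
  | nil => exact List.Sublist.refl _
  | cons e E ih =>
    simp only [dedupT, val_step, val_bind, val_ite, val_pure]
    split_ifs
    · exact ih.cons e
    · exact ih.cons_cons e

lemma family_dedupT (E : List (List α)) : family (dedupT E).val = family E := by
  induction E with
  | nil => rfl
  | cons e E ih =>
    simp only [dedupT, val_step, val_bind, val_ite, val_pure, anyT_val, sameSetT_val]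
    split_ifs with h
    · obtain ⟨f, hf, hef⟩ := List.any_eq_true.1 h
      have hmem : e.toFinset ∈ family E :=
        ih ▸ mem_family.2 ⟨f, hf, (of_decide_eq_true hef).symm⟩
      rw [ih, family_cons, Finset.insert_eq_self.2 hmem]
    · rw [family_cons, family_cons, ih]

lemma nodup_dedupT (E : List (List α)) : ((dedupT E).val.map List.toFinset).Nodup := by
  induction E with
  | nil => exact List.nodup_nil
  | cons e E ih =>
    simp only [dedupT, val_step, val_bind, val_ite, val_pure, anyT_val, sameSetT_val]
    split_ifs with h
    · exact ih
    · rw [List.map_cons, List.nodup_cons]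
      refine ⟨fun hm => h ?_, ih⟩
      obtain ⟨f, hf, hef⟩ := List.mem_map.1 hm
      exact List.any_eq_true.2 ⟨f, hf, decide_eq_true hef.symm⟩

@[simp] lemma selectT_val (v : α) (I : Inst α) : (selectT v I).val =
    ⟨I.V.filter fun x => !decide (v = x), I.E.filter fun e => !decide (v ∈ e), v :: I.S⟩ := by
  simp [selectT]

@[simp] lemma discardT_val (v : α) (I : Inst α) : (discardT v I).val =
    ⟨I.V.filter fun x => !decide (v = x),
      (dedupT (I.E.map fun e => e.filter fun x => !decide (v = x))).val, I.S⟩ := by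
  simp [discardT]

end Values
/-! ### Instances -/

section Instances

open Finset

variable {α : Type} [DecidableEq α]

/-- Minimal transversals of a family, in the form in which the algorithm tests for them: `T` meets
all members of `F`, and each element of `T` is the only element of `T` in some member of `F`. -/
def IsMinimalHittingSet (F : Finset (Finset α)) (T : Finset α) : Prop :=
  (∀ s ∈ F, (s ∩ T).Nonempty) ∧ ∀ x ∈ T, ∃ s ∈ F, s ∩ T = {x}

lemma toFinset_filter_ne (l : List α) (v : α) :
    (l.filter fun x => !decide (v = x)).toFinset = l.toFinset.erase v := by
  ext y
  simp only [List.mem_toFinset, List.mem_filter, mem_erase, Bool.not_eq_true',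
    decide_eq_false_iff_not]
  exact ⟨fun h => ⟨Ne.symm h.2, h.1⟩, fun h => ⟨h.2, Ne.symm h.1⟩⟩

lemma exists_not_nonempty_inter_erase_iff {F : Finset (Finset α)} {T : Finset α}
    (hT : ∀ s ∈ F, (s ∩ T).Nonempty) (x : α) :
    (∃ s ∈ F, ¬ (s ∩ T.erase x).Nonempty) ↔ ∃ s ∈ F, s ∩ T = {x} := by
  refine exists_congr fun s => and_congr_right fun hs => ?_
  rw [not_nonempty_iff_eq_empty, inter_erase, erase_eq_empty_iff,
    or_iff_right (hT s hs).ne_empty]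

lemma isMinimalT_val (E : List (List α)) (T : List α) :
    (isMinimalT E T).val = true ↔ IsMinimalHittingSet (family E) T.toFinset := by
  simp only [isMinimalT, val_bind, val_ite, hitsAllT_val, allT_val, val_pure, filterT_val,
    neT_val, IsMinimalHittingSet, toFinset_filter_ne, decide_eq_true_eq]
  split_ifs with h
  · simp only [List.all_eq_true, Bool.not_eq_true', decide_eq_false_iff_not, ← List.mem_toFinset]
    rw [and_iff_right h]
    refine forall₂_congr fun x _ => ?_
    rw [← exists_not_nonempty_inter_erase_iff h x]
    push Not
    rfl
  · simp [h]

/-- The invariants of the instances `I` that arise from the input hyperedges `F₀`. -/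
structure Inst.Valid (F₀ : Finset (Finset α)) (I : Inst α) : Prop where
  nodup_vertices : I.V.Nodup
  nodup_selected : I.S.Nodup
  notMem_selected : ∀ x ∈ I.V, x ∉ I.S
  nodup_edge : ∀ e ∈ I.E, e.Nodup
  subset_vertices : ∀ e ∈ I.E, ∀ x ∈ e, x ∈ I.V
  length_le : ∀ e ∈ I.E, e.length ≤ 3
  nodup_edges : (I.E.map List.toFinset).Nodup
  exists_original : ∀ s ∈ family I.E, ∃ e₀ ∈ F₀, ∀ x ∈ e₀, x ∈ I.S ∨ x ∈ I.V → x ∈ s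
  exists_remaining : ∀ e₀ ∈ F₀, (∃ x ∈ e₀, x ∈ I.S) ∨ ∃ s ∈ family I.E, s ⊆ e₀

/-- The sets that the algorithm has to output on the instance `I`. -/
def Inst.IsSolution (F₀ : Finset (Finset α)) (I : Inst α) (T : Finset α) : Prop :=
  IsMinimalHittingSet F₀ T ∧ I.S.toFinset ⊆ T ∧ T ⊆ I.S.toFinset ∪ I.V.toFinset

/-- The instance `J` arises from `I` by selecting the vertices in `P` and discarding those
in `D`. -/
structure Inst.Reaches (F₀ : Finset (Finset α)) (I : Inst α) (P D : Finset α) (J : Inst α) :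
    Prop where
  valid : J.Valid F₀
  selected : J.S.toFinset = I.S.toFinset ∪ P
  vertices : J.V.toFinset = I.V.toFinset \ (P ∪ D)
  edges : family J.E = restrict (family I.E) P D
  select_subset : P ⊆ I.V.toFinset
  discard_subset : D ⊆ I.V.toFinset
  disjoint : Disjoint P D
  length_vertices : J.V.length + (#P + #D) = I.V.length
  length_selected : J.S.length = I.S.length + #P
  length_edges : J.E.length ≤ I.E.length

variable {F₀ : Finset (Finset α)} {I J : Inst α} {P D : Finset α} {v : α}

lemma Inst.Valid.inter_nonempty (hI : I.Valid F₀) {T : Finset α} (hT : I.IsSolution F₀ T)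
    {s : Finset α} (hs : s ∈ family I.E) : (s ∩ T).Nonempty := by
  obtain ⟨e₀, he₀, h⟩ := hI.exists_original s hs
  obtain ⟨x, hx⟩ := hT.1.1 e₀ he₀
  rw [mem_inter] at hx
  refine ⟨x, mem_inter.2 ⟨h x hx.1 ?_, hx.2⟩⟩
  simpa using hT.2.2 hx.2

lemma Inst.Valid.exists_private (hI : I.Valid F₀) {T : Finset α} (hT : I.IsSolution F₀ T)
    {x : α} (hx : x ∈ T) (hxS : x ∉ I.S) : ∃ s ∈ family I.E, s ∩ T = {x} := by
  obtain ⟨e₀, he₀, h⟩ := hT.1.2 x hx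
  rcases hI.exists_remaining e₀ he₀ with ⟨y, hy, hyS⟩ | ⟨s, hs, hse⟩
  · have hyT : y ∈ e₀ ∩ T := mem_inter.2 ⟨hy, hT.2.1 (List.mem_toFinset.2 hyS)⟩
    rw [h, mem_singleton] at hyT
    exact absurd (hyT ▸ hyS) hxS
  · refine ⟨s, hs, (subset_singleton_iff.1 ?_).resolve_left
      (hI.inter_nonempty hT hs).ne_empty⟩
    rw [← h]
    exact inter_subset_inter_right hse

lemma Inst.Reaches.isSolution_iff (h : I.Reaches F₀ P D J) (hI : I.Valid F₀) (T : Finset α) :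
    J.IsSolution F₀ T ↔ I.IsSolution F₀ T ∧ P ⊆ T ∧ Disjoint T D := by
  rw [IsSolution, IsSolution, h.selected, h.vertices, union_subset_iff]
  have hSD : Disjoint I.S.toFinset D := Finset.disjoint_right.2 fun x hxD hxS =>
    hI.notMem_selected x (List.mem_toFinset.1 (h.discard_subset hxD)) (List.mem_toFinset.1 hxS)
  constructor
  · rintro ⟨hmin, ⟨hS, hP⟩, hT⟩
    refine ⟨⟨hmin, hS, hT.trans ?_⟩, hP, disjoint_of_subset_left hT ?_⟩
    · exact union_subset (union_subset subset_union_left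
        (h.select_subset.trans subset_union_right)) (sdiff_subset.trans subset_union_right)
    · exact disjoint_union_left.2 ⟨disjoint_union_left.2 ⟨hSD, h.disjoint⟩,
        disjoint_of_subset_right subset_union_right sdiff_disjoint⟩
  · rintro ⟨⟨hmin, hS, hT⟩, hP, hTD⟩
    refine ⟨hmin, ⟨hS, hP⟩, fun x hx => ?_⟩
    have hxI := hT hx
    have hxD := Finset.disjoint_left.1 hTD hx
    simp only [mem_union, mem_sdiff] at hxI ⊢
    tauto

lemma Inst.Valid.reaches_refl (hI : I.Valid F₀) : I.Reaches F₀ ∅ ∅ I where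
  valid := hI
  selected := by simp
  vertices := by simp
  edges := (restrict_empty _).symm
  select_subset := empty_subset _
  discard_subset := empty_subset _
  disjoint := disjoint_empty_left _
  length_vertices := by simp
  length_selected := by simp
  length_edges := le_rfl

lemma family_select (E : List (List α)) (v : α) :
    family (E.filter fun e => !decide (v ∈ e)) = restrict (family E) {v} ∅ := by
  ext s
  simp only [mem_family, mem_restrict, List.mem_filter, sdiff_empty, disjoint_singleton_right]
  constructor
  · rintro ⟨e, ⟨he, hv⟩, rfl⟩
    exact ⟨_, ⟨e, he, rfl⟩, by simpa using hv, rfl⟩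
  · rintro ⟨_, ⟨e, he, rfl⟩, hv, rfl⟩
    exact ⟨e, ⟨he, by simpa using hv⟩, rfl⟩

lemma family_discard (E : List (List α)) (v : α) :
    family (E.map fun e => e.filter fun x => !decide (v = x)) = restrict (family E) ∅ {v} := by
  ext s
  simp only [mem_family, mem_restrict, List.mem_map, disjoint_empty_right, true_and,
    sdiff_singleton_eq_erase]
  constructor
  · rintro ⟨_, ⟨e, he, rfl⟩, rfl⟩
    exact ⟨_, ⟨e, he, rfl⟩, (toFinset_filter_ne e v).symm⟩
  · rintro ⟨_, ⟨e, he, rfl⟩, rfl⟩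
    exact ⟨_, ⟨e, he, rfl⟩, toFinset_filter_ne e v⟩

lemma length_filter_ne {l : List α} (hl : l.Nodup) (hv : v ∈ l) :
    (l.filter fun x => !decide (v = x)).length + 1 = l.length := by
  rw [← List.toFinset_card_of_nodup (hl.filter _), toFinset_filter_ne,
    card_erase_add_one (List.mem_toFinset.2 hv), List.toFinset_card_of_nodup hl]

lemma Inst.Valid.select (hI : I.Valid F₀) (hv : v ∈ I.V) : (selectT v I).val.Valid F₀ := by
  rw [selectT_val]
  constructor
  · exact hI.nodup_vertices.filter _
  · exact List.nodup_cons.2 ⟨hI.notMem_selected v hv, hI.nodup_selected⟩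
  · intro x hx
    simp only [List.mem_filter, Bool.not_eq_true', decide_eq_false_iff_not] at hx
    simp only [List.mem_cons, not_or]
    exact ⟨Ne.symm hx.2, hI.notMem_selected x hx.1⟩
  · exact fun e he => hI.nodup_edge e (List.mem_of_mem_filter he)
  · intro e he x hx
    simp only [List.mem_filter, Bool.not_eq_true', decide_eq_false_iff_not] at he ⊢
    exact ⟨hI.subset_vertices e he.1 x hx, fun h => he.2 (h ▸ hx)⟩
  · exact fun e he => hI.length_le e (List.mem_of_mem_filter he)
  · exact hI.nodup_edges.sublist (List.filter_sublist.map _)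
  · intro s hs
    rw [family_select, mem_restrict] at hs
    obtain ⟨s, hs, -, rfl⟩ := hs
    obtain ⟨e₀, he₀, h⟩ := hI.exists_original s hs
    refine ⟨e₀, he₀, fun x hx hxI => ?_⟩
    rw [sdiff_empty]
    refine h x hx ?_
    simp only [List.mem_filter, List.mem_cons] at hxI
    rcases hxI with (rfl | h) | h
    exacts [Or.inr hv, Or.inl h, Or.inr h.1]
  · intro e₀ he₀
    rcases hI.exists_remaining e₀ he₀ with ⟨x, hx, hxS⟩ | ⟨s, hs, hse⟩
    · exact Or.inl ⟨x, hx, List.mem_cons_of_mem _ hxS⟩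
    · by_cases hvs : v ∈ s
      · exact Or.inl ⟨v, hse hvs, List.mem_cons_self⟩
      · refine Or.inr ⟨s, ?_, hse⟩
        rw [family_select, mem_restrict]
        exact ⟨s, hs, by simpa using hvs, sdiff_empty⟩

lemma Inst.Valid.discard (hI : I.Valid F₀) (hv : v ∈ I.V) : (discardT v I).val.Valid F₀ := by
  rw [discardT_val]
  have hsub := dedupT_sublist (I.E.map fun e => e.filter fun x => !decide (v = x))
  constructor
  · exact hI.nodup_vertices.filter _
  · exact hI.nodup_selected
  · exact fun x hx => hI.notMem_selected x (List.mem_of_mem_filter hx)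
  · intro e he
    obtain ⟨f, hf, rfl⟩ := List.mem_map.1 (hsub.subset he)
    exact (hI.nodup_edge f hf).filter _
  · intro e he x hx
    obtain ⟨f, hf, rfl⟩ := List.mem_map.1 (hsub.subset he)
    rw [List.mem_filter] at hx ⊢
    exact ⟨hI.subset_vertices f hf x hx.1, hx.2⟩
  · intro e he
    obtain ⟨f, hf, rfl⟩ := List.mem_map.1 (hsub.subset he)
    exact (List.length_filter_le _ _).trans (hI.length_le f hf)
  · exact nodup_dedupT _
  · intro s hs
    rw [family_dedupT, family_discard, mem_restrict] at hs
    obtain ⟨s, hs, -, rfl⟩ := hs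
    obtain ⟨e₀, he₀, h⟩ := hI.exists_original s hs
    refine ⟨e₀, he₀, fun x hx hxI => ?_⟩
    rw [mem_sdiff, mem_singleton]
    simp only [List.mem_filter, Bool.not_eq_true', decide_eq_false_iff_not] at hxI
    rcases hxI with hxI | hxI
    · exact ⟨h x hx (Or.inl hxI), fun hxv => hI.notMem_selected v hv (hxv ▸ hxI)⟩
    · exact ⟨h x hx (Or.inr hxI.1), fun hxv => hxI.2 hxv.symm⟩
  · intro e₀ he₀
    rcases hI.exists_remaining e₀ he₀ with h | ⟨s, hs, hse⟩
    · exact Or.inl h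
    · refine Or.inr ⟨s \ {v}, ?_, sdiff_subset.trans hse⟩
      rw [family_dedupT, family_discard, mem_restrict]
      exact ⟨s, hs, by simp, rfl⟩

lemma Inst.Reaches.mem_vertices (h : I.Reaches F₀ P D J) {x : α} :
    x ∈ J.V ↔ x ∈ I.V ∧ x ∉ P ∪ D := by
  rw [← List.mem_toFinset, h.vertices, mem_sdiff, List.mem_toFinset]

lemma Inst.Reaches.select (h : I.Reaches F₀ P D J) (hv : v ∈ I.V) (hP : v ∉ P) (hD : v ∉ D) :
    I.Reaches F₀ (insert v P) D (selectT v J).val := by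
  have hvJ : v ∈ J.V := h.mem_vertices.2 ⟨hv, by simp [hP, hD]⟩
  have hval := h.valid.select hvJ
  rw [selectT_val] at hval ⊢
  constructor
  · exact hval
  · rw [List.toFinset_cons, h.selected, union_insert]
  · rw [toFinset_filter_ne, h.vertices]
    ext x
    simp only [mem_erase, mem_sdiff, mem_union, mem_insert]
    tauto
  · rw [family_select, h.edges, restrict_restrict (by simpa using hD), union_empty, union_comm,
      ← insert_eq]
  · exact insert_subset (List.mem_toFinset.2 hv) h.select_subset
  · exact h.discard_subset
  · exact disjoint_insert_left.2 ⟨hD, h.disjoint⟩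
  · have hfilter := length_filter_ne h.valid.nodup_vertices hvJ
    have hlength := h.length_vertices
    rw [card_insert_of_notMem hP]
    simp only
    omega
  · have hlength := h.length_selected
    rw [card_insert_of_notMem hP, List.length_cons]
    omega
  · exact (List.length_filter_le _ _).trans h.length_edges

lemma Inst.Reaches.discard (h : I.Reaches F₀ P D J) (hv : v ∈ I.V) (hP : v ∉ P) (hD : v ∉ D) :
    I.Reaches F₀ P (insert v D) (discardT v J).val := by
  have hvJ : v ∈ J.V := h.mem_vertices.2 ⟨hv, by simp [hP, hD]⟩
  have hval := h.valid.discard hvJ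
  rw [discardT_val] at hval ⊢
  constructor
  · exact hval
  · exact h.selected
  · rw [toFinset_filter_ne, h.vertices]
    ext x
    simp only [mem_erase, mem_sdiff, mem_union, mem_insert]
    tauto
  · rw [family_dedupT, family_discard, h.edges, restrict_restrict (disjoint_empty_right _),
      union_empty, union_comm D, ← insert_eq]
  · exact h.select_subset
  · exact insert_subset (List.mem_toFinset.2 hv) h.discard_subset
  · exact disjoint_insert_right.2 ⟨hP, h.disjoint⟩
  · have hfilter := length_filter_ne h.valid.nodup_vertices hvJ
    have hlength := h.length_vertices
    rw [card_insert_of_notMem hD]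
    simp only
    omega
  · exact h.length_selected
  · refine (dedupT_sublist _).length_le.trans ?_
    rw [List.length_map]
    exact h.length_edges

lemma Inst.Reaches.selectAll (h : I.Reaches F₀ P D J) (l : List α) (hl : l.Nodup)
    (hV : ∀ v ∈ l, v ∈ I.V ∧ v ∉ P ∧ v ∉ D) :
    I.Reaches F₀ (l.toFinset ∪ P) D (selectAllT l J).val := by
  induction l generalizing P J with
  | nil => simpa [selectAllT] using h
  | cons v l ih =>
    rw [List.nodup_cons] at hl
    obtain ⟨hv, hvP, hvD⟩ := hV v List.mem_cons_self
    have hrec := ih (h.select hv hvP hvD) hl.2 fun u hu => by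
      obtain ⟨huV, huP, huD⟩ := hV u (List.mem_cons_of_mem _ hu)
      exact ⟨huV, by simp [ne_of_mem_of_not_mem hu hl.1, huP], huD⟩
    rwa [List.toFinset_cons, insert_union, ← union_insert]

lemma Inst.Reaches.discardAll (h : I.Reaches F₀ P D J) (l : List α) (hl : l.Nodup)
    (hV : ∀ v ∈ l, v ∈ I.V ∧ v ∉ P ∧ v ∉ D) :
    I.Reaches F₀ P (l.toFinset ∪ D) (discardAllT l J).val := by
  induction l generalizing D J with
  | nil => simpa [discardAllT] using h
  | cons v l ih =>
    rw [List.nodup_cons] at hl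
    obtain ⟨hv, hvP, hvD⟩ := hV v List.mem_cons_self
    have hrec := ih (h.discard hv hvP hvD) hl.2 fun u hu => by
      obtain ⟨huV, huP, huD⟩ := hV u (List.mem_cons_of_mem _ hu)
      exact ⟨huV, huP, by simp [ne_of_mem_of_not_mem hu hl.1, huD]⟩
    rwa [List.toFinset_cons, insert_union, ← union_insert]

lemma Inst.Valid.card_filter_family (hI : I.Valid F₀) (p : Finset α → Prop) [DecidablePred p] :
    #{s ∈ family I.E | p s} = I.E.countP fun e => decide (p e.toFinset) := by
  have hfamily : {s ∈ family I.E | p s} =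
      ((I.E.map List.toFinset).filter fun s => decide (p s)).toFinset := by
    ext s
    simp [family]
  rw [hfamily, List.toFinset_card_of_nodup (hI.nodup_edges.filter _), List.countP_eq_length_filter,
    List.filter_map, List.length_map]
  rfl

lemma Inst.Valid.degree_eq (hI : I.Valid F₀) (v : α) :
    (degreeT I.E v).val = degree (family I.E) v := by
  rw [degreeT_val, degree, hI.card_filter_family]
  simp

lemma Inst.Valid.card_eq (hI : I.Valid F₀) {e : List α} (he : e ∈ I.E) :
    #e.toFinset = e.length := List.toFinset_card_of_nodup (hI.nodup_edge e he)

lemma Inst.Valid.degreeTwo_eq (hI : I.Valid F₀) (v : α) :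
    (degreeTwoT I.E v).val = degree (pairs (family I.E)) v := by
  rw [degreeTwoT, countT_val, degree, pairs, filter_filter, hI.card_filter_family]
  exact List.countP_congr fun e he => by simp [hI.card_eq he]

end Instances

/-! ### Correctness of the rules -/

section Rules

open Finset

variable {α : Type} [DecidableEq α] {F₀ : Finset (Finset α)} {I J J₁ J₂ : Inst α}
  {P D T s : Finset α} {u v w x : α}

/-- Correctness of a branching: the instances `Js` partition the solutions of `I`, are smaller
than `I`, and do not have a larger total weight. -/
structure IsGoodBranch (F₀ : Finset (Finset α)) (I : Inst α) (Js : List (Inst α)) : Prop where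
  valid : ∀ J ∈ Js, J.Valid F₀
  size_lt : ∀ J ∈ Js, J.V.length + J.E.length < I.V.length + I.E.length
  vertices_le : ∀ J ∈ Js, J.V.length ≤ I.V.length
  edges_le : ∀ J ∈ Js, J.E.length ≤ I.E.length
  selected_le : ∀ J ∈ Js, J.S.length + J.V.length ≤ I.S.length + I.V.length
  length_le : Js.length ≤ 3
  solution : ∀ T, I.IsSolution F₀ T ↔ ∃ J ∈ Js, J.IsSolution F₀ T
  disjoint : Js.Pairwise fun J J' => ∀ T, J.IsSolution F₀ T → ¬J'.IsSolution F₀ T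
  sum_weight_le : (Js.map fun J => weight (family J.E)).sum ≤ weight (family I.E)

/-- Correctness of what a rule does with the instance `I`: it either outputs the only solution of
`I`, if there is one, or branches correctly. -/
def Outcome.IsGood (F₀ : Finset (Finset α)) (I : Inst α) : Outcome α → Prop
  | .halt out => out.length ≤ 1 ∧ (∀ l ∈ out, l.Nodup) ∧
      ∀ T, T ∈ out.map List.toFinset ↔ I.IsSolution F₀ T
  | .branch Js => IsGoodBranch F₀ I Js

lemma Inst.Reaches.size_lt (h : I.Reaches F₀ P D J) (hpos : 0 < #P + #D) :
    J.V.length + J.E.length < I.V.length + I.E.length := by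
  have hV := h.length_vertices
  have hE := h.length_edges
  omega

lemma Inst.Reaches.vertices_le (h : I.Reaches F₀ P D J) : J.V.length ≤ I.V.length :=
  le_of_add_le_left h.length_vertices.le

lemma Inst.Reaches.selected_le (h : I.Reaches F₀ P D J) :
    J.S.length + J.V.length ≤ I.S.length + I.V.length := by
  have hV := h.length_vertices
  have hS := h.length_selected
  omega

lemma isGoodBranch_of_reaches (hI : I.Valid F₀) (L : List (Finset α × Finset α × Inst α))
    (hlen : L.length ≤ 3)
    (hL : ∀ t ∈ L, I.Reaches F₀ t.1 t.2.1 t.2.2 ∧ 0 < #t.1 + #t.2.1)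
    (hsol : ∀ T, I.IsSolution F₀ T → ∃ t ∈ L, t.1 ⊆ T ∧ Disjoint T t.2.1)
    (hdisj : L.Pairwise fun t t' => ¬Disjoint t.1 t'.2.1 ∨ ¬Disjoint t.2.1 t'.1)
    (hw : (L.map fun t => weight (restrict (family I.E) t.1 t.2.1)).sum ≤ weight (family I.E)) :
    IsGoodBranch F₀ I (L.map fun t => t.2.2) where
  valid := List.forall_mem_map.2 fun t ht => (hL t ht).1.valid
  size_lt := List.forall_mem_map.2 fun t ht => (hL t ht).1.size_lt (hL t ht).2
  vertices_le := List.forall_mem_map.2 fun t ht => (hL t ht).1.vertices_le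
  edges_le := List.forall_mem_map.2 fun t ht => (hL t ht).1.length_edges
  selected_le := List.forall_mem_map.2 fun t ht => (hL t ht).1.selected_le
  length_le := by rwa [List.length_map]
  solution T := by
    simp only [List.mem_map, exists_exists_and_eq_and]
    constructor
    · intro hT
      obtain ⟨t, ht, hP, hD⟩ := hsol T hT
      exact ⟨t, ht, ((hL t ht).1.isSolution_iff hI T).2 ⟨hT, hP, hD⟩⟩
    · rintro ⟨t, ht, hT⟩
      exact (((hL t ht).1.isSolution_iff hI T).1 hT).1
  disjoint := by
    rw [List.pairwise_map]
    refine hdisj.imp_of_mem fun {t t'} ht ht' h T hT hT' => ?_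
    obtain ⟨-, hP, hD⟩ := ((hL t ht).1.isSolution_iff hI T).1 hT
    obtain ⟨-, hP', hD'⟩ := ((hL t' ht').1.isSolution_iff hI T).1 hT'
    exact h.elim (· (hD'.mono_left hP)) (· (hD.symm.mono_right hP'))
  sum_weight_le := by
    rw [List.map_map]
    refine (congrArg List.sum (List.map_congr_left fun t ht => ?_)).trans_le hw
    rw [Function.comp_apply, (hL t ht).1.edges]

lemma isGoodBranch_select_or_discard (hI : I.Valid F₀) (hJ₁ : I.Reaches F₀ {v} D J₁)
    (hJ₂ : I.Reaches F₀ P {v} J₂) (hD : ∀ T, I.IsSolution F₀ T → v ∈ T → Disjoint T D)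
    (hP : ∀ T, I.IsSolution F₀ T → v ∉ T → P ⊆ T)
    (hw : weight (restrict (family I.E) {v} D) + weight (restrict (family I.E) P {v}) ≤
      weight (family I.E)) :
    IsGoodBranch F₀ I [J₁, J₂] := by
  refine isGoodBranch_of_reaches hI [({v}, D, J₁), (P, {v}, J₂)] (by simp) ?_ (fun T hT => ?_)
    (by simp) (by simpa using hw)
  · simp [hJ₁, hJ₂]
  · simp only [List.mem_cons, List.not_mem_nil, or_false, exists_eq_or_imp, exists_eq_left,
      singleton_subset_iff, disjoint_singleton_right]
    by_cases hv : v ∈ T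
    exacts [Or.inl ⟨hv, hD T hT hv⟩, Or.inr ⟨hP T hT hv, hv⟩]

lemma Inst.Valid.card_le (hI : I.Valid F₀) : ∀ s ∈ family I.E, #s ≤ 3 := by
  intro s hs
  obtain ⟨e, he, rfl⟩ := mem_family.1 hs
  exact (List.toFinset_card_le e).trans (hI.length_le e he)

lemma Inst.Valid.mem_vertices (hI : I.Valid F₀) (hs : s ∈ family I.E) (hx : x ∈ s) :
    x ∈ I.V := by
  obtain ⟨e, he, rfl⟩ := mem_family.1 hs
  exact hI.subset_vertices e he x (List.mem_toFinset.1 hx)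

lemma Inst.Valid.degree_eq_zero (hI : I.Valid F₀) (hx : x ∉ I.V) : degree (family I.E) x = 0 :=
  degree_eq_zero_iff.2 fun _ hs hxs => hx (hI.mem_vertices hs hxs)

lemma Inst.Valid.exists_private_edge (hI : I.Valid F₀) (hT : I.IsSolution F₀ T)
    (hv : v ∈ I.V) (hvT : v ∈ T) :
    ∃ s ∈ family I.E, v ∈ s ∧ ∀ y ∈ s, y ∈ T → y = v := by
  obtain ⟨s, hs, h⟩ := hI.exists_private hT hvT (hI.notMem_selected v hv)
  exact ⟨s, hs, (mem_inter.1 (singleton_subset_iff.1 h.ge)).1, fun y hys hyT =>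
    mem_singleton.1 (h.le (mem_inter.2 ⟨hys, hyT⟩))⟩

lemma Inst.Valid.notMem_of_dominated (hI : I.Valid F₀) (hT : I.IsSolution F₀ T) (hv : v ∈ I.V)
    (hvT : v ∈ T) (huv : u ≠ v) (hu : ∀ s ∈ family I.E, v ∈ s → u ∈ s) : u ∉ T := by
  obtain ⟨s, hs, hvs, hunique⟩ := hI.exists_private_edge hT hv hvT
  exact fun huT => huv (hunique u (hu s hs hvs) huT)

lemma Inst.Valid.reaches_select (hI : I.Valid F₀) (hv : v ∈ I.V) :
    I.Reaches F₀ {v} ∅ (selectT v I).val :=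
  hI.reaches_refl.select hv (notMem_empty v) (notMem_empty v)

lemma Inst.Valid.reaches_discard (hI : I.Valid F₀) (hv : v ∈ I.V) :
    I.Reaches F₀ ∅ {v} (discardT v I).val :=
  hI.reaches_refl.discard hv (notMem_empty v) (notMem_empty v)

lemma Inst.Valid.reaches_select_discard (hI : I.Valid F₀) (hv : v ∈ I.V) (hu : u ∈ I.V)
    (huv : u ≠ v) : I.Reaches F₀ {v} {u} (discardT u (selectT v I).val).val :=
  (hI.reaches_select hv).discard hu (by simpa using huv) (notMem_empty u)

lemma Inst.Valid.reaches_select_discardAll_pair (hI : I.Valid F₀) (hv : v ∈ I.V) (hu : u ∈ I.V)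
    (hw : w ∈ I.V) (hvu : v ≠ u) (hvw : v ≠ w) (huw : u ≠ w) :
    I.Reaches F₀ {v} {u, w} (discardAllT [u, w] (selectT v I).val).val := by
  have h := (hI.reaches_select hv).discardAll [u, w] (by simpa using huw)
    (by simp [hu, hw, hvu.symm, hvw.symm])
  rwa [union_empty, List.toFinset_cons, List.toFinset_cons, List.toFinset_nil,
    insert_empty_eq] at h

lemma isGood_halt_of_empty_mem (hI : I.Valid F₀) (h : ∅ ∈ family I.E) :
    (Outcome.halt []).IsGood F₀ I := by
  refine ⟨by simp, by simp, fun T => iff_of_false (by simp) fun hT => ?_⟩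
  simpa using hI.inter_nonempty hT h

lemma Inst.Valid.isSolution_iff_of_edges_eq_nil (hI : I.Valid F₀) (h : I.E = []) (T : Finset α) :
    I.IsSolution F₀ T ↔ T = I.S.toFinset ∧ IsMinimalHittingSet F₀ I.S.toFinset := by
  constructor
  · intro hT
    have hTS : T = I.S.toFinset := by
      refine Finset.Subset.antisymm (fun x hx => ?_) hT.2.1
      by_contra hxS
      obtain ⟨s, hs, -⟩ := hI.exists_private hT hx (by simpa using hxS)
      simp [h, family] at hs
    exact ⟨hTS, hTS ▸ hT.1⟩
  · rintro ⟨rfl, hmin⟩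
    exact ⟨hmin, Finset.Subset.refl _, subset_union_left⟩

lemma isGood_halt_of_edges_eq_nil {E₀ : List (List α)} (hI : I.Valid (family E₀))
    (h : I.E = []) :
    (if (isMinimalT E₀ I.S).val = true then Outcome.halt [I.S] else .halt []).IsGood
      (family E₀) I := by
  split_ifs with hmin <;> rw [isMinimalT_val] at hmin
  · refine ⟨by simp, by simpa using hI.nodup_selected, fun T => ?_⟩
    simp [hI.isSolution_iff_of_edges_eq_nil h, hmin]
  · refine ⟨by simp, by simp, fun T => ?_⟩
    simp [hI.isSolution_iff_of_edges_eq_nil h, hmin]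

lemma isGoodBranch_degree_zero (hI : I.Valid F₀) (hv : v ∈ I.V)
    (hd : degree (family I.E) v = 0) : IsGoodBranch F₀ I [(discardT v I).val] := by
  have hvs := degree_eq_zero_iff.1 hd
  refine isGoodBranch_of_reaches hI [(∅, {v}, (discardT v I).val)] (by simp) ?_ (fun T hT => ?_)
    (by simp) ?_
  · simpa using hI.reaches_discard hv
  · simp only [List.mem_singleton, exists_eq_left, empty_subset, true_and,
      disjoint_singleton_right]
    intro hvT
    obtain ⟨s, hs, hv, -⟩ := hI.exists_private_edge hT hv hvT
    exact hvs s hs hv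
  · simp [restrict_eq_self (fun s _ => disjoint_empty_right s)
      fun s hs => disjoint_singleton_right.2 (hvs s hs)]

lemma family_filter_ne (E : List (List α)) (t : Finset α) :
    family (E.filter fun e => !decide (e.toFinset = t)) = (family E).erase t := by
  ext s
  simp only [mem_family, List.mem_filter, mem_erase, Bool.not_eq_true', decide_eq_false_iff_not]
  constructor
  · rintro ⟨g, ⟨hg, hgt⟩, rfl⟩
    exact ⟨hgt, g, hg, rfl⟩
  · rintro ⟨hgt, g, hg, rfl⟩
    exact ⟨g, ⟨hg, hgt⟩, rfl⟩

lemma Inst.Valid.remove_superset (hI : I.Valid F₀) {t : Finset α} (hs : s ∈ family I.E)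
    (hst : s ⊂ t) :
    (Inst.mk I.V (I.E.filter fun e => !decide (e.toFinset = t)) I.S).Valid F₀ where
  nodup_vertices := hI.nodup_vertices
  nodup_selected := hI.nodup_selected
  notMem_selected := hI.notMem_selected
  nodup_edge e he := hI.nodup_edge e (List.mem_of_mem_filter he)
  subset_vertices e he := hI.subset_vertices e (List.mem_of_mem_filter he)
  length_le e he := hI.length_le e (List.mem_of_mem_filter he)
  nodup_edges := hI.nodup_edges.sublist (List.filter_sublist.map _)
  exists_original r hr := by
    rw [family_filter_ne] at hr
    exact hI.exists_original r (mem_of_mem_erase hr)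
  exists_remaining e₀ he₀ := by
    refine (hI.exists_remaining e₀ he₀).imp_right fun ⟨r, hr, hre⟩ => ?_
    rw [family_filter_ne]
    obtain rfl | hrt := eq_or_ne r t
    · exact ⟨s, mem_erase.2 ⟨hst.ne, hs⟩, hst.subset.trans hre⟩
    · exact ⟨r, mem_erase.2 ⟨hrt, hr⟩, hre⟩

lemma isGoodBranch_superset (hI : I.Valid F₀) {f : List α} (hs : s ∈ family I.E) (hf : f ∈ I.E)
    (hsf : s ⊂ f.toFinset) :
    IsGoodBranch F₀ I [⟨I.V, I.E.filter fun e => !decide (e.toFinset = f.toFinset), I.S⟩] := by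
  have hlen : (I.E.filter fun e => !decide (e.toFinset = f.toFinset)).length < I.E.length :=
    List.length_filter_lt_length_iff_exists.2 ⟨f, hf, by simp⟩
  refine ⟨?_, ?_, ?_, ?_, ?_, by simp, ?_, List.pairwise_singleton _ _, ?_⟩ <;>
    simp only [List.mem_singleton, forall_eq, exists_eq_left, List.map_singleton,
      List.sum_singleton]
  · exact hI.remove_superset hs hsf
  · exact Nat.add_lt_add_left hlen _
  · exact le_rfl
  · exact hlen.le
  · exact le_rfl
  · exact fun T => Iff.rfl
  · rw [family_filter_ne, weight_eq_of_core_eq (core_erase_of_ssubset hs hsf)]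

lemma isGoodBranch_singleton (hI : I.Valid F₀) (hv : {v} ∈ family I.E) :
    IsGoodBranch F₀ I [(selectAllT [v] I).val] := by
  have hvV := hI.mem_vertices hv (mem_singleton_self v)
  refine isGoodBranch_of_reaches hI [({v}, ∅, (selectAllT [v] I).val)] (by simp) ?_
    (fun T hT => ?_) (by simp) ?_
  · simpa using hI.reaches_refl.selectAll [v] (by simp) (by simpa using hvV)
  · simpa [← not_disjoint_iff_nonempty_inter] using hI.inter_nonempty hT hv
  · simp [weight_eq_of_core_eq (core_restrict_of_singletons_mem (F := family I.E) (P := {v})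
      (by simpa using hv))]

end Rules

section Branchings

open Finset

variable {α : Type} [DecidableEq α] {F₀ : Finset (Finset α)} {I : Inst α} {u v w : α}

lemma ne_of_card_eq_three {a b c : α} (h : #{a, b, c} = 3) : a ≠ b ∧ a ≠ c ∧ b ≠ c := by
  have hle : ∀ x y : α, #{x, y} ≠ 3 := fun x y hxy => by
    have := card_le_two (a := x) (b := y)
    omega
  refine ⟨?_, ?_, ?_⟩ <;> rintro rfl
  · exact hle a c (by simpa using h)
  · exact hle b a (by simpa [insert_comm a b] using h)
  · exact hle a b (by simpa using h)

lemma toFinset_eq_insert_of_filter_ne {e l : List α} (hv : v ∈ e)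
    (h : (e.filter fun x => !decide (v = x)) = l) : e.toFinset = insert v l.toFinset := by
  rw [← h, toFinset_filter_ne, insert_erase (List.mem_toFinset.2 hv)]

lemma isGoodBranch_degree_one_pair (hI : I.Valid F₀) (hC : IsClutter (family I.E))
    (hd : degree (family I.E) v = 1) (he : {v, u} ∈ family I.E) (huv : u ≠ v) :
    IsGoodBranch F₀ I [(discardT u (selectT v I).val).val, (discardT v I).val] := by
  have hv := hI.mem_vertices he (mem_insert_self v _)
  have hu := hI.mem_vertices he (mem_insert_of_mem (mem_singleton_self u))
  have hdom := mem_of_degree_eq_one (u := u) hd he (by simp) (by simp)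
  exact isGoodBranch_select_or_discard hI (hI.reaches_select_discard hv hu huv)
    (hI.reaches_discard hv)
    (fun T hT hvT => disjoint_singleton_right.2 (hI.notMem_of_dominated hT hv hvT huv hdom))
    (fun T _ _ => empty_subset T) (weight_branch_degree_one_pair hC hI.card_le hd huv he)

lemma isGoodBranch_degree_one_triple (hI : I.Valid F₀) (hC : IsClutter (family I.E))
    (hd : degree (family I.E) v = 1) (he : {v, u, w} ∈ family I.E) (hc : #{v, u, w} = 3)
    (huw : ¬(degree (family I.E) u = 1 ∧ degree (family I.E) w = 1)) :
    IsGoodBranch F₀ I [(discardAllT [u, w] (selectT v I).val).val, (discardT v I).val] := by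
  obtain ⟨hvu, hvw, huw'⟩ := ne_of_card_eq_three hc
  have hve : v ∈ ({v, u, w} : Finset α) := by simp
  have hue : u ∈ ({v, u, w} : Finset α) := by simp
  have hwe : w ∈ ({v, u, w} : Finset α) := by simp
  have hv := hI.mem_vertices he hve
  refine isGoodBranch_select_or_discard hI
    (hI.reaches_select_discardAll_pair hv (hI.mem_vertices he hue) (hI.mem_vertices he hwe)
      hvu hvw huw') (hI.reaches_discard hv) (fun T hT hvT => ?_) (fun T _ _ => empty_subset T) ?_
  · rw [disjoint_insert_right, disjoint_singleton_right]
    exact ⟨hI.notMem_of_dominated hT hv hvT hvu.symm (mem_of_degree_eq_one hd he hve hue),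
      hI.notMem_of_dominated hT hv hvT hvw.symm (mem_of_degree_eq_one hd he hve hwe)⟩
  · have herase : ({v, u, w} : Finset α).erase v = {u, w} := erase_insert (by simp [hvu, hvw])
    have hdu := degree_pos_of_mem he hue
    have hdw := degree_pos_of_mem he hwe
    rw [← herase]
    by_cases hdu1 : degree (family I.E) u = 1
    · exact weight_branch_degree_one_triple hC hI.card_le hd he hve hc hwe (by omega)
    · exact weight_branch_degree_one_triple hC hI.card_le hd he hve hc hue (by omega)

lemma weight_branch_isolated_sum {F : Finset (Finset α)} (hF : IsClutter F) (he : {v, u, w} ∈ F)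
    (hc : #{v, u, w} = 3) (hd : ∀ x ∈ ({v, u, w} : Finset α), degree F x = 1) :
    weight (restrict F {v} {u, w}) + (weight (restrict F {u} {v, w}) +
      weight (restrict F {w} {v, u})) ≤ weight F := by
  obtain ⟨hvu, hvw, huw⟩ := ne_of_card_eq_three hc
  have hle {a : α} (ha : a ∈ ({v, u, w} : Finset α)) := weight_branch_isolated hF he hc hd ha
  have hv := hle (a := v) (by simp)
  have hu := hle (a := u) (by simp)
  have hw := hle (a := w) (by simp)
  rw [erase_insert (by simp [hvu, hvw])] at hv
  rw [insert_comm, erase_insert (by simp [hvu.symm, huw])] at hu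
  rw [pair_comm, insert_comm, erase_insert (by simp [hvw.symm, huw.symm])] at hw
  linarith

lemma isGoodBranch_isolated (hI : I.Valid F₀) (hC : IsClutter (family I.E))
    (he : {v, u, w} ∈ family I.E) (hc : #{v, u, w} = 3)
    (hd : ∀ x ∈ ({v, u, w} : Finset α), degree (family I.E) x = 1) :
    IsGoodBranch F₀ I [(discardAllT [u, w] (selectT v I).val).val,
      (discardAllT [v, w] (selectT u I).val).val,
      (discardAllT [v, u] (selectT w I).val).val] := by
  obtain ⟨hvu, hvw, huw⟩ := ne_of_card_eq_three hc
  have hV : ∀ x ∈ ({v, u, w} : Finset α), x ∈ I.V := fun x hx => hI.mem_vertices he hx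
  have hv := hV v (by simp)
  have hu := hV u (by simp)
  have hw := hV w (by simp)
  refine isGoodBranch_of_reaches hI [({v}, {u, w}, _), ({u}, {v, w}, _), ({w}, {v, u}, _)]
    (by simp) ?_ (fun T hT => ?_) (by simp) (by simpa using weight_branch_isolated_sum hC he hc hd)
  · simp only [List.forall_mem_cons]
    exact ⟨⟨hI.reaches_select_discardAll_pair hv hu hw hvu hvw huw, by simp⟩,
      ⟨hI.reaches_select_discardAll_pair hu hv hw hvu.symm huw hvw, by simp⟩,
      ⟨hI.reaches_select_discardAll_pair hw hv hu hvw.symm huw.symm hvu, by simp⟩,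
      List.forall_mem_nil _⟩
  · have hunique : ∀ x ∈ ({v, u, w} : Finset α), x ∈ T → ∀ y ∈ ({v, u, w} : Finset α), y ≠ x →
        y ∉ T := fun x hx hxT y hy hyx =>
      hI.notMem_of_dominated hT (hV x hx) hxT hyx (mem_of_degree_eq_one (hd x hx) he hx hy)
    obtain ⟨x, hx⟩ := hI.inter_nonempty hT he
    have hmeet : v ∈ T ∨ u ∈ T ∨ w ∈ T := by
      rw [mem_inter, mem_insert, mem_insert, mem_singleton] at hx
      obtain ⟨rfl | rfl | rfl, hxT⟩ := hx <;> tauto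
    simp only [mem_insert, mem_singleton, forall_eq_or_imp, forall_eq] at hunique
    simp only [List.mem_cons, List.not_mem_nil, or_false, exists_eq_or_imp, exists_eq_left,
      singleton_subset_iff, disjoint_insert_right, disjoint_singleton_right]
    grind

lemma isGood_branchDegreeOne (hI : I.Valid F₀) (hC : IsClutter (family I.E))
    (hd : degree (family I.E) v = 1) {e : List α} (he : e ∈ I.E) (hve : v ∈ e) :
    (branchDegreeOne I v e).val.IsGood F₀ I := by
  have heF : e.toFinset ∈ family I.E := mem_family.2 ⟨e, he, rfl⟩
  have hcard := hI.card_eq he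
  have hlen := length_filter_ne (hI.nodup_edge e he) hve
  have htwo := hC.two_le_card _ heF
  have hthree := hI.length_le e he
  simp only [branchDegreeOne, val_bind, filterT_val, neT_val]
  split
  · rename_i u hr
    have heq := toFinset_eq_insert_of_filter_ne hve hr
    simp only [List.toFinset_cons, List.toFinset_nil, insert_empty_eq] at heq
    have huv : u ≠ v := by
      rintro rfl
      simp [heq] at htwo
    exact isGoodBranch_degree_one_pair hI hC hd (heq ▸ heF) huv
  · rename_i u w hr
    have heq := toFinset_eq_insert_of_filter_ne hve hr
    simp only [List.toFinset_cons, List.toFinset_nil, insert_empty_eq] at heq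
    rw [hr, List.length_cons, List.length_cons, List.length_nil] at hlen
    rw [heq] at heF hcard
    simp only [val_bind, val_ite, hI.degree_eq]
    split_ifs with hone
    · exact isGoodBranch_isolated hI hC heF (by omega) (by simp [hd, hone])
    · exact isGoodBranch_degree_one_triple hI hC hd heF (by omega) hone
  · rename_i hone htwo'
    match hr : e.filter fun x => !decide (v = x) with
    | [] => simp only [hr, List.length_nil] at hlen; omega
    | [u] => exact absurd hr (hone u)
    | [u, w] => exact absurd hr (htwo' u w)
    | _ :: _ :: _ :: _ => simp only [hr, List.length_cons] at hlen; omega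

end Branchings

section Values

variable {β : Type} {p : β → Timed Bool} {l : List β}

lemma findT_eq_some {b : β} (h : (findT p l).val = some b) : b ∈ l ∧ (p b).val = true := by
  rw [findT_val] at h
  exact ⟨List.mem_of_find?_eq_some h, List.find?_some (p := fun b => (p b).val) h⟩

lemma findT_eq_none (h : (findT p l).val = none) : ∀ b ∈ l, (p b).val = false := by
  rw [findT_val] at h
  simpa using List.find?_eq_none.1 h

end Values

section Branchings

open Finset

variable {α : Type} [DecidableEq α] {F₀ : Finset (Finset α)} {I : Inst α} {k : ℕ}
  {u v w x u₁ u₂ w₁ w₂ : α}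

lemma Inst.Valid.codegree_eq (hI : I.Valid F₀) (v u : α) :
    (countT (containsBothT v u) I.E).val = codegree (family I.E) v u := by
  rw [countT_val, codegree, hI.card_filter_family]
  simp

lemma Inst.Valid.isPairPartnerT_val (hI : I.Valid F₀) (v u : α) :
    (isPairPartnerT I.E v u).val = decide (u ∈ partners (family I.E) v) := by
  rw [Bool.eq_iff_iff, decide_eq_true_iff, mem_partners]
  simp only [isPairPartnerT, val_bind, val_ite, neT_val, anyT_val, isPairAtT_val, memT_val,
    val_pure]
  obtain rfl | huv := eq_or_ne u v
  · simp
  · simp only [huv.symm, decide_false, Bool.not_false, if_true, List.any_eq_true, mem_family,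
      ne_eq, huv, not_false_eq_true, true_and, Bool.if_false_right, Bool.and_eq_true,
      decide_eq_true_eq]
    refine exists_congr fun e => and_congr_right fun he => ?_
    rw [← hI.card_eq he, ← List.mem_toFinset, ← List.mem_toFinset]
    constructor
    · rintro ⟨⟨hc, hv⟩, hu⟩
      exact (eq_of_subset_of_card_le (by simp [insert_subset_iff, hv, hu])
        (by rw [hc, card_pair huv.symm])).symm
    · intro h
      simp [h, card_pair huv.symm]

lemma Inst.Valid.toFinset_filter_partners (hI : I.Valid F₀) (v : α) :
    (I.V.filter fun u => decide (u ∈ partners (family I.E) v)).toFinset =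
      partners (family I.E) v := by
  ext u
  simp only [List.mem_toFinset, List.mem_filter, decide_eq_true_eq, and_iff_right_iff_imp]
  exact fun hu => hI.mem_vertices (mem_partners.1 hu).2 (by simp)

lemma Inst.Valid.reaches_discard_selectAll_partners (hI : I.Valid F₀) (hv : v ∈ I.V) :
    I.Reaches F₀ (partners (family I.E) v) {v}
      (selectAllT (I.V.filter fun u => decide (u ∈ partners (family I.E) v))
        (discardT v I).val).val := by
  have h := (hI.reaches_discard hv).selectAll
    (I.V.filter fun u => decide (u ∈ partners (family I.E) v)) (hI.nodup_vertices.filter _)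
    fun u hu => by
      rw [List.mem_filter, decide_eq_true_iff, mem_partners] at hu
      exact ⟨hu.1, notMem_empty u, by simpa using hu.2.1⟩
  rwa [hI.toFinset_filter_partners, union_empty] at h

lemma isGoodBranch_pair (hI : I.Valid F₀) (hC : IsClutter (family I.E))
    (hdeg : ∀ x, degree (family I.E) x ≠ 1) (hpos : 0 < degree (pairs (family I.E)) v)
    (hmax : ∀ x, degree (pairs (family I.E)) x ≤ degree (pairs (family I.E)) v)
    (hmax' : ∀ x, degree (pairs (family I.E)) x = degree (pairs (family I.E)) v →
      degree (family I.E) x ≤ degree (family I.E) v) :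
    IsGoodBranch F₀ I [(selectT v I).val,
      (selectAllT (I.V.filter fun u => decide (u ∈ partners (family I.E) v))
        (discardT v I).val).val] := by
  have hv : v ∈ I.V := by
    by_contra hv
    exact (hpos.trans_le (degree_pairs_le _ v)).ne' (hI.degree_eq_zero hv)
  refine isGoodBranch_select_or_discard hI (hI.reaches_select hv)
    (hI.reaches_discard_selectAll_partners hv) (fun T _ _ => disjoint_empty_right T)
    (fun T hT hvT u hu => ?_) (weight_branch_pair hC hI.card_le hdeg hpos hmax hmax')
  obtain ⟨y, hy⟩ := hI.inter_nonempty hT (mem_partners.1 hu).2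
  rw [mem_inter, mem_insert, mem_singleton] at hy
  obtain ⟨rfl | rfl, hyT⟩ := hy
  exacts [absurd hyT hvT, hyT]

lemma Inst.Valid.degree_le_of_argmaxT (hI : I.Valid F₀) {d : ℕ}
    (h : (argmaxT (degreeT I.E) I.V).val = some (v, d)) :
    v ∈ I.V ∧ d = degree (family I.E) v ∧
      ∀ x, degree (family I.E) x ≤ degree (family I.E) v := by
  obtain ⟨hv, hd, hmax⟩ := argmaxT_eq_some h
  simp only [hI.degree_eq] at hd hmax
  refine ⟨hv, hd, fun x => ?_⟩
  by_cases hx : x ∈ I.V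
  · exact (hmax x hx).trans hd.le
  · exact (hI.degree_eq_zero hx).trans_le (Nat.zero_le _)

lemma Inst.Valid.degree_pairs_le_of_argmaxT (hI : I.Valid F₀)
    (h : (argmaxT (degreeTwoT I.E) I.V).val = some (x, k)) :
    x ∈ I.V ∧ k = degree (pairs (family I.E)) x ∧
      ∀ y, degree (pairs (family I.E)) y ≤ k := by
  obtain ⟨hx, hk, hmax⟩ := argmaxT_eq_some h
  simp only [hI.degreeTwo_eq] at hk hmax
  refine ⟨hx, hk, fun y => ?_⟩
  by_cases hy : y ∈ I.V
  · exact hmax y hy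
  · exact ((degree_pairs_le _ y).trans (hI.degree_eq_zero hy).le).trans (Nat.zero_le _)

lemma Inst.Valid.degree_le_of_argmaxT_filter (hI : I.Valid F₀) {d : ℕ}
    (h : (argmaxT (degreeT I.E) (I.V.filter fun x =>
      degree (pairs (family I.E)) x == k)).val = some (v, d)) :
    degree (pairs (family I.E)) v = k ∧ ∀ x, degree (pairs (family I.E)) x = k →
      degree (family I.E) x ≤ degree (family I.E) v := by
  obtain ⟨hv, hd, hmax⟩ := argmaxT_eq_some h
  simp only [List.mem_filter, beq_iff_eq, hI.degree_eq, and_imp] at hv hd hmax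
  refine ⟨hv.2, fun x hxk => ?_⟩
  by_cases hx : x ∈ I.V
  · exact (hmax x hx hxk).trans hd.le
  · exact (hI.degree_eq_zero hx).trans_le (Nat.zero_le _)

lemma Inst.Valid.exists_mem_vertices (hI : I.Valid F₀) {e : List α} (he : e ∈ I.E)
    (h : 0 < e.length) : ∃ x ∈ I.V, x ∈ e := by
  obtain ⟨x, hx⟩ := List.exists_mem_of_length_pos h
  exact ⟨x, hI.subset_vertices e he x hx, hx⟩

lemma isGood_branchPair (hI : I.Valid F₀) (hC : IsClutter (family I.E))
    (hdeg : ∀ x, degree (family I.E) x ≠ 1) {e : List α} (he : e ∈ I.E) (h2 : e.length = 2) :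
    (branchPair I).val.IsGood F₀ I := by
  obtain ⟨y, hyV, hy⟩ := hI.exists_mem_vertices he (by omega)
  have hdy : 0 < degree (pairs (family I.E)) y :=
    degree_pos_of_mem (mem_pairs.2 ⟨mem_family.2 ⟨e, he, rfl⟩, by rw [hI.card_eq he, h2]⟩)
      (List.mem_toFinset.2 hy)
  simp only [branchPair, val_bind]
  split
  · rename_i x k hk
    obtain ⟨hx, hxk, hmax⟩ := hI.degree_pairs_le_of_argmaxT hk
    simp only [val_bind, filterT_val, val_pure, hI.degreeTwo_eq]
    split
    · rename_i v d hd
      obtain ⟨hvk, hmax'⟩ := hI.degree_le_of_argmaxT_filter hd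
      subst hvk
      simp only [val_bind, filterT_val, val_pure, hI.isPairPartnerT_val]
      exact isGoodBranch_pair hI hC hdeg (hdy.trans_le (hmax y)) hmax hmax'
    · rename_i hnone
      exact absurd hxk.symm (by simpa using List.filter_eq_nil_iff.1 (argmaxT_eq_none hnone) x hx)
  · rename_i hnone
    exact absurd hyV (by simp [argmaxT_eq_none hnone])

lemma isGoodBranch_degree_three (hI : I.Valid F₀) (hC : IsClutter (family I.E))
    (h3 : ∀ s ∈ family I.E, #s = 3) (hd : 3 ≤ degree (family I.E) v)
    (hmax : ∀ x, degree (family I.E) x ≤ degree (family I.E) v) (hv : v ∈ I.V) :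
    IsGoodBranch F₀ I [(selectT v I).val, (discardT v I).val] :=
  isGoodBranch_select_or_discard hI (hI.reaches_select hv) (hI.reaches_discard hv)
    (fun T _ _ => disjoint_empty_right T) (fun T _ _ => empty_subset T)
    (weight_branch_degree_three hC h3 hd hmax)

lemma isGoodBranch_twins (hI : I.Valid F₀) (hC : IsClutter (family I.E))
    (h3 : ∀ s ∈ family I.E, #s = 3) (hv : v ∈ I.V) (hu : u ∈ I.V) (huv : u ≠ v)
    (hdv : degree (family I.E) v = 2) (hdu : degree (family I.E) u = 2)
    (hvu : codegree (family I.E) v u = 2) :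
    IsGoodBranch F₀ I [(discardT u (selectT v I).val).val, (discardT v I).val] :=
  isGoodBranch_select_or_discard hI (hI.reaches_select_discard hv hu huv) (hI.reaches_discard hv)
    (fun _ hT hvT => disjoint_singleton_right.2
      (hI.notMem_of_dominated hT hv hvT huv (codegree_eq_degree_iff.1 (hvu.trans hdv.symm))))
    (fun T _ _ => empty_subset T) (weight_branch_twins hC h3 hdv hdu huv)

lemma isGoodBranch_degree_two (hI : I.Valid F₀) (hC : IsClutter (family I.E))
    (h3 : ∀ s ∈ family I.E, #s = 3) (hd : ∀ x ∈ I.V, degree (family I.E) x = 2)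
    (h₁ : {v, u₁, w₁} ∈ family I.E) (h₂ : {v, u₂, w₂} ∈ family I.E)
    (hv : ∀ s ∈ family I.E, v ∈ s → s = {v, u₁, w₁} ∨ s = {v, u₂, w₂})
    (hu₁ : u₁ ∉ ({v, u₂, w₂} : Finset α)) :
    IsGoodBranch F₀ I [(discardAllT [u₂, w₂] (selectT u₁ (selectT v I).val).val).val,
      (discardT u₁ (selectT v I).val).val, (discardT v I).val] := by
  obtain ⟨hvu₂, hvw₂, huw₂⟩ := ne_of_card_eq_three (h3 _ h₂)
  simp only [mem_insert, mem_singleton, not_or] at hu₁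
  obtain ⟨hu₁v, hu₁u₂, hu₁w₂⟩ := hu₁
  have hvV := hI.mem_vertices h₁ (mem_insert_self v _)
  have hu₁V := hI.mem_vertices (x := u₁) h₁ (by simp)
  have hu₂V := hI.mem_vertices (x := u₂) h₂ (by simp)
  have hw₂V := hI.mem_vertices (x := w₂) h₂ (by simp)
  have hsel := (hI.reaches_select hvV).select hu₁V (by simpa using hu₁v) (notMem_empty u₁)
  have hJ₁ := hsel.discardAll [u₂, w₂] (by simpa using huw₂)
    (by simp [hu₂V, hw₂V, hvu₂.symm, hvw₂.symm, Ne.symm hu₁u₂, Ne.symm hu₁w₂])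
  refine isGoodBranch_of_reaches hI
    [({v, u₁}, {u₂, w₂}, _), ({v}, {u₁}, _), (∅, {v}, _)] (by simp) ?_ (fun T hT => ?_) (by simp) ?_
  · simp only [List.forall_mem_cons]
    exact ⟨⟨by simpa [pair_comm u₁ v] using hJ₁, by simp⟩,
      ⟨hI.reaches_select_discard hvV hu₁V hu₁v, by simp⟩, ⟨hI.reaches_discard hvV, by simp⟩,
      List.forall_mem_nil _⟩
  · have hprivate : v ∈ T → u₁ ∈ T → u₂ ∉ T ∧ w₂ ∉ T := fun hvT hu₁T => by
      obtain ⟨s, hs, hvs, hunique⟩ := hI.exists_private_edge hT hvV hvT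
      obtain rfl | rfl := hv s hs hvs
      · exact absurd (hunique u₁ (by simp) hu₁T) hu₁v
      · exact ⟨fun h => hvu₂ (hunique u₂ (by simp) h).symm,
          fun h => hvw₂ (hunique w₂ (by simp) h).symm⟩
    simp only [List.mem_cons, List.not_mem_nil, or_false, exists_eq_or_imp, exists_eq_left,
      singleton_subset_iff, disjoint_insert_right, disjoint_singleton_right, empty_subset,
      true_and, insert_subset_iff]
    tauto
  · have hdisj : Disjoint ({v, u₁} : Finset α) {u₂, w₂} := by
      simp [hvu₂.symm, hvw₂.symm, Ne.symm hu₁u₂, Ne.symm hu₁w₂]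
    simpa [add_assoc] using weight_branch_degree_two hC h3 h₂ hdisj hu₁v huw₂ (hd v hvV)
      (hd u₁ hu₁V) (hd u₂ hu₂V) (hd w₂ hw₂V)

lemma exists_toFinset_eq_insert_pair {e : List α} (he : e.Nodup) (h3 : e.length = 3)
    (hv : v ∈ e) :
    ∃ u w, (e.filter fun x => !decide (v = x)) = [u, w] ∧ e.toFinset = {v, u, w} := by
  have hlen := length_filter_ne he hv
  obtain ⟨u, w, h⟩ := List.length_eq_two.1
    (show (e.filter fun x => !decide (v = x)).length = 2 by omega)
  exact ⟨u, w, h, by simpa using toFinset_eq_insert_of_filter_ne hv h⟩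

lemma Inst.Valid.exists_links_eq (hI : I.Valid F₀) (h3 : ∀ e ∈ I.E, e.length = 3)
    (hd : degree (family I.E) v = 2) :
    ∃ u₁ w₁ u₂ w₂, ((I.E.filter fun e => decide (v ∈ e)).map
        fun e => e.filter fun x => !decide (v = x)) = [[u₁, w₁], [u₂, w₂]] ∧
      {v, u₁, w₁} ∈ family I.E ∧ {v, u₂, w₂} ∈ family I.E ∧
      ∀ s ∈ family I.E, v ∈ s → s = {v, u₁, w₁} ∨ s = {v, u₂, w₂} := by
  have hlen : (I.E.filter fun e => decide (v ∈ e)).length = 2 := by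
    rw [← List.countP_eq_length_filter, ← degreeT_val, hI.degree_eq, hd]
  obtain ⟨f₁, f₂, hf⟩ := List.length_eq_two.1 hlen
  have hmem : ∀ f, f = f₁ ∨ f = f₂ ↔ f ∈ I.E ∧ v ∈ f := fun f => by
    simpa [eq_comm] using congrArg (f ∈ ·) hf.symm
  obtain ⟨hf₁, hvf₁⟩ := (hmem f₁).1 (Or.inl rfl)
  obtain ⟨hf₂, hvf₂⟩ := (hmem f₂).1 (Or.inr rfl)
  obtain ⟨u₁, w₁, hl₁, hs₁⟩ :=
    exists_toFinset_eq_insert_pair (hI.nodup_edge f₁ hf₁) (h3 f₁ hf₁) hvf₁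
  obtain ⟨u₂, w₂, hl₂, hs₂⟩ :=
    exists_toFinset_eq_insert_pair (hI.nodup_edge f₂ hf₂) (h3 f₂ hf₂) hvf₂
  refine ⟨u₁, w₁, u₂, w₂, by simp [hf, hl₁, hl₂], mem_family.2 ⟨f₁, hf₁, hs₁⟩,
    mem_family.2 ⟨f₂, hf₂, hs₂⟩, fun s hs hvs => ?_⟩
  obtain ⟨f, hfE, rfl⟩ := mem_family.1 hs
  obtain rfl | rfl := (hmem f).2 ⟨hfE, List.mem_toFinset.1 hvs⟩
  exacts [Or.inl hs₁, Or.inr hs₂]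

lemma codegree_eq_degree_of_mem {F : Finset (Finset α)}
    (hv : ∀ s ∈ F, v ∈ s → s = {v, u₁, w₁} ∨ s = {v, u₂, w₂})
    (hu₁ : u₁ ∈ ({v, u₂, w₂} : Finset α)) : codegree F v u₁ = degree F v :=
  codegree_eq_degree_iff.2 fun s hs hvs => by
    obtain rfl | rfl := hv s hs hvs
    exacts [by simp, hu₁]

lemma Inst.Valid.isTwinT_val (hI : I.Valid F₀) (v u : α) :
    (do if ← neT v u then
          let k ← countT (containsBothT v u) I.E
          pure (k == 2)
        else pure false : Timed Bool).val =
      (!decide (v = u) && codegree (family I.E) v u == 2) := by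
  simp only [val_bind, val_ite, neT_val, hI.codegree_eq, val_pure, Bool.if_false_right,
    Bool.decide_eq_true]

lemma Inst.Valid.card_eq_three (hI : I.Valid F₀) (h3 : ∀ e ∈ I.E, e.length = 3) :
    ∀ s ∈ family I.E, #s = 3 := fun s hs => by
  obtain ⟨e, he, rfl⟩ := mem_family.1 hs
  rw [hI.card_eq he, h3 e he]

lemma Inst.Valid.vertices_ne_nil (hI : I.Valid F₀) (h3 : ∀ e ∈ I.E, e.length = 3)
    (hE : I.E ≠ []) : I.V ≠ [] := by
  obtain ⟨e, he⟩ := List.exists_mem_of_ne_nil _ hE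
  obtain ⟨y, hy, -⟩ := hI.exists_mem_vertices he (by rw [h3 e he]; omega)
  exact List.ne_nil_of_mem hy

lemma isGood_branchTriple (hI : I.Valid F₀) (hC : IsClutter (family I.E))
    (hd : ∀ x ∈ I.V, 2 ≤ degree (family I.E) x) (h3 : ∀ e ∈ I.E, e.length = 3)
    (hE : I.E ≠ []) : (branchTriple I).val.IsGood F₀ I := by
  have h3' := hI.card_eq_three h3
  simp only [branchTriple, val_bind]
  split
  · rename_i v d hargmax
    obtain ⟨hv, rfl, hmax⟩ := hI.degree_le_of_argmaxT hargmax
    simp only [val_ite]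
    split_ifs with hdv
    · exact isGoodBranch_degree_three hI hC h3' hdv hmax hv
    have hd2 : ∀ x ∈ I.V, degree (family I.E) x = 2 := fun x hx => by
      have := hd x hx
      have := hmax x
      omega
    simp only [val_bind]
    split
    · rename_i u hfind
      obtain ⟨hu, h⟩ := findT_eq_some hfind
      simp only [hI.isTwinT_val, Bool.and_eq_true, Bool.not_eq_true', decide_eq_false_iff_not,
        beq_iff_eq] at h
      exact isGoodBranch_twins hI hC h3' hv hu (Ne.symm h.1) (hd2 v hv) (hd2 u hu) h.2
    · rename_i hfind
      obtain ⟨u₁, w₁, u₂, w₂, hlinks, h₁, h₂, hlink⟩ := hI.exists_links_eq h3 (hd2 v hv)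
      simp only [val_bind, filterT_val, mapT_val, memT_val, neT_val, hlinks]
      refine isGoodBranch_degree_two hI hC h3' hd2 h₁ h₂ hlink fun hu₁ => ?_
      have hvu₁ : v ≠ u₁ := (ne_of_card_eq_three (h3' _ h₁)).1
      have h := findT_eq_none hfind u₁ (hI.mem_vertices h₁ (by simp))
      rw [hI.isTwinT_val, codegree_eq_degree_of_mem hlink hu₁, hd2 v hv] at h
      simp [hvu₁] at h
  · rename_i hnone
    exact absurd (argmaxT_eq_none hnone) (hI.vertices_ne_nil h3 hE)

end Branchings

section ApplyRule

open Finset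

variable {α : Type} [DecidableEq α] {E₀ : List (List α)} {F₀ : Finset (Finset α)}
  {I : Inst α} {v : α}

lemma Inst.Valid.isClutter_of_findT_eq_none (hI : I.Valid F₀) (h2 : ∀ e ∈ I.E, 2 ≤ e.length)
    (h : (findT (fun f => do
      if ← hasSizeT 3 f then anyT (fun e => ssubsetT e f) I.E else pure false) I.E).val = none) :
    IsClutter (family I.E) := by
  constructor <;> simp only [mem_family, forall_exists_index, and_imp, forall_apply_eq_imp_iff₂]
  · exact fun e he => (h2 e he).trans (hI.card_eq he).ge
  · intro f hf e he hef
    by_contra hne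
    have hss : e.toFinset ⊂ f.toFinset := hef.ssubset_of_ne hne
    have hlt := card_lt_card hss
    rw [hI.card_eq he, hI.card_eq hf] at hlt
    have hlen : f.length = 3 := by
      have := h2 e he
      have := hI.length_le f hf
      omega
    have hnone := findT_eq_none h f hf
    simp only [val_bind, hasSizeT_val, hlen, BEq.rfl, if_true, anyT_val, ssubsetT_val,
      List.any_eq_false, decide_eq_true_eq] at hnone
    exact hnone e he hss

lemma Inst.Valid.hasDegreeT_eq (hI : I.Valid F₀) (k : ℕ) (v : α) :
    (hasDegreeT I.E k v).val = decide (degree (family I.E) v = k) := by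
  rw [hasDegreeT_val, hI.degree_eq, beq_eq_decide]

lemma isGood_findT_branchDegreeOne (hI : I.Valid F₀) (hC : IsClutter (family I.E))
    (hd : degree (family I.E) v = 1) :
    (do match ← findT (memT v) I.E with
      | some e => branchDegreeOne I v e
      | none => pure (.halt []) : Timed (Outcome α)).val.IsGood F₀ I := by
  simp only [val_bind]
  split
  · rename_i e he
    obtain ⟨he, hve⟩ := findT_eq_some he
    exact isGood_branchDegreeOne hI hC hd he (by simpa using hve)
  · rename_i hnone
    refine absurd hd (ne_of_eq_of_ne (degree_eq_zero_iff.2 fun s hs hvs => ?_) zero_ne_one)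
    obtain ⟨e, he, rfl⟩ := mem_family.1 hs
    simpa [List.mem_toFinset.1 hvs] using findT_eq_none hnone e he

lemma isGood_branchPair_or_branchTriple (hI : I.Valid F₀) (hC : IsClutter (family I.E))
    (hd : ∀ x ∈ I.V, 2 ≤ degree (family I.E) x) (h2 : ∀ e ∈ I.E, 2 ≤ e.length)
    (hE : I.E ≠ []) :
    (do if ← anyT (hasSizeT 2) I.E then branchPair I else branchTriple I :
      Timed (Outcome α)).val.IsGood F₀ I := by
  simp only [val_bind, val_ite, anyT_val, hasSizeT_val, List.any_eq_true, beq_iff_eq]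
  split_ifs with hpair
  · obtain ⟨e, he, hlen⟩ := hpair
    refine isGood_branchPair hI hC (fun x hx => ?_) he hlen
    by_cases hxV : x ∈ I.V
    · exact absurd (hd x hxV) (by omega)
    · exact absurd (hI.degree_eq_zero hxV) (by omega)
  · refine isGood_branchTriple hI hC hd (fun e he => ?_) hE
    have := h2 e he
    have := hI.length_le e he
    have hne : e.length ≠ 2 := fun h => hpair ⟨e, he, h⟩
    omega

lemma isGood_findT_degree_one (hI : I.Valid F₀) (hC : IsClutter (family I.E))
    (hd : ∀ x ∈ I.V, degree (family I.E) x ≠ 0) (h2 : ∀ e ∈ I.E, 2 ≤ e.length)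
    (hE : I.E ≠ []) :
    (do match ← findT (hasDegreeT I.E 1) I.V with
      | some v =>
        match ← findT (memT v) I.E with
        | some e => branchDegreeOne I v e
        | none => pure (.halt [])
      | none => if ← anyT (hasSizeT 2) I.E then branchPair I else branchTriple I :
      Timed (Outcome α)).val.IsGood F₀ I := by
  simp only [val_bind]
  split
  · rename_i v hv
    obtain ⟨-, hdv⟩ := findT_eq_some hv
    exact isGood_findT_branchDegreeOne hI hC
      (by simpa only [hI.hasDegreeT_eq, decide_eq_true_eq] using hdv)
  · rename_i hd1
    refine isGood_branchPair_or_branchTriple hI hC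
      (fun x hx => (Nat.two_le_iff _).2 ⟨hd x hx, ?_⟩) h2 hE
    simpa only [hI.hasDegreeT_eq, decide_eq_false_iff_not] using findT_eq_none hd1 x hx

lemma isGood_applyRule (hI : I.Valid (family E₀)) :
    (applyRule E₀ I).val.IsGood (family E₀) I := by
  simp only [applyRule, val_bind, val_ite, anyT_val, hasSizeT_val, List.isEmpty_iff,
    List.any_eq_true, beq_iff_eq]
  split_ifs with h0 hE hmin
  · obtain ⟨e, he, hlen⟩ := h0
    rw [List.length_eq_zero_iff] at hlen
    exact isGood_halt_of_empty_mem hI (mem_family.2 ⟨e, he, by simp [hlen]⟩)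
  · simpa [hmin] using isGood_halt_of_edges_eq_nil hI hE
  · simpa [hmin] using isGood_halt_of_edges_eq_nil hI hE
  split
  · rename_i v hv
    obtain ⟨hv, hdv⟩ := findT_eq_some hv
    exact isGoodBranch_degree_zero hI hv
      (by simpa only [hI.hasDegreeT_eq, decide_eq_true_eq] using hdv)
  rename_i hd0
  simp only [val_bind]
  split
  · rename_i f hf
    obtain ⟨hf, h⟩ := findT_eq_some hf
    obtain ⟨-, e, he, hef⟩ : f.length = 3 ∧ ∃ e ∈ I.E, e.toFinset ⊂ f.toFinset := by
      simpa [val_ite] using h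
    simp only [val_bind, filterT_val, sameSetT_val, val_pure]
    exact isGoodBranch_superset hI (mem_family.2 ⟨e, he, rfl⟩) hf hef
  rename_i hsuper
  simp only [val_bind]
  split
  · rename_i e he
    obtain ⟨he, h⟩ := findT_eq_some he
    obtain ⟨v, rfl⟩ := List.length_eq_one_iff.1 (show e.length = 1 by simpa using h)
    exact isGoodBranch_singleton hI (mem_family.2 ⟨[v], he, rfl⟩)
  rename_i hone
  have h2 : ∀ e ∈ I.E, 2 ≤ e.length := fun e he =>
    (Nat.two_le_iff _).2 ⟨fun h => h0 ⟨e, he, h⟩, by simpa using findT_eq_none hone e he⟩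
  have hC := hI.isClutter_of_findT_eq_none h2 hsuper
  exact isGood_findT_degree_one hI hC (fun x hx => by
    simpa only [hI.hasDegreeT_eq, decide_eq_false_iff_not] using findT_eq_none hd0 x hx) h2 hE

end ApplyRule

/-! ### Running time -/

section Times

variable {β γ : Type}

@[simp] lemma time_pure (b : β) : (pure b : Timed β).time = 0 := rfl
@[simp] lemma time_bind (x : Timed β) (f : β → Timed γ) :
    (x >>= f).time = x.time + (f x.val).time := rfl
@[simp] lemma time_step (x : Timed β) : (step x).time = x.time + 1 := rfl

lemma time_ite_le {c : Prop} [Decidable c] {x y : Timed β} {t : ℕ} (hx : x.time ≤ t)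
    (hy : y.time ≤ t) : (if c then x else y).time ≤ t := by
  split_ifs <;> assumption

lemma time_pure_le {b : β} {t : ℕ} : (pure b : Timed β).time ≤ t := Nat.zero_le _

lemma time_bind_le {x : Timed β} {f : β → Timed γ} {s t : ℕ} (hx : x.time ≤ t)
    (hf : (f x.val).time ≤ s * t) : (x >>= f).time ≤ (s + 1) * t := by
  rw [time_bind, add_one_mul]
  omega

lemma time_le_succ_mul {x : Timed β} {s t : ℕ} (hx : x.time ≤ t) : x.time ≤ (s + 1) * t :=
  hx.trans (Nat.le_mul_of_pos_left _ s.succ_pos)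

lemma le_length_succ_mul {f : List β → ℕ} {l : List β} {t : ℕ} (hnil : f [] ≤ t + 1)
    (hcons : ∀ b l', b :: l' <:+ l → f (b :: l') ≤ f l' + (t + 1)) :
    f l ≤ (l.length + 1) * (t + 1) := by
  induction l with
  | nil => simpa using hnil
  | cons b l ih =>
    have htail := ih fun c l' h => hcons c l' (h.trans (List.suffix_cons b l))
    have hhead := hcons b l (List.suffix_refl _)
    rw [List.length_cons, add_one_mul]
    omega

lemma anyT_time_le {p : β → Timed Bool} {l : List β} {t : ℕ} (h : ∀ b ∈ l, (p b).time ≤ t) :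
    (anyT p l).time ≤ (l.length + 1) * (t + 1) := by
  refine le_length_succ_mul (f := fun l => (anyT p l).time) (by simp [anyT]) fun b l' hl => ?_
  have := h b (hl.subset List.mem_cons_self)
  simp only [anyT, time_step, time_bind, apply_ite Timed.time, time_pure]
  split_ifs <;> omega

lemma allT_time_le {p : β → Timed Bool} {l : List β} {t : ℕ} (h : ∀ b ∈ l, (p b).time ≤ t) :
    (allT p l).time ≤ (l.length + 1) * (t + 1) := by
  refine le_length_succ_mul (f := fun l => (allT p l).time) (by simp [allT]) fun b l' hl => ?_
  have := h b (hl.subset List.mem_cons_self)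
  simp only [allT, time_step, time_bind, apply_ite Timed.time, time_pure]
  split_ifs <;> omega

lemma findT_time_le {p : β → Timed Bool} {l : List β} {t : ℕ} (h : ∀ b ∈ l, (p b).time ≤ t) :
    (findT p l).time ≤ (l.length + 1) * (t + 1) := by
  refine le_length_succ_mul (f := fun l => (findT p l).time) (by simp [findT]) fun b l' hl => ?_
  have := h b (hl.subset List.mem_cons_self)
  simp only [findT, time_step, time_bind, apply_ite Timed.time, time_pure]
  split_ifs <;> omega

lemma filterT_time_le {p : β → Timed Bool} {l : List β} {t : ℕ} (h : ∀ b ∈ l, (p b).time ≤ t) :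
    (filterT p l).time ≤ (l.length + 1) * (t + 1) := by
  refine le_length_succ_mul (f := fun l => (filterT p l).time) (by simp [filterT])
    fun b l' hl => ?_
  have := h b (hl.subset List.mem_cons_self)
  simp only [filterT, time_step, time_bind, time_pure]
  omega

lemma countT_time_le {p : β → Timed Bool} {l : List β} {t : ℕ} (h : ∀ b ∈ l, (p b).time ≤ t) :
    (countT p l).time ≤ (l.length + 1) * (t + 1) := by
  refine le_length_succ_mul (f := fun l => (countT p l).time) (by simp [countT])
    fun b l' hl => ?_
  have := h b (hl.subset List.mem_cons_self)
  simp only [countT, time_step, time_bind, time_pure]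
  omega

lemma mapT_time_le {f : β → Timed γ} {l : List β} {t : ℕ} (h : ∀ b ∈ l, (f b).time ≤ t) :
    (mapT f l).time ≤ (l.length + 1) * (t + 1) := by
  refine le_length_succ_mul (f := fun l => (mapT f l).time) (by simp [mapT]) fun b l' hl => ?_
  have := h b (hl.subset List.mem_cons_self)
  simp only [mapT, time_step, time_bind, time_pure]
  omega

lemma argmaxT_time_le {f : β → Timed ℕ} {l : List β} {t : ℕ} (h : ∀ b ∈ l, (f b).time ≤ t) :
    (argmaxT f l).time ≤ (l.length + 1) * (t + 1) := by
  refine le_length_succ_mul (f := fun l => (argmaxT f l).time) (by simp [argmaxT])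
    fun b l' hl => ?_
  have := h b (hl.subset List.mem_cons_self)
  simp only [argmaxT, time_step, time_bind]
  split <;> simp only [time_pure] <;> omega

lemma lengthT_time (l : List β) : (lengthT l).time = l.length + 1 := by
  induction l with
  | nil => rfl
  | cons b l ih =>
    simp only [lengthT, time_step, time_bind, time_pure, ih, List.length_cons, add_zero]

lemma appendT_time (l m : List β) : (appendT l m).time = l.length + 1 := by
  induction l with
  | nil => rfl
  | cons b l ih =>
    simp only [appendT, time_step, time_bind, time_pure, ih, List.length_cons, add_zero]

lemma flatMapT_time (f : β → Timed (List γ)) (l : List β) :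
    (flatMapT f l).time = (l.map fun b => (f b).time + (f b).val.length + 2).sum + 1 := by
  induction l with
  | nil => rfl
  | cons b l ih =>
    simp only [flatMapT, time_step, time_bind, appendT_time, ih, List.map_cons, List.sum_cons]
    omega

end Times

section PowerBounds

variable {α : Type} [DecidableEq α] {M k m : ℕ} {e f T : List α} {E : List (List α)} {I : Inst α}

lemma loop_le_pow (hM : 16 ≤ M) {n t : ℕ} (hn : n < M) (ht : t ≤ M ^ k)
    (hkm : k + 2 ≤ m := by norm_num) : (n + 1) * (t + 1) ≤ M ^ m := by
  have hpos : 1 ≤ M ^ k := Nat.one_le_pow _ _ (by omega)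
  calc (n + 1) * (t + 1) ≤ M * (2 * M ^ k) := Nat.mul_le_mul hn (by omega)
    _ ≤ M * (M * M ^ k) := by gcongr; omega
    _ = M ^ (k + 2) := by ring
    _ ≤ M ^ m := Nat.pow_le_pow_right (by omega) hkm

/-- No rule runs more than sixteen subroutines in a row, so one factor `M` pays for their number. -/
lemma le_pow_of_le_sixteen_mul (hM : 16 ≤ M) {t : ℕ} (ht : t ≤ 16 * M ^ k)
    (hkm : k + 1 ≤ m := by norm_num) : t ≤ M ^ m :=
  calc t ≤ M * M ^ k := ht.trans (Nat.mul_le_mul_right _ hM)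
    _ = M ^ (k + 1) := by ring
    _ ≤ M ^ m := Nat.pow_le_pow_right (by omega) hkm

lemma hasSizeT_time_le {β : Type} {e : List β} (he : e.length < M) (n : ℕ)
    (hm : 1 ≤ m := by norm_num) : (hasSizeT n e).time ≤ M ^ m := by
  simp only [hasSizeT, time_bind, lengthT_time, time_pure]
  exact he.trans_le (Nat.le_self_pow (by omega) M)

lemma neT_time_le (hM : 16 ≤ M) (x y : α) : (neT x y).time ≤ M ^ k :=
  Nat.one_le_pow _ _ (by omega)

lemma memT_time_le (hM : 16 ≤ M) (he : e.length < M) (x : α) (hm : 2 ≤ m := by norm_num) :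
    (memT x e).time ≤ M ^ m :=
  (anyT_time_le (t := 1) fun _ _ => le_rfl).trans (loop_le_pow (k := 0) hM he le_rfl hm)

lemma filterT_neT_time_le (hM : 16 ≤ M) (he : e.length < M) (x : α) (hm : 2 ≤ m := by norm_num) :
    (filterT (neT x) e).time ≤ M ^ m :=
  (filterT_time_le (t := 1) fun _ _ => le_rfl).trans (loop_le_pow (k := 0) hM he le_rfl hm)

lemma subsetT_time_le (hM : 16 ≤ M) (he : e.length < M) (hf : f.length < M) :
    (subsetT e f).time ≤ M ^ 4 :=
  (allT_time_le fun x _ => memT_time_le (m := 2) hM hf x).trans (loop_le_pow hM he le_rfl)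

lemma sameSetT_time_le (hM : 16 ≤ M) (he : e.length < M) (hf : f.length < M) :
    (sameSetT e f).time ≤ M ^ 5 :=
  le_pow_of_le_sixteen_mul hM <| time_bind_le (subsetT_time_le hM he hf) <|
    time_ite_le (time_le_succ_mul (subsetT_time_le hM hf he)) time_pure_le

lemma ssubsetT_time_le (hM : 16 ≤ M) (he : e.length < M) (hf : f.length < M) :
    (ssubsetT e f).time ≤ M ^ 5 :=
  le_pow_of_le_sixteen_mul hM <| time_bind_le (subsetT_time_le hM he hf) <|
    time_ite_le (time_bind_le (subsetT_time_le hM hf he) time_pure_le) time_pure_le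

lemma dedupT_time_le (hM : 16 ≤ M) (hE : E.length < M) (he : ∀ e ∈ E, e.length < M) :
    (dedupT E).time ≤ M ^ 9 := by
  refine (le_length_succ_mul (f := fun E => (dedupT E).time) (t := M ^ 7) (by simp [dedupT])
    fun e E' hE' => ?_).trans (loop_le_pow hM hE le_rfl)
  have hsub : (dedupT E').val ⊆ E := fun f hf =>
    hE'.subset (List.mem_cons_of_mem _ ((dedupT_sublist E').subset hf))
  have hlen : (dedupT E').val.length < M :=
    (dedupT_sublist E').length_le.trans_lt ((Nat.lt_of_succ_le hE'.length_le).trans hE)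
  have hany : (anyT (sameSetT e) (dedupT E').val).time ≤ M ^ 7 :=
    (anyT_time_le fun f hf => sameSetT_time_le hM (he e (hE'.subset List.mem_cons_self))
      (he f (hsub hf))).trans (loop_le_pow hM hlen le_rfl)
  simp only [dedupT, time_step, time_bind]
  split_ifs <;> simp only [time_pure] <;> omega

lemma degreeT_time_le (hM : 16 ≤ M) (hE : E.length < M) (he : ∀ e ∈ E, e.length < M) (v : α)
    (hm : 4 ≤ m := by norm_num) : (degreeT E v).time ≤ M ^ m :=
  (countT_time_le fun e h => memT_time_le (m := 2) hM (he e h) v).trans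
    (loop_le_pow hM hE le_rfl hm)

lemma isPairAtT_time_le (hM : 16 ≤ M) (he : e.length < M) (v : α) :
    (isPairAtT v e).time ≤ M ^ 3 :=
  le_pow_of_le_sixteen_mul (k := 2) hM <| time_bind_le (hasSizeT_time_le he 2) <|
    time_ite_le (time_le_succ_mul (memT_time_le hM he v)) time_pure_le

lemma degreeTwoT_time_le (hM : 16 ≤ M) (hE : E.length < M) (he : ∀ e ∈ E, e.length < M)
    (v : α) : (degreeTwoT E v).time ≤ M ^ 5 :=
  (countT_time_le fun e h => isPairAtT_time_le hM (he e h) v).trans (loop_le_pow hM hE le_rfl)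

lemma containsBothT_time_le (hM : 16 ≤ M) (he : e.length < M) (v u : α) :
    (containsBothT v u e).time ≤ M ^ 3 :=
  le_pow_of_le_sixteen_mul (k := 2) hM <| time_bind_le (memT_time_le hM he v) <|
    time_ite_le (time_le_succ_mul (memT_time_le hM he u)) time_pure_le

lemma isPairPartnerT_time_le (hM : 16 ≤ M) (hE : E.length < M) (he : ∀ e ∈ E, e.length < M)
    (v u : α) : (isPairPartnerT E v u).time ≤ M ^ 7 := by
  refine le_pow_of_le_sixteen_mul (k := 6) hM (time_bind_le (neT_time_le hM v u)
    (time_ite_le (time_le_succ_mul ?_) time_pure_le))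
  refine (anyT_time_le (t := M ^ 4) fun e h => ?_).trans (loop_le_pow hM hE le_rfl)
  exact le_pow_of_le_sixteen_mul hM <| time_bind_le (isPairAtT_time_le hM (he e h) v) <|
    time_ite_le (time_le_succ_mul (memT_time_le hM (he e h) u)) time_pure_le

lemma hitsAllT_time_le (hM : 16 ≤ M) (hE : E.length < M) (he : ∀ e ∈ E, e.length < M)
    (hT : T.length < M) (hm : 6 ≤ m := by norm_num) : (hitsAllT E T).time ≤ M ^ m :=
  (allT_time_le fun e h => (anyT_time_le fun x _ => memT_time_le (m := 2) hM hT x).trans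
    (loop_le_pow (m := 4) hM (he e h) le_rfl)).trans (loop_le_pow hM hE le_rfl hm)

lemma isMinimalT_time_le (hM : 16 ≤ M) (hE : E.length < M) (he : ∀ e ∈ E, e.length < M)
    (hT : T.length < M) (hm : 10 ≤ m := by norm_num) : (isMinimalT E T).time ≤ M ^ m := by
  refine le_pow_of_le_sixteen_mul (k := 9) hM (time_bind_le (hitsAllT_time_le hM hE he hT)
    (time_ite_le (time_le_succ_mul ?_) time_pure_le)) hm
  refine (allT_time_le (t := M ^ 7) fun v _ => ?_).trans (loop_le_pow hM hT le_rfl)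
  refine le_pow_of_le_sixteen_mul (k := 6) hM (time_bind_le (filterT_neT_time_le hM hT v)
    (time_bind_le (hitsAllT_time_le hM hE he ?_) time_pure_le))
  rw [filterT_val]
  exact (List.length_filter_le _ _).trans_lt hT

/-- All lists of the instance except that of the selected vertices have length less than `M`. -/
structure Inst.Bounded (M : ℕ) (I : Inst α) : Prop where
  vertices : I.V.length < M
  edges : I.E.length < M
  edge : ∀ e ∈ I.E, e.length < M

lemma Inst.Bounded.select (hI : I.Bounded M) (v : α) : (selectT v I).val.Bounded M := by
  rw [selectT_val]
  exact ⟨(List.length_filter_le _ _).trans_lt hI.vertices,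
    (List.length_filter_le _ _).trans_lt hI.edges,
    fun e he => hI.edge e (List.mem_of_mem_filter he)⟩

lemma Inst.Bounded.discard (hI : I.Bounded M) (v : α) : (discardT v I).val.Bounded M := by
  rw [discardT_val]
  have hsub := dedupT_sublist (I.E.map fun e => e.filter fun x => !decide (v = x))
  refine ⟨(List.length_filter_le _ _).trans_lt hI.vertices, ?_, fun e he => ?_⟩
  · exact (hsub.length_le.trans_eq (List.length_map _)).trans_lt hI.edges
  · obtain ⟨f, hf, rfl⟩ := List.mem_map.1 (hsub.subset he)
    exact (List.length_filter_le _ _).trans_lt (hI.edge f hf)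

lemma selectT_time_le (hM : 16 ≤ M) (hI : I.Bounded M) (v : α) (hm : 5 ≤ m := by norm_num) :
    (selectT v I).time ≤ M ^ m := by
  refine le_pow_of_le_sixteen_mul (k := 4) hM (time_bind_le
    (filterT_neT_time_le hM hI.vertices v) (time_bind_le ?_ time_pure_le)) hm
  refine (filterT_time_le (t := M ^ 2) fun e he => ?_).trans (loop_le_pow hM hI.edges le_rfl)
  simpa using memT_time_le hM (hI.edge e he) v

lemma discardT_time_le (hM : 16 ≤ M) (hI : I.Bounded M) (v : α) (hm : 10 ≤ m := by norm_num) :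
    (discardT v I).time ≤ M ^ m := by
  refine le_pow_of_le_sixteen_mul (k := 9) hM (time_bind_le
    (filterT_neT_time_le hM hI.vertices v) (time_bind_le ?_
      (time_bind_le (dedupT_time_le hM ?_ ?_) time_pure_le))) hm
  · exact (mapT_time_le fun e he => filterT_neT_time_le (m := 2) hM (hI.edge e he) v).trans
      (loop_le_pow hM hI.edges le_rfl)
  · rw [mapT_val, List.length_map]
    exact hI.edges
  · rw [mapT_val]
    intro e he
    obtain ⟨f, hf, rfl⟩ := List.mem_map.1 he
    rw [filterT_val]
    exact (List.length_filter_le _ _).trans_lt (hI.edge f hf)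

lemma selectAllT_time_le (hM : 16 ≤ M) (hI : I.Bounded M) {l : List α} (hl : l.length < M)
    (hm : 7 ≤ m := by norm_num) : (selectAllT l I).time ≤ M ^ m := by
  refine le_trans ?_ (loop_le_pow (k := 5) hM hl le_rfl hm)
  clear hl
  induction l generalizing I with
  | nil => simp [selectAllT]
  | cons v l ih =>
    have hhead : (selectT v I).time ≤ M ^ 5 := selectT_time_le hM hI v
    have htail := ih (hI.select v)
    simp only [selectAllT, time_step, time_bind]
    rw [List.length_cons, add_one_mul]
    omega

lemma discardAllT_time_le (hM : 16 ≤ M) (hI : I.Bounded M) {l : List α} (hl : l.length < M) :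
    (discardAllT l I).time ≤ M ^ 12 := by
  refine le_trans ?_ (loop_le_pow (k := 10) hM hl le_rfl)
  clear hl
  induction l generalizing I with
  | nil => simp [discardAllT]
  | cons v l ih =>
    have hhead : (discardT v I).time ≤ M ^ 10 := discardT_time_le hM hI v
    have htail := ih (hI.discard v)
    simp only [discardAllT, time_step, time_bind]
    rw [List.length_cons, add_one_mul]
    omega

end PowerBounds

section RuleTimes

variable {α : Type} [DecidableEq α] {M m : ℕ} {I : Inst α} {e : List α}

lemma branchDegreeOne_time_le (hM : 16 ≤ M) (hI : I.Bounded M) (he : e.length < M) (v : α) :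
    (branchDegreeOne I v e).time ≤ M ^ 13 := by
  have hsel (u : α) : (selectT u I).time ≤ M ^ 12 := selectT_time_le hM hI u
  have hdis {J : Inst α} (hJ : J.Bounded M) (u : α) : (discardT u J).time ≤ M ^ 12 :=
    discardT_time_le hM hJ u
  have hall (u a b : α) : (discardAllT [a, b] (selectT u I).val).time ≤ M ^ 12 :=
    discardAllT_time_le hM (hI.select u) (by simp only [List.length_cons, List.length_nil]; omega)
  have hdeg (u : α) : (degreeT I.E u).time ≤ M ^ 12 := degreeT_time_le hM hI.edges hI.edge u
  refine le_pow_of_le_sixteen_mul (k := 12) hM (time_bind_le (filterT_neT_time_le hM he v) ?_)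
  split
  · exact time_bind_le (hsel _) <| time_bind_le (hdis (hI.select _) _) <|
      time_bind_le (hdis hI _) time_pure_le
  · refine time_bind_le (hdeg _) (time_bind_le (hdeg _) (time_ite_le ?_ ?_))
    · exact time_bind_le (hsel _) <| time_bind_le (hall _ _ _) <| time_bind_le (hsel _) <|
        time_bind_le (hall _ _ _) <| time_bind_le (hsel _) <| time_bind_le (hall _ _ _)
          time_pure_le
    · exact time_bind_le (hsel _) <| time_bind_le (hall _ _ _) <| time_bind_le (hdis hI _)
        time_pure_le
  · exact time_pure_le

lemma branchPair_time_le (hM : 16 ≤ M) (hI : I.Bounded M) (hm : 11 ≤ m := by norm_num) :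
    (branchPair I).time ≤ M ^ m := by
  have hlen (p : α → Timed Bool) : (filterT p I.V).val.length < M := by
    rw [filterT_val]
    exact (List.length_filter_le _ _).trans_lt hI.vertices
  have htwo (x : α) : (degreeTwoT I.E x).time ≤ M ^ 5 := degreeTwoT_time_le hM hI.edges hI.edge x
  refine le_pow_of_le_sixteen_mul (k := 10) hM (time_bind_le ((argmaxT_time_le fun x _ =>
    htwo x).trans (loop_le_pow hM hI.vertices le_rfl)) ?_) hm
  split
  · refine time_bind_le ((filterT_time_le (t := M ^ 5) fun x _ => by simpa using htwo x).trans
      (loop_le_pow hM hI.vertices le_rfl)) ?_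
    refine time_bind_le ((argmaxT_time_le fun x _ =>
      degreeT_time_le (m := 4) hM hI.edges hI.edge x).trans (loop_le_pow hM (hlen _) le_rfl)) ?_
    split
    · refine time_bind_le ((filterT_time_le fun x _ =>
        isPairPartnerT_time_le hM hI.edges hI.edge _ x).trans
        (loop_le_pow hM hI.vertices le_rfl)) ?_
      exact time_bind_le (selectT_time_le hM hI _) <| time_bind_le (discardT_time_le hM hI _) <|
        time_bind_le (selectAllT_time_le hM (hI.discard _) (hlen _)) time_pure_le
    · exact time_pure_le
  · exact time_pure_le

lemma findT_containsBothT_time_le (hM : 16 ≤ M) (hI : I.Bounded M) (v : α) :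
    (findT (fun u => do
      if ← neT v u then
        let k ← countT (containsBothT v u) I.E
        pure (k == 2)
      else pure false) I.V).time ≤ M ^ 8 := by
  refine (findT_time_le (t := M ^ 6) fun u _ => ?_).trans (loop_le_pow hM hI.vertices le_rfl)
  refine le_pow_of_le_sixteen_mul (k := 5) hM (time_bind_le (neT_time_le hM v u)
    (time_ite_le (time_bind_le ?_ time_pure_le) time_pure_le))
  exact (countT_time_le fun e he => containsBothT_time_le hM (hI.edge e he) v u).trans
    (loop_le_pow hM hI.edges le_rfl)

lemma mapT_filterT_memT_time_le (hM : 16 ≤ M) (hI : I.Bounded M) (v : α) :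
    (mapT (filterT (neT v)) (filterT (memT v) I.E).val).time ≤ M ^ 4 := by
  rw [filterT_val]
  exact (mapT_time_le fun e he =>
    filterT_neT_time_le (m := 2) hM (hI.edge e (List.mem_of_mem_filter he)) v).trans
    (loop_le_pow hM ((List.length_filter_le _ _).trans_lt hI.edges) le_rfl)

lemma branchTriple_time_le (hM : 16 ≤ M) (hI : I.Bounded M) :
    (branchTriple I).time ≤ M ^ 13 := by
  have hsel {J : Inst α} (hJ : J.Bounded M) (u : α) : (selectT u J).time ≤ M ^ 12 :=
    selectT_time_le hM hJ u
  have hdis {J : Inst α} (hJ : J.Bounded M) (u : α) : (discardT u J).time ≤ M ^ 12 :=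
    discardT_time_le hM hJ u
  refine le_pow_of_le_sixteen_mul (k := 12) hM (time_bind_le ((argmaxT_time_le fun x _ =>
    degreeT_time_le (m := 4) hM hI.edges hI.edge x).trans (loop_le_pow hM hI.vertices le_rfl)) ?_)
  split
  · refine time_ite_le ?_ ?_
    · exact time_bind_le (hsel hI _) (time_bind_le (hdis hI _) time_pure_le)
    · refine time_bind_le ((findT_containsBothT_time_le hM hI _).trans
        (Nat.pow_le_pow_right (by omega) (by norm_num))) ?_
      split
      · exact time_bind_le (hsel hI _) <| time_bind_le (hdis (hI.select _) _) <|
          time_bind_le (hdis hI _) time_pure_le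
      · refine time_bind_le ((filterT_time_le fun e he =>
          memT_time_le (m := 2) hM (hI.edge e he) _).trans (loop_le_pow hM hI.edges le_rfl)) ?_
        refine time_bind_le ((mapT_filterT_memT_time_le hM hI _).trans
          (Nat.pow_le_pow_right (by omega) (by norm_num))) ?_
        split
        · exact time_bind_le (hsel hI _) <| time_bind_le (hsel (hI.select _) _) <|
            time_bind_le (discardAllT_time_le hM ((hI.select _).select _)
              (by simp only [List.length_cons, List.length_nil]; omega)) <|
            time_bind_le (hdis (hI.select _) _) <| time_bind_le (hdis hI _) time_pure_le
        · exact time_pure_le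
  · exact time_pure_le

lemma findT_hasSizeT_time_le {β : Type} {E : List (List β)} (hM : 16 ≤ M) (hE : E.length < M)
    (he : ∀ e ∈ E, e.length < M) (n : ℕ) (hm : 3 ≤ m := by norm_num) :
    (findT (hasSizeT n) E).time ≤ M ^ m :=
  (findT_time_le fun e h => hasSizeT_time_le (m := 1) (he e h) n).trans
    (loop_le_pow hM hE le_rfl hm)

lemma anyT_hasSizeT_time_le {β : Type} {E : List (List β)} (hM : 16 ≤ M) (hE : E.length < M)
    (he : ∀ e ∈ E, e.length < M) (n : ℕ) (hm : 3 ≤ m := by norm_num) :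
    (anyT (hasSizeT n) E).time ≤ M ^ m :=
  (anyT_time_le fun e h => hasSizeT_time_le (m := 1) (he e h) n).trans
    (loop_le_pow hM hE le_rfl hm)

lemma findT_hasDegreeT_time_le (hM : 16 ≤ M) (hI : I.Bounded M) (n : ℕ)
    (hm : 6 ≤ m := by norm_num) : (findT (hasDegreeT I.E n) I.V).time ≤ M ^ m :=
  (findT_time_le (t := M ^ 4) fun v _ => degreeT_time_le hM hI.edges hI.edge v).trans
    (loop_le_pow hM hI.vertices le_rfl hm)

lemma findT_ssubsetT_time_le (hM : 16 ≤ M) (hI : I.Bounded M) (hm : 10 ≤ m := by norm_num) :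
    (findT (fun f => do
      if ← hasSizeT 3 f then anyT (fun e => ssubsetT e f) I.E else pure false) I.E).time ≤
      M ^ m := by
  refine (findT_time_le (t := M ^ 8) fun f hf => ?_).trans (loop_le_pow hM hI.edges le_rfl hm)
  refine le_pow_of_le_sixteen_mul (k := 7) hM (time_bind_le
    (hasSizeT_time_le (hI.edge f hf) 3) (time_ite_le (time_le_succ_mul ?_) time_pure_le))
  exact (anyT_time_le fun e he => ssubsetT_time_le hM (hI.edge e he) (hI.edge f hf)).trans
    (loop_le_pow hM hI.edges le_rfl)

lemma filterT_sameSetT_time_le (hM : 16 ≤ M) (hI : I.Bounded M) (he : e.length < M)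
    (hm : 7 ≤ m := by norm_num) :
    (filterT (fun f => do
      let b ← sameSetT f e
      pure (!b)) I.E).time ≤ M ^ m :=
  (filterT_time_le (t := M ^ 5) fun f hf => by
    simpa using sameSetT_time_le hM (hI.edge f hf) he).trans (loop_le_pow hM hI.edges le_rfl hm)

lemma findT_memT_time_le (hM : 16 ≤ M) (hI : I.Bounded M) (v : α) (hm : 4 ≤ m := by norm_num) :
    (findT (memT v) I.E).time ≤ M ^ m :=
  (findT_time_le fun e he => memT_time_le (m := 2) hM (hI.edge e he) v).trans
    (loop_le_pow hM hI.edges le_rfl hm)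

lemma applyRule_time_le (hM : 16 ≤ M) {E₀ : List (List α)} (hE : E₀.length < M)
    (he : ∀ e ∈ E₀, e.length < M) (hI : I.Bounded M) (hS : I.S.length < M) :
    (applyRule E₀ I).time ≤ M ^ 14 := by
  refine le_pow_of_le_sixteen_mul (k := 13) hM (time_bind_le
    (anyT_hasSizeT_time_le hM hI.edges hI.edge 0)
    (time_ite_le time_pure_le (time_ite_le ?_ ?_)))
  · exact time_bind_le (isMinimalT_time_le hM hE he hS) (time_ite_le time_pure_le time_pure_le)
  refine time_bind_le (findT_hasDegreeT_time_le hM hI 0) ?_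
  split
  · exact time_bind_le (discardT_time_le hM hI _) time_pure_le
  refine time_bind_le (findT_ssubsetT_time_le hM hI) ?_
  split
  · rename_i f hf
    exact time_bind_le (filterT_sameSetT_time_le hM hI (hI.edge f (findT_eq_some hf).1))
      time_pure_le
  refine time_bind_le (findT_hasSizeT_time_le hM hI.edges hI.edge 1) ?_
  split
  · rename_i e he
    exact time_bind_le (selectAllT_time_le hM hI (hI.edge e (findT_eq_some he).1)) time_pure_le
  refine time_bind_le (findT_hasDegreeT_time_le hM hI 1) ?_
  split
  · refine time_bind_le (findT_memT_time_le hM hI _) ?_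
    split
    · rename_i e he
      exact time_le_succ_mul (branchDegreeOne_time_le hM hI (hI.edge e (findT_eq_some he).1) _)
    · exact time_pure_le
  refine time_bind_le (anyT_hasSizeT_time_le hM hI.edges hI.edge 2) (time_ite_le ?_ ?_)
  · exact time_le_succ_mul (branchPair_time_le hM hI)
  · exact time_le_succ_mul (branchTriple_time_le hM hI)

end RuleTimes

/-! ### The search tree -/

section Search

open Finset

variable {α : Type} [DecidableEq α] {E₀ : List (List α)} {F₀ : Finset (Finset α)} {I J : Inst α}
  {out : List (List α)} {Js : List (Inst α)} {M depth : ℕ}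

/-- The lists in `out` are exactly the solutions of the instance `I`, without repetitions. -/
structure IsSolutionList (F₀ : Finset (Finset α)) (I : Inst α) (out : List (List α)) : Prop where
  nodup : ∀ l ∈ out, l.Nodup
  nodup_map : (out.map List.toFinset).Nodup
  mem_iff : ∀ T, T ∈ out.map List.toFinset ↔ I.IsSolution F₀ T

lemma isSolutionList_of_isGood_halt (h : (Outcome.halt out).IsGood F₀ I) :
    IsSolutionList F₀ I out := by
  obtain ⟨hlength, hnodup, hmem⟩ := h
  refine ⟨hnodup, ?_, hmem⟩
  obtain rfl | ⟨l, rfl⟩ := (Nat.le_one_iff_eq_zero_or_eq_one.1 hlength).imp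
    List.length_eq_zero_iff.1 List.length_eq_one_iff.1
  exacts [List.nodup_nil, List.nodup_singleton _]

lemma IsGoodBranch.isSolutionList_flatMap (h : IsGoodBranch F₀ I Js)
    {f : Inst α → List (List α)} (hf : ∀ J ∈ Js, IsSolutionList F₀ J (f J)) :
    IsSolutionList F₀ I (Js.flatMap f) where
  nodup := List.forall_mem_flatMap.2 fun J hJ => (hf J hJ).nodup
  nodup_map := by
    rw [List.map_flatMap, List.nodup_flatMap]
    exact ⟨fun J hJ => (hf J hJ).nodup_map, h.disjoint.imp_of_mem fun hJ hJ' hdisj T hT hT' =>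
      hdisj T (((hf _ hJ).mem_iff T).1 hT) (((hf _ hJ').mem_iff T).1 hT')⟩
  mem_iff T := by
    rw [List.map_flatMap, List.mem_flatMap, h.solution]
    exact exists_congr fun J => and_congr_right fun hJ => (hf J hJ).mem_iff T

lemma search_succ_of_halt (h : (applyRule E₀ I).val = .halt out) :
    search E₀ (depth + 1) I = ⟨out, (applyRule E₀ I).time + 1⟩ := by
  have hval : (search E₀ (depth + 1) I).val = out := by
    simp only [search, val_step, val_bind, h, val_pure]
  have htime : (search E₀ (depth + 1) I).time = (applyRule E₀ I).time + 1 := by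
    simp only [search, time_step, time_bind, h, time_pure, add_zero]
  rw [← hval, ← htime]

lemma search_succ_val_of_branch (h : (applyRule E₀ I).val = .branch Js) :
    (search E₀ (depth + 1) I).val = Js.flatMap fun J => (search E₀ depth J).val := by
  simp only [search, val_step, val_bind, h, flatMapT_val]

lemma search_succ_time_of_branch (h : (applyRule E₀ I).val = .branch Js) :
    (search E₀ (depth + 1) I).time = (applyRule E₀ I).time +
      (Js.map fun J => (search E₀ depth J).time + (search E₀ depth J).val.length + 2).sum + 2 := by
  simp only [search, time_step, time_bind, h, flatMapT_time]
  omega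

lemma isSolutionList_search (hI : I.Valid (family E₀))
    (hdepth : I.V.length + I.E.length < depth) :
    IsSolutionList (family E₀) I (search E₀ depth I).val := by
  induction depth generalizing I with
  | zero => omega
  | succ depth ih =>
    have hgood := isGood_applyRule hI
    rcases h : (applyRule E₀ I).val with out | Js <;> rw [h] at hgood
    · rw [search_succ_of_halt h]
      exact isSolutionList_of_isGood_halt hgood
    · rw [search_succ_val_of_branch h]
      have hbranch : IsGoodBranch (family E₀) I Js := hgood
      exact hbranch.isSolutionList_flatMap fun J hJ => ih (hbranch.valid J hJ)
        ((hbranch.size_lt J hJ).trans_le (Nat.lt_succ_iff.1 hdepth))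

lemma IsGoodBranch.cast_sum_le (h : IsGoodBranch F₀ I Js) {f : Inst α → ℕ} {c : ℚ} (hc : 0 ≤ c)
    (hf : ∀ J ∈ Js, (f J : ℚ) ≤ c * weight (family J.E)) :
    ((Js.map f).sum : ℚ) ≤ c * weight (family I.E) :=
  calc ((Js.map f).sum : ℚ) = (Js.map fun J => (f J : ℚ)).sum := by
        rw [Nat.cast_list_sum, List.map_map, Function.comp_def]
    _ ≤ (Js.map fun J => c * weight (family J.E)).sum := List.sum_le_sum hf
    _ = c * (Js.map fun J => weight (family J.E)).sum := List.sum_map_mul_left ..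
    _ ≤ c * weight (family I.E) := mul_le_mul_of_nonneg_left h.sum_weight_le hc

lemma length_search_le (hI : I.Valid (family E₀)) (depth : ℕ) :
    ((search E₀ depth I).val.length : ℚ) ≤ weight (family I.E) := by
  induction depth generalizing I with
  | zero => simpa [search] using weight_nonneg _
  | succ depth ih =>
    have hgood := isGood_applyRule hI
    rcases h : (applyRule E₀ I).val with out | Js <;> rw [h] at hgood
    · rw [search_succ_of_halt h]
      exact le_trans (by exact_mod_cast hgood.1) (one_le_weight _)
    · rw [search_succ_val_of_branch h, List.length_flatMap]
      have hbranch : IsGoodBranch (family E₀) I Js := hgood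
      simpa only [one_mul] using hbranch.cast_sum_le zero_le_one fun J hJ =>
        (ih (hbranch.valid J hJ)).trans_eq (one_mul _).symm

lemma IsGoodBranch.bounded (h : IsGoodBranch F₀ I Js) (hM : 3 < M) (hI : I.Bounded M)
    (hJ : J ∈ Js) : J.Bounded M where
  vertices := (h.vertices_le J hJ).trans_lt hI.vertices
  edges := (h.edges_le J hJ).trans_lt hI.edges
  edge e he := ((h.valid J hJ).length_le e he).trans_lt hM

-- A node spends at most `M ^ 14` steps on its rule and a constant number of steps per output of
-- each child; as the weights of the children add up to at most the weight of their parent, each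
-- level of the tree costs at most `(M ^ 14 + 9) * weight`.
lemma time_search_le (hM : 16 ≤ M) (hE : E₀.length < M) (he : ∀ e ∈ E₀, e.length < M)
    (hI : I.Valid (family E₀)) (hb : I.Bounded M) (hS : I.S.length + I.V.length < M)
    (depth : ℕ) :
    ((search E₀ depth I).time : ℚ) ≤ (depth * (M ^ 14 + 9) + 1) * weight (family I.E) := by
  induction depth generalizing I with
  | zero => simpa [search] using one_le_weight _
  | succ depth ih =>
    have hgood := isGood_applyRule hI
    have hrule : ((applyRule E₀ I).time : ℚ) ≤ M ^ 14 := by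
      exact_mod_cast applyRule_time_le hM hE he hb (by omega)
    have hw := one_le_weight (family I.E)
    have hd : (0 : ℚ) ≤ depth * (M ^ 14 + 9) := by positivity
    have hchild : (0 : ℚ) ≤ depth * (M ^ 14 + 9) * weight (family I.E) :=
      mul_nonneg hd (weight_nonneg _)
    have hM14 : (M ^ 14 : ℚ) ≤ M ^ 14 * weight (family I.E) :=
      le_mul_of_one_le_right (by positivity) hw
    rcases h : (applyRule E₀ I).val with out | Js <;> rw [h] at hgood
    · rw [search_succ_of_halt h]
      push_cast
      linarith
    · have hbranch : IsGoodBranch (family E₀) I Js := hgood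
      have htime := hbranch.cast_sum_le (f := fun J => (search E₀ depth J).time)
        (by positivity) fun J hJ => ih (hbranch.valid J hJ) (hbranch.bounded (by omega) hb hJ)
          ((hbranch.selected_le J hJ).trans_lt hS)
      have hlength := hbranch.cast_sum_le (f := fun J => (search E₀ depth J).val.length)
        zero_le_one fun J hJ =>
          (length_search_le (hbranch.valid J hJ) depth).trans_eq (one_mul _).symm
      have hJs : (Js.length : ℚ) ≤ 3 := by exact_mod_cast hbranch.length_le
      rw [search_succ_time_of_branch h, List.sum_map_add, List.sum_map_add, List.map_const',
        List.sum_replicate, smul_eq_mul]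
      simp only [Nat.cast_add, Nat.cast_mul, Nat.cast_one, Nat.cast_ofNat]
      linarith

end Search

/-! ### Hypergraphs given by lists -/

section Hypergraphs

open Finset

lemma minimal_and_iff_of_antitone {β : Type} [Preorder β] {P Q : β → Prop} {x : β}
    (hQ : ∀ ⦃x y⦄, x ≤ y → Q y → Q x) :
    Minimal (fun x => Q x ∧ P x) x ↔ Q x ∧ Minimal P x :=
  ⟨fun h => ⟨h.prop.1, h.prop.2, fun _ hy hyx => h.le_of_le ⟨hQ hyx h.prop.1, hy⟩ hyx⟩,
    fun h => ⟨⟨h.1, h.2.prop⟩, fun _ hy hyx => h.2.le_of_le hy.2 hyx⟩⟩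

lemma minimal_coe_iff {β : Type} {P : Set β → Prop} {T : Finset β} :
    Minimal P (T : Set β) ↔ Minimal (fun U : Finset β => P U) T := by
  refine ⟨fun h => ⟨h.prop, fun U hU hUT => ?_⟩, fun h => ⟨h.prop, fun U hU hUT => ?_⟩⟩
  · exact coe_subset.1 (h.le_of_le hU (coe_subset.2 hUT))
  · obtain ⟨U, rfl⟩ := (T.finite_toSet.subset hUT).exists_finset_coe
    exact coe_subset.2 (h.le_of_le hU (coe_subset.1 hUT))

lemma encard_le_of_rank_le {β : Type} {H : Hypergraph β} {k : ℕ∞} (hr : H.rank ≤ k) {e : Set β}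
    (he : e ∈ H.edgeSet) : e.encard ≤ k :=
  (le_iSup₂ (f := fun (e : Set β) (_ : e ∈ H.edgeSet) => e.encard) e he).trans hr

variable {α : Type} {H : Hypergraph α} {V : List α} {E : List (List α)}

lemma mem_vertices_of_mem_edge (h : H.IsListedBy V E) {e : List α} (he : e ∈ E) {x : α}
    (hx : x ∈ e) : x ∈ V :=
  (h.mem_vertices x).2 (H.subset_vertexSet_of_mem_edgeSet ((h.mem_edges _).2 ⟨e, he, rfl⟩) hx)

lemma ncard_vertexSet (h : H.IsListedBy V E) : H.vertexSet.ncard = V.length := by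
  classical
  have hV : H.vertexSet = (V.toFinset : Set α) := by
    ext x
    simp [← h.mem_vertices]
  rw [hV, Set.ncard_coe_finset, List.toFinset_card_of_nodup h.nodup_vertices]

lemma length_le_of_rank_le (h : H.IsListedBy V E) {k : ℕ} (hr : H.rank ≤ k) {e : List α}
    (he : e ∈ E) : e.length ≤ k := by
  classical
  have hcard := encard_le_of_rank_le hr ((h.mem_edges _).2 ⟨e, he, rfl⟩)
  rw [← List.coe_toFinset, Set.encard_coe_eq_coe_finsetCard,
    List.toFinset_card_of_nodup (h.nodup_edge e he)] at hcard
  exact_mod_cast hcard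

variable [DecidableEq α]

lemma isMinimalHittingSet_iff_minimal {F : Finset (Finset α)} {T : Finset α} :
    IsMinimalHittingSet F T ↔ Minimal (fun T => ∀ s ∈ F, (s ∩ T).Nonempty) T := by
  rw [minimal_iff_forall_erase fun T U hU hUT s hs =>
    (hU s hs).mono (inter_subset_inter_left hUT), IsMinimalHittingSet]
  refine and_congr_right fun hT => forall₂_congr fun x _ => ?_
  rw [← exists_not_nonempty_inter_erase_iff hT x]
  push Not
  rfl

lemma isTransversal_coe_iff (h : H.IsListedBy V E) (T : Finset α) :
    H.IsTransversal (T : Set α) ↔ T ⊆ V.toFinset ∧ ∀ s ∈ family E, (s ∩ T).Nonempty := by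
  refine and_congr ?_ ?_
  · simp only [Set.subset_def, ← h.mem_vertices, mem_coe, subset_iff, List.mem_toFinset]
  · simp only [h.mem_edges, mem_family, forall_exists_index, and_imp, forall_apply_eq_imp_iff₂,
      ← List.coe_toFinset, ← coe_inter, coe_nonempty]

lemma isMinimalTransversal_coe_iff (h : H.IsListedBy V E) (T : Finset α) :
    H.IsMinimalTransversal (T : Set α) ↔ T ⊆ V.toFinset ∧ IsMinimalHittingSet (family E) T := by
  rw [Hypergraph.IsMinimalTransversal, minimal_coe_iff, isMinimalHittingSet_iff_minimal]
  simp only [isTransversal_coe_iff h]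
  exact minimal_and_iff_of_antitone fun _ _ => Finset.Subset.trans

lemma valid_of_isListedBy (h : H.IsListedBy V E) (hr : H.rank ≤ 3) :
    (⟨V, E, []⟩ : Inst α).Valid (family E) where
  nodup_vertices := h.nodup_vertices
  nodup_selected := List.nodup_nil
  notMem_selected _ _ := List.not_mem_nil
  nodup_edge := h.nodup_edge
  subset_vertices _ he _ hx := mem_vertices_of_mem_edge h he hx
  length_le _ he := length_le_of_rank_le h (k := 3) hr he
  nodup_edges := by
    refine List.Nodup.of_map (fun s : Finset α => (s : Set α)) ?_
    simpa only [List.map_map, Function.comp_def, List.coe_toFinset] using h.nodup_edges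
  exists_original s hs := ⟨s, hs, fun _ hx _ => hx⟩
  exists_remaining s hs := Or.inr ⟨s, hs, Finset.Subset.refl _⟩

lemma isSolutionList_enumerate (h : H.IsListedBy V E) (hr : H.rank ≤ 3) :
    IsSolutionList (family E) ⟨V, E, []⟩ (enumerate V E).val :=
  isSolutionList_search (valid_of_isListedBy h hr) (Nat.lt_succ_self _)

lemma nodup_map_setOf_enumerate (h : H.IsListedBy V E) (hr : H.rank ≤ 3) :
    ((enumerate V E).val.map fun l => {x | x ∈ l}).Nodup := by
  simpa only [List.map_map, Function.comp_def, List.coe_toFinset] using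
    (isSolutionList_enumerate h hr).nodup_map.map (coe_injective (α := α))

lemma isMinimalTransversal_iff_exists_mem_enumerate (h : H.IsListedBy V E) (hr : H.rank ≤ 3)
    (T : Set α) :
    H.IsMinimalTransversal T ↔ ∃ l ∈ (enumerate V E).val, {x | x ∈ l} = T := by
  have hcoe (T : Finset α) : H.IsMinimalTransversal (T : Set α) ↔
      ∃ l ∈ (enumerate V E).val, {x | x ∈ l} = (T : Set α) := by
    simp only [← List.coe_toFinset, coe_inj]
    rw [← List.mem_map, (isSolutionList_enumerate h hr).mem_iff, isMinimalTransversal_coe_iff h,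
      Inst.IsSolution, and_comm]
    simp
  refine ⟨fun hT => ?_, ?_⟩
  · have hfinite : T.Finite := V.toFinset.finite_toSet.subset fun x hx => by
      simpa [h.mem_vertices] using hT.prop.1 hx
    obtain ⟨T, rfl⟩ := hfinite.exists_finset_coe
    exact (hcoe T).1 hT
  · rintro ⟨l, hl, rfl⟩
    rw [← List.coe_toFinset, hcoe]
    exact ⟨l, hl, (List.coe_toFinset l).symm⟩

lemma finite_setOf_isMinimalTransversal (h : H.IsListedBy V E) (hr : H.rank ≤ 3) :
    {T | H.IsMinimalTransversal T}.Finite ∧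
      {T | H.IsMinimalTransversal T}.ncard ≤ (enumerate V E).val.length := by
  classical
  have heq : {T | H.IsMinimalTransversal T} =
      (((enumerate V E).val.map fun l => {x | x ∈ l}).toFinset : Set (Set α)) := by
    ext T
    simp [isMinimalTransversal_iff_exists_mem_enumerate h hr]
  rw [heq, Set.ncard_coe_finset]
  exact ⟨finite_toSet _, (List.toFinset_card_le _).trans_eq (List.length_map _)⟩

lemma Inst.Valid.length_edges_le {F₀ : Finset (Finset α)} {I : Inst α} (hI : I.Valid F₀) :
    I.E.length ≤ (I.V.length + 1) ^ 3 := by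
  have hU : #I.V.toFinset = I.V.length := List.toFinset_card_of_nodup hI.nodup_vertices
  calc I.E.length = #(family I.E) := by
        rw [family, List.toFinset_card_of_nodup hI.nodup_edges, List.length_map]
    _ ≤ #((range 4).biUnion fun k => powersetCard k I.V.toFinset) := by
        refine card_le_card fun s hs => mem_biUnion.2 ⟨#s, ?_, mem_powersetCard.2 ⟨?_, rfl⟩⟩
        · exact mem_range.2 (Nat.lt_succ_of_le (hI.card_le s hs))
        · exact fun x hx => List.mem_toFinset.2 (hI.mem_vertices hs hx)
    _ ≤ ∑ k ∈ range 4, I.V.length ^ k := card_biUnion_le.trans <| sum_le_sum fun k _ => by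
        rw [card_powersetCard, hU]
        exact Nat.choose_le_pow _ k
    _ ≤ (I.V.length + 1) ^ 3 := by
        simp only [sum_range_succ, sum_range_zero]
        ring_nf
        omega

lemma weight_family_le (h : H.IsListedBy V E) :
    weight (family E) ≤ 3 / 2 * (67 / 40) ^ V.length := by
  rw [← List.toFinset_card_of_nodup h.nodup_vertices]
  refine weight_le (biUnion_subset.2 fun s hs x hx => ?_)
  obtain ⟨e, he, rfl⟩ := mem_family.1 hs
  exact List.mem_toFinset.2 (mem_vertices_of_mem_edge h he (List.mem_toFinset.1 hx))

lemma length_enumerate_le (h : H.IsListedBy V E) (hr : H.rank ≤ 3) :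
    ((enumerate V E).val.length : ℝ) ≤ 3 / 2 * (67 / 40) ^ V.length := by
  have hle := (length_search_le (valid_of_isListedBy h hr) (V.length + E.length + 1)).trans
    (weight_family_le h)
  have hcast := (Rat.cast_le (K := ℝ)).2 hle
  push_cast at hcast
  exact hcast

lemma time_enumerate_le_weight (h : H.IsListedBy V E) (hr : H.rank ≤ 3) :
    ((enumerate V E).time : ℚ) ≤ 2 * ((V.length : ℚ) + 3) ^ 45 * weight (family E) := by
  have hI := valid_of_isListedBy h hr
  have hEV : E.length ≤ (V.length + 1) ^ 3 := hI.length_edges_le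
  set n := V.length
  obtain ⟨M, hM⟩ : ∃ M, M = (n + 3) ^ 3 := ⟨_, rfl⟩
  have hnM : (n + 1) ^ 3 + n + 17 < M := by
    rw [hM]
    ring_nf
    omega
  have he : ∀ e ∈ E, e.length < M := fun e he =>
    (hI.length_le e he).trans_lt (by omega)
  refine (time_search_le (M := M) (by omega) (by omega) he hI
    ⟨by simp only; omega, by simp only; omega, he⟩ (by simp only [List.length_nil]; omega)
    (V.length + E.length + 1)).trans (mul_le_mul_of_nonneg_right ?_ (weight_nonneg _))
  have hdepth : ((n + E.length + 1 : ℕ) : ℚ) ≤ M := by exact_mod_cast (by omega)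
  have hM17 : (17 : ℚ) ≤ M := by exact_mod_cast (by omega)
  have hpow : (9 * M + 1 : ℚ) ≤ M ^ 15 := by
    calc (9 * M + 1 : ℚ) ≤ M ^ 2 := by nlinarith
      _ ≤ M ^ 15 := pow_le_pow_right₀ (by linarith) (by norm_num)
  calc _ ≤ (M : ℚ) * (M ^ 14 + 9) + 1 := by gcongr
    _ = M ^ 15 + (9 * M + 1) := by ring
    _ ≤ 2 * (M : ℚ) ^ 15 := by linarith
    _ = 2 * ((n : ℚ) + 3) ^ 45 := by
        rw [hM]
        push_cast
        ring

lemma time_enumerate_le (h : H.IsListedBy V E) (hr : H.rank ≤ 3) :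
    ((enumerate V E).time : ℝ) ≤ 3 * (((V.length : ℝ) + 3) ^ 45 * (67 / 40) ^ V.length) := by
  have hle : ((enumerate V E).time : ℚ) ≤
      3 * (((V.length : ℚ) + 3) ^ 45 * (67 / 40) ^ V.length) :=
    calc _ ≤ 2 * ((V.length : ℚ) + 3) ^ 45 * weight (family E) := time_enumerate_le_weight h hr
      _ ≤ 2 * ((V.length : ℚ) + 3) ^ 45 * (3 / 2 * (67 / 40) ^ V.length) := by
          gcongr
          exact weight_family_le h
      _ = _ := by ring
  have hcast := (Rat.cast_le (K := ℝ)).2 hle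
  push_cast at hcast
  exact hcast

lemma exists_add_pow_mul_pow_le (k a : ℕ) {r s : ℝ} (hr : 0 < r) (hrs : r < s) :
    ∃ C : ℝ, 0 < C ∧ ∀ n : ℕ, ((n : ℝ) + a) ^ k * r ^ n ≤ C * s ^ n := by
  have hs : 0 < s := hr.trans hrs
  obtain ⟨q, hrq⟩ : ∃ q, r = q * s := ⟨r / s, (div_mul_cancel₀ r hs.ne').symm⟩
  have hq0 : 0 < q := pos_of_mul_pos_left (hrq ▸ hr) hs.le
  have hq1 : q < 1 := lt_of_mul_lt_mul_right (by rwa [one_mul, ← hrq]) hs.le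
  obtain ⟨B, hB⟩ := (tendsto_pow_const_mul_const_pow_of_abs_lt_one k (r := q)
    (by rwa [abs_of_pos hq0])).bddAbove_range
  refine ⟨(|B| + 1) / q ^ a, by positivity, fun n => ?_⟩
  have hshift : ((n : ℝ) + a) ^ k * q ^ n ≤ (|B| + 1) / q ^ a := by
    rw [le_div_iff₀ (by positivity)]
    calc _ = ((n + a : ℕ) : ℝ) ^ k * q ^ (n + a) := by push_cast; ring
      _ ≤ B := hB ⟨n + a, rfl⟩
      _ ≤ |B| + 1 := by linarith [le_abs_self B]
  calc ((n : ℝ) + a) ^ k * r ^ n = ((n : ℝ) + a) ^ k * q ^ n * s ^ n := by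
        rw [mul_assoc, ← mul_pow, ← hrq]
    _ ≤ (|B| + 1) / q ^ a * s ^ n := by gcongr

lemma exists_isListedBy {β : Type} {H : Hypergraph β} (hV : H.vertexSet.Finite) :
    ∃ (V : List β) (E : List (List β)), H.IsListedBy V E := by
  classical
  have hfin : ∀ s ∈ H.edgeSet, s.Finite := fun s hs =>
    hV.subset (H.subset_vertexSet_of_mem_edgeSet hs)
  have hE : H.edgeSet.Finite := hV.finite_subsets.subset fun s hs =>
    H.subset_vertexSet_of_mem_edgeSet hs
  let f : Set β → List β := fun s => if hs : s.Finite then hs.toFinset.toList else []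
  have hf : ∀ s ∈ H.edgeSet, {x | x ∈ f s} = s := by
    intro s hs
    ext x
    simp [f, hfin s hs]
  have hmap : (hE.toFinset.toList.map f).map (fun e => {x | x ∈ e}) = hE.toFinset.toList := by
    rw [List.map_map]
    exact (List.map_congr_left fun s hs => hf s (by simpa using hs)).trans (List.map_id _)
  refine ⟨hV.toFinset.toList, hE.toFinset.toList.map f, ?_, ?_, ?_, ?_, ?_⟩
  · exact hV.toFinset.nodup_toList
  · simp
  · intro e he
    obtain ⟨s, hs, rfl⟩ := List.mem_map.1 he
    simp only [f, dif_pos (hfin s (by simpa using hs)), nodup_toList]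
  · rw [hmap]
    exact hE.toFinset.nodup_toList
  · intro s
    rw [← List.mem_map (f := fun e : List β => {x | x ∈ e}), hmap, mem_toList,
      Set.Finite.mem_toFinset]

end Hypergraphs

end TransversalEnum

theorem theorem1 :
    ∃ C : ℝ, 0 < C ∧
      -- the algorithm lists every minimal transversal exactly once, in time `O(1.6755 ^ n)`
      (∀ (α : Type) [DecidableEq α] (H : Hypergraph α) (V : List α) (E : List (List α)),
        H.IsListedBy V E → H.rank ≤ 3 →
          (∀ l ∈ (TransversalEnum.enumerate V E).val, l.Nodup) ∧
          ((TransversalEnum.enumerate V E).val.map fun l => {x | x ∈ l}).Nodup ∧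
          (∀ T : Set α, H.IsMinimalTransversal T ↔
            ∃ l ∈ (TransversalEnum.enumerate V E).val, {x | x ∈ l} = T) ∧
          ((TransversalEnum.enumerate V E).time : ℝ) ≤ C * 1.6755 ^ H.vertexSet.ncard) ∧
      -- there are at most `O(1.6755 ^ n)` minimal transversals
      (∀ (α : Type) (H : Hypergraph α), H.vertexSet.Finite → H.rank ≤ 3 →
        {T | H.IsMinimalTransversal T}.Finite ∧
          ({T | H.IsMinimalTransversal T}.ncard : ℝ) ≤ C * 1.6755 ^ H.vertexSet.ncard) := by
  obtain ⟨C, hC, hpoly⟩ := TransversalEnum.exists_add_pow_mul_pow_le 45 3 (r := 67 / 40)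
    (s := 1.6755) (by norm_num) (by norm_num)
  refine ⟨3 * C + 3 / 2, by positivity, fun α _ H V E h hr => ?_, fun α H hV hr => ?_⟩
  · refine ⟨(TransversalEnum.isSolutionList_enumerate h hr).nodup,
      TransversalEnum.nodup_map_setOf_enumerate h hr,
      TransversalEnum.isMinimalTransversal_iff_exists_mem_enumerate h hr, ?_⟩
    rw [TransversalEnum.ncard_vertexSet h]
    calc _ ≤ 3 * (((V.length : ℝ) + 3) ^ 45 * (67 / 40) ^ V.length) :=
          TransversalEnum.time_enumerate_le h hr
      _ ≤ 3 * (C * 1.6755 ^ V.length) := by gcongr _ * ?_; exact_mod_cast hpoly V.length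
      _ = 3 * C * 1.6755 ^ V.length := by ring
      _ ≤ (3 * C + 3 / 2) * 1.6755 ^ V.length := by gcongr; linarith
  · classical
    obtain ⟨V, E, h⟩ := TransversalEnum.exists_isListedBy hV
    obtain ⟨hfinite, hcard⟩ := TransversalEnum.finite_setOf_isMinimalTransversal h hr
    refine ⟨hfinite, ?_⟩
    rw [TransversalEnum.ncard_vertexSet h]
    calc _ ≤ ((TransversalEnum.enumerate V E).val.length : ℝ) := by exact_mod_cast hcard
      _ ≤ 3 / 2 * (67 / 40) ^ V.length := TransversalEnum.length_enumerate_le h hr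
      _ ≤ (3 * C + 3 / 2) * 1.6755 ^ V.length := by gcongr <;> norm_num; linarith
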